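/- For a matrix $x=\begin{pmatrix}a&b\\c&d\end{pmatrix}$ put $s(x)=c$ if $c\neq 0$ and $s(x)=d$ if $c=0$. Let $h$ be the restriction to $G=\mathrm{SL}_2(\mathbb Z)$ of the Asai cocycle, which defines the universal cover of $\mathrm{SL}_2(\mathbb R)$: $h(x,y)=1$ if $s(x)>0$, $s(y)>0$, $s(xy)<0$; $h(x,y)=-1$ if $s(x)<0$, $s(y)<0$, $s(xy)>0$; and $h(x,y)=0$ otherwise. Then $h$ is a $\mathbb Z$-valued 2-cocycle on $G$ (for the trivial action), and there is exactly one function $f\colon G\to\mathbb R$ such that $f(1)=0$ and $h(x,y)=f(x)+f(y)-f(xy)$ for all $x,y\in G$; this $f$ takes integer values on $H=[G,G]$. Let $\mathcal G$ be any first-order expansion (possibly trivial) of the two-sorted structure $((\mathbb Z,+),(\mathbb Z,+,\cdot),f|_H)$, where $f|_H$ is regarded as a function from the set $H$ of matrices over the second sort to the first sort, and let $\mathcal G^*\succ\mathcal G$ be a monster model, that is, a $\kappa$-saturated and strongly $\kappa$-homogeneous elementary extension, where $\kappa>|L|+\aleph_0$ is a strong limit cardinal and $L$ is the language of $\mathcal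 G$. "Bounded" means of cardinality less than $\kappa$. Let $A=(\mathbb Z,+)$ be the first sort, $B=\{1\}\subseteq A$, $A_1^*=\bigcap_{n\ge 1} nA^*$, and let $A_0$ be the subgroup of $A$ generated by the image of $h$; a star denotes interpretation in $\mathcal G^*$. For a group $X$ definable in $\mathcal G^*$ over $B$, let $X^{00}_B$ be its smallest subgroup of bounded index that is type-definable over $B$, and $X^{000}_B$ its smallest subgroup of bounded index that is invariant under $\mathrm{Aut}(\mathcal G^*/B)$. Let $\widetilde{G}$ be the central extension of $G$ by $\mathbb Z$ defined by $h$, i.e. $\mathbb Z\times G$ with $(a,x)(b,y)=(a+b+h(x,y),xy)$. Then: (0) $h$ is $B$-definable with finite image contained in $\mathrm{dcl}(B)$, and $A_1^*$ is a subgroup of $A^*$ of bounded index, type-definable over $B$; (1) $H$ is a $B$-definable subgroup of $G$ of finite index, and $h|_{H\times H}\colon H\times H\to\mathbb Z$ is split via the $B$-definable function $f|_H\colon H\to\mathbb Z$; (2) $A_0/(A_1^*\cap A_0)$ is torsion free; (3) $(G^*)^{00}_B\subseteq H^*$, and the image of $(G^*)^{00}_B$ under the map $H^*\to A^*/A_1^*$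 induced by $f^*=(f|_H)^*$ is not contained in $A_0/A_1^*$ (the image of $A_0$ in $A^*/A_1^*$); (4) this image contains a non-trivial subgroup of $A^*/A_1^*$; and $(\widetilde{G^*})^{000}_B\neq(\widetilde{G^*})^{00}_B$. -/

import Mathlib

open FirstOrder FirstOrder.Language Cardinal

universe u v w

/-! ### Central extensions by 2-cocycles (trivial action) -/

/-- A normalised 2-cocycle on `G` with values in `A`, for the trivial action of `G` on `A`. -/
structure IsTwoCocycle {G A : Type*} [Group G] [AddCommGroup A] (h : G → G → A) : Prop where
  cocycle : ∀ x y z, h x y + h (x * y) z = h x (y * z) + h y z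
  right_one : ∀ x, h x 1 = 0
  left_one : ∀ x, h 1 x = 0

/-- The 2-cocycle `h` is split via the function `f` (trivial action). -/
def SplitsVia {G A : Type*} [Group G] [AddCommGroup A] (h : G → G → A) (f : G → A) : Prop :=
  (∀ x y, h x y = f x + f y - f (x * y)) ∧ f 1 = 0

/-- The central extension of `G` by `A` defined by the 2-cocycle `h`: the set `A × G` with
`(a, x) * (b, y) = (a + b + h x y, x * y)`. -/
@[ext]
structure CentralExt {G A : Type*} [Group G] [AddCommGroup A] {h : G → G → A}
    (hc : IsTwoCocycle h) where
  fst : A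
  snd : G

namespace CentralExt

variable {G A : Type*} [Group G] [AddCommGroup A] {h : G → G → A} {hc : IsTwoCocycle h}

instance : Mul (CentralExt hc) := ⟨fun p q => ⟨p.fst + q.fst + h p.snd q.snd, p.snd * q.snd⟩⟩

instance : One (CentralExt hc) := ⟨⟨0, 1⟩⟩

instance : Inv (CentralExt hc) := ⟨fun p => ⟨-p.fst - h p.snd⁻¹ p.snd, p.snd⁻¹⟩⟩

@[simp] theorem mul_fst (p q : CentralExt hc) :
    (p * q).fst = p.fst + q.fst + h p.snd q.snd := rfl
@[simp] theorem mul_snd (p q : CentralExt hc) : (p * q).snd = p.snd * q.snd := rfl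
@[simp] theorem one_fst : (1 : CentralExt hc).fst = 0 := rfl
@[simp] theorem one_snd : (1 : CentralExt hc).snd = 1 := rfl
@[simp] theorem inv_fst (p : CentralExt hc) : p⁻¹.fst = -p.fst - h p.snd⁻¹ p.snd := rfl
@[simp] theorem inv_snd (p : CentralExt hc) : p⁻¹.snd = p.snd⁻¹ := rfl

instance : Group (CentralExt hc) := Group.ofLeftAxioms
  (fun p q r => by
    ext
    · have := hc.cocycle p.snd q.snd r.snd
      simp only [mul_fst, mul_snd]
      calc _ = p.fst + q.fst + r.fst + (h p.snd q.snd + h (p.snd * q.snd) r.snd) := by abel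
        _ = _ := by rw [this]; abel
    · simp [mul_assoc])
  (fun p => by ext <;> simp [hc.left_one])
  (fun p => by
    ext
    · simp only [mul_fst, inv_fst, inv_snd, one_fst]; abel
    · simp)

end CentralExt

/-! ### The Asai cocycle and its splitting function on `SL₂(ℤ)` -/

/-- `SL₂` over a commutative ring. -/
abbrev SL2 (R : Type*) [CommRing R] := Matrix.SpecialLinearGroup (Fin 2) R

/-- The symbol `c(d)` of the second row `(c, d)` of a matrix: it is `c` if `c ≠ 0`, and `d` if
`c = 0`. -/
def rowSymbol {R : Type*} [CommRing R] [DecidableEq R] (g : SL2 R) : R :=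
  if g 1 0 ≠ 0 then g 1 0 else g 1 1

/-- The Asai cocycle. For `R = ℝ` it defines the universal cover of `SL₂(ℝ)`; for `R = ℤ` it is the
restriction of that cocycle to `SL₂(ℤ)`. -/
def asaiCocycle {R : Type*} [CommRing R] [LinearOrder R] (x y : SL2 R) : ℤ :=
  if 0 < rowSymbol x ∧ 0 < rowSymbol y ∧ rowSymbol (x * y) < 0 then 1
  else if rowSymbol x < 0 ∧ rowSymbol y < 0 ∧ 0 < rowSymbol (x * y) then -1
  else 0

/-- The function `f : SL₂(ℤ) → ℝ` via which the (restricted, real-valued) Asai cocycle is split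
(definite description; such a function exists and is unique). -/
noncomputable def asaiSplitting : SL2 ℤ → ℝ :=
  Classical.epsilon fun f => SplitsVia (fun x y : SL2 ℤ => (asaiCocycle x y : ℝ)) f

/-! ### Two-sorted structures

A two-sorted structure with sorts `A` and `R` is a first-order structure on the disjoint union
`A ⊕ R` in which the two sorts are named by unary predicates; operations are given by their
graphs. -/

/-- Relation symbols of the language of `((A, +), (R, +, ·), F)`. -/
inductive BaseRel : ℕ → Type
  | sortA : BaseRel 1
  | sortR : BaseRel 1
  | addA : BaseRel 3
  | addR : BaseRel 3
  | mulR : BaseRel 3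
  | split : BaseRel 5

/-- The language of the two-sorted structures `((A, +), (R, +, ·), F)`. -/
def baseLang : FirstOrder.Language.{0, 0} := ⟨fun _ => Empty, BaseRel⟩

/-- The two-sorted structure `((A, +), (R, +, ·), F)`, where `F` is (the graph of) a partial
function from `SL₂(R)` (a set of quadruples of elements of the sort `R`) to the sort `A`. -/
@[reducible]
def baseStructure (A R : Type w) [AddCommGroup A] [CommRing R] (F : SL2 R → A → Prop) :
    baseLang.Structure (A ⊕ R) where
  funMap := fun f => nomatch f
  RelMap := fun {_} r => match r with
    | .sortA => fun v => ∃ a : A, v 0 = .inl a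
    | .sortR => fun v => ∃ r : R, v 0 = .inr r
    | .addA => fun v => ∃ a b : A, v = ![.inl a, .inl b, .inl (a + b)]
    | .addR => fun v => ∃ r s : R, v = ![.inr r, .inr s, .inr (r + s)]
    | .mulR => fun v => ∃ r s : R, v = ![.inr r, .inr s, .inr (r * s)]
    | .split => fun v => ∃ (g : SL2 R) (a : A), F g a ∧
        v = ![.inr (g 0 0), .inr (g 0 1), .inr (g 1 0), .inr (g 1 1), .inl a]

/-- The given `L`-structure on `A ⊕ R` is an expansion (along `φ : baseLang →ᴸ L`) of the two-sorted
structure `((A, +), (R, +, ·), F)`. -/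
def IsExpansionOf {L : FirstOrder.Language.{u, v}} (φ : baseLang →ᴸ L) (A R : Type w) [AddCommGroup A]
    [CommRing R] [L.Structure (A ⊕ R)] (F : SL2 R → A → Prop) : Prop :=
  letI := baseStructure A R F
  φ.IsExpansionOn (A ⊕ R)

/-- The graph of the restriction of the splitting function to the commutator subgroup
`[SL₂(ℤ), SL₂(ℤ)]`, as a relation between `SL₂(ℤ)` and `ℤ`. -/
def asaiSplittingGraph (g : SL2 ℤ) (n : ℤ) : Prop :=
  g ∈ commutator (SL2 ℤ) ∧ asaiSplitting g = n

section Coordinates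

variable {A R : Type w} [AddCommGroup A] [CommRing R]

/-- An element of `A` as a tuple of elements of `A ⊕ R`. -/
def coordA (a : A) : Unit → A ⊕ R := fun _ => .inl a

/-- A matrix as a tuple of elements of the two-sorted structure. -/
def coordG (g : SL2 R) : Fin 2 × Fin 2 → A ⊕ R := fun p => .inr (g p.1 p.2)

/-- A pair in `SL₂(R) × A` as a tuple of elements of the two-sorted structure. -/
def coordGA (g : SL2 R) (a : A) : (Fin 2 × Fin 2) ⊕ Unit → A ⊕ R :=
  Sum.elim (coordG g) (coordA a)

/-- A triple in `SL₂(R) × SL₂(R) × A` as a tuple of elements of the two-sorted structure. -/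
def coordGGA (x y : SL2 R) (a : A) : (Fin 2 × Fin 2) ⊕ ((Fin 2 × Fin 2) ⊕ Unit) → A ⊕ R :=
  Sum.elim (coordG x) (coordGA y a)

/-- An element of a central extension of `SL₂(R)` by `A` as a tuple of elements of the two-sorted
structure. -/
def coordExt {h : SL2 R → SL2 R → A} (hc : IsTwoCocycle h) (p : CentralExt hc) :
    (Fin 2 × Fin 2) ⊕ Unit → A ⊕ R :=
  coordGA p.snd p.fst

end Coordinates

/-- The graph of a function `h : SL₂(R) × SL₂(R) → A` as a set of tuples of elements of the
two-sorted structure. -/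
def cocycleGraph {A R : Type w} [AddCommGroup A] [CommRing R] (h : SL2 R → SL2 R → A) :
    Set ((Fin 2 × Fin 2) ⊕ ((Fin 2 × Fin 2) ⊕ Unit) → A ⊕ R) :=
  {v | ∃ x y, v = coordGGA x y (h x y)}

/-! ### Monster models, interpretations and connected components -/

/-- `κ`-saturation: every family of sets definable over a parameter set of size `< κ` that has the
finite intersection property has a common point. -/
def IsSaturatedModel (L : FirstOrder.Language.{u, v}) (M : Type w) [L.Structure M] (κ : Cardinal.{w}) : Prop :=
  ∀ P : Set M, #P < κ → ∀ 𝒮 : Set (Set M), (∀ S ∈ 𝒮, P.Definable₁ L S) →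
    (∀ 𝒯 ⊆ 𝒮, 𝒯.Finite → (⋂₀ 𝒯).Nonempty) → (⋂₀ 𝒮).Nonempty

/-- Strong `κ`-homogeneity: every partial elementary map defined on a set of size `< κ` extends to an
automorphism. -/
def IsStronglyHomogeneous (L : FirstOrder.Language.{u, v}) (M : Type w) [L.Structure M] (κ : Cardinal.{w}) :
    Prop :=
  ∀ P : Set M, #P < κ → ∀ g : P → M,
    (∀ ψ : L.Formula P, ψ.Realize (fun p : P => (p : M)) ↔ ψ.Realize g) →
      ∃ σ : M ≃[L] M, ∀ p : P, σ p = g p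

/-- `M` is a monster model of degree `κ`: it is `κ`-saturated and strongly `κ`-homogeneous for a
strong limit cardinal `κ > |L| + ℵ₀`. Sizes `< κ` are called bounded (or small). -/
structure IsMonster (L : FirstOrder.Language.{u, v}) (M : Type w) [L.Structure M] (κ : Cardinal.{w}) :
    Prop where
  strongLimit : κ.IsStrongLimit
  aleph0_lt : ℵ₀ < κ
  card_lt : Cardinal.lift.{w} L.card < Cardinal.lift.{max u v} κ
  saturated : IsSaturatedModel L M κ
  homogeneous : IsStronglyHomogeneous L M κ

/-- The interpretation in `M` of a set `X` of tuples definable (with parameters) in `N`, for an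
elementary embedding `ι : N → M`: the set of realizations in `M` of a formula defining `X` in `N`.
By elementarity it does not depend on the formula. -/
def interpretation {L : FirstOrder.Language.{u, v}} {N : Type*} {M : Type*} [L.Structure N] [L.Structure M]
    (ι : N ↪ₑ[L] M) {α : Type*} (X : Set (α → N)) : Set (α → M) :=
  {y | ∃ ψ : L.Formula (α ⊕ N),
    (∀ x, x ∈ X ↔ ψ.Realize (Sum.elim x id)) ∧ ψ.Realize (Sum.elim y ι)}

section Components

variable (L : FirstOrder.Language.{u, v}) {M : Type w} [L.Structure M] (κ : Cardinal.{w}) (B : Set M)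
  {X : Type w} {α : Type} (e : X → α → M)

/-- Type-definability over `B` of a subset `K` of a definable set `X`, whose elements are tuples of
elements of `M` via the coordinate map `e`: `K` is an intersection of `B`-definable sets. -/
def IsTypeDefinableOver (K : Set X) : Prop :=
  ∃ 𝒮 : Set (Set (α → M)), (∀ S ∈ 𝒮, B.Definable L S) ∧ K = e ⁻¹' ⋂₀ 𝒮

/-- Invariance under `Aut(M/B)` of a subset `K` of a definable set `X`, whose elements are tuples of
elements of `M` via the coordinate map `e`. -/
def IsInvariantOver (K : Set X) : Prop :=
  ∀ σ : M ≃[L] M, (∀ b ∈ B, σ b = b) → ∀ x y : X, e y = σ ∘ e x → x ∈ K → y ∈ K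

/-- The component `X⁰⁰_B` of a definable group `X`: the smallest subgroup of bounded index which is
type-definable over `B`, i.e. the intersection of all of them. -/
def component00 [Group X] : Subgroup X :=
  sInf {K | IsTypeDefinableOver L B e (K : Set X) ∧ #(X ⧸ K) < κ}

/-- The component `X⁰⁰⁰_B` of a definable group `X`: the smallest subgroup of bounded index which is
invariant under `Aut(M/B)`, i.e. the intersection of all of them. -/
def component000 [Group X] : Subgroup X :=
  sInf {K | IsInvariantOver L B e (K : Set X) ∧ #(X ⧸ K) < κ}

end Components

/-- The intersection of the subgroups `n A`, for positive integers `n`. -/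
def divisibleCore (A : Type*) [AddCommGroup A] : AddSubgroup A :=
  ⨅ n : {n : ℕ // n ≠ 0}, (nsmulAddMonoidHom (α := A) (n : ℕ)).range

/-- The subgroup `A₀` generated by the image of the Asai cocycle of `SL₂(ℤ)`, viewed inside the sort
`A` of an elementary extension of a structure with sorts `ℤ` and `ℤ`. -/
def imageSubgroup {L : FirstOrder.Language.{u, v}} {A R : Type w} [AddCommGroup A] [L.Structure (ℤ ⊕ ℤ)]
    [L.Structure (A ⊕ R)] (ι : (ℤ ⊕ ℤ) ↪ₑ[L] (A ⊕ R)) : AddSubgroup A :=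
  AddSubgroup.closure {a | ∃ x y : SL2 ℤ, ι (.inl (asaiCocycle x y)) = .inl a}

/-- The image of a subset `K` of `SL₂(R)` under the function to `A ⧸ A₁` induced by the partial
function with graph `F`. -/
def inducedImage {A R : Type w} [AddCommGroup A] [CommRing R] (F : SL2 R → A → Prop)
    (A₁ : AddSubgroup A) (K : Set (SL2 R)) : Set (A ⧸ A₁) :=
  {q | ∃ g ∈ K, ∃ a : A, F g a ∧ QuotientAddGroup.mk a = q}

/-!
# The Asai cocycle of `SL₂(ℤ)` and connected components

*The splitting function.* The Asai cocycle measures the failure of suitable branches of `log`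
of `cz + d` to be multiplicative (`logFactor_mul`). As the modular discriminant has weight `12` and a
continuous logarithm on the upper half plane, comparing this logarithm at `z` and at `gz` gives a
function that splits the cocycle over `ℝ` (`exists_splitsVia`). Since the abelianization of
`SL₂(ℤ)` is generated by the class of `T = (1 1; 0 1)`, which has order dividing `12`, the
splitting function is unique, and modulo `ℤ` it is a homomorphism, so it is integral on the
commutator subgroup. The cocycle identity itself holds over every ordered ring
(`isTwoCocycle_asaiCocycle`): signs are compared by a Plücker relation.

*Transfer.* In an elementary extension the ring sort `R` is a discretely ordered ring, because by
Lagrange's theorem the non-negative integers are the sums of four squares. The interpretation of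
the cocycle is therefore `asaiCocycle x y • c`, where `c` is the image of `1`, and the graph of
the splitting function keeps the properties collected in `IsAsaiGraph`. A small language of
two-sorted formulas with an explicit semantics (`TwoSorted`) is translated into the given
language, and serves both for transfer and for definability over `c`.

*The components.* Let `E` be the extension of `SL₂(R)` by `A` defined by the cocycle and let `K`
be a subgroup of bounded index. As `R` is not small, the pigeonhole principle gives `r ≥ 2` for
which `K` contains the lifts of `(1 r; 0 1)` and of its conjugate `(1 0; -r 1)`. The square of the
product of these lifts has the form `(-c, p)`, and its powers are `(-k c, p ^ k)` because the
second rows of the powers of `p` stay in a cone (`lift_pow`). So `K` contains elements with first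
coordinate `k c` for every integer `k` (`exists_mem_fst_eq_zsmul`). By saturation `E⁰⁰` contains
elements whose first coordinate realizes any prescribed compatible family of standard residues
(`exists_mem_component00`). As `(a, x) ↦ a + f x` has values in `nA` on `E⁰⁰`, for all `n ≥ 1`,
the splitting function takes arbitrary compatible residues on the component of `SL₂(R)`
(`exists_mem_component00_graph`). Constant families show that its image contains the infinite
cyclic group generated by the class of `c`, and a family that does not come from an integer, the
limit of `2 ^ n!`, shows that the image is not contained in this group. Finally, the elements of
`E` with first coordinate in `ℤc` modulo the divisible core form an invariant subgroup of bounded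
index (`integralPart`), so it contains `E⁰⁰⁰`; but it does not contain `E⁰⁰`.
-/

/-! ### The cocycle identity over an ordered ring -/

section AsaiCocycle

variable {R : Type*} [CommRing R]

theorem mul_apply_one_zero (x y : SL2 R) : (x * y) 1 0 = x 1 0 * y 0 0 + x 1 1 * y 1 0 := by
  simp [Matrix.mul_apply, Fin.sum_univ_two]

theorem mul_apply_one_one (x y : SL2 R) : (x * y) 1 1 = x 1 0 * y 0 1 + x 1 1 * y 1 1 := by
  simp [Matrix.mul_apply, Fin.sum_univ_two]

/-- The Plücker relation between the lower left entries of `x`, `y`, `z` and their products; they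
are the `2 × 2` minors of the four row vectors `e`, `e z`, `e y z`, `e x y z`, where
`e = (0, 1)`. -/
theorem plucker_lower_left (x y z : SL2 R) :
    (x * y * z) 1 0 * y 1 0 + x 1 0 * z 1 0 = (x * y) 1 0 * (y * z) 1 0 := by
  have hy := y.det_coe
  rw [Matrix.det_fin_two] at hy
  simp only [mul_apply_one_zero, mul_apply_one_one]
  linear_combination (-(x 1 0 * z 1 0)) * hy

variable [LinearOrder R]

/-- The sign of the row symbol, as an integer. -/
def rowSign (g : SL2 R) : ℤ := if 0 < rowSymbol g then 1 else -1

theorem rowSign_eq_or (g : SL2 R) : rowSign g = 1 ∨ rowSign g = -1 := by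
  unfold rowSign; split_ifs <;> simp

variable [IsStrictOrderedRing R]

theorem rowSymbol_ne_zero (g : SL2 R) : rowSymbol g ≠ 0 := by
  unfold rowSymbol
  split_ifs with h
  · exact h
  · intro hd
    have hdet := g.det_coe
    rw [Matrix.det_fin_two] at hdet
    simp [not_not.mp h, hd] at hdet

theorem rowSymbol_eq (g : SL2 R) : ∃ r : R, 0 < r ∧ rowSymbol g = rowSign g * r := by
  unfold rowSign
  split_ifs with h
  · exact ⟨_, h, by simp⟩
  · refine ⟨-rowSymbol g, ?_, by simp⟩
    have := lt_of_le_of_ne (not_lt.mp h) (rowSymbol_ne_zero g)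
    linarith

theorem rowSign_eq_of_eq_mul {g : SL2 R} {e : ℤ} {r : R} (he : e = 1 ∨ e = -1) (hr : 0 < r)
    (h : rowSymbol g = e * r) : rowSign g = e := by
  unfold rowSign
  rcases he with rfl | rfl
  · rw [if_pos]; rw [h]; simpa using hr
  · rw [if_neg]; rw [h]; push_cast; linarith

/-- The cocycle as a polynomial in signs: a coboundary plus a product of three signs. -/
theorem four_mul_asaiCocycle (x y : SL2 R) :
    4 * asaiCocycle x y =
      rowSign x + rowSign y - rowSign (x * y) - rowSign x * rowSign y * rowSign (x * y) := by
  have hx := (rowSymbol_ne_zero x).lt_or_gt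
  have hy := (rowSymbol_ne_zero y).lt_or_gt
  have hxy := (rowSymbol_ne_zero (x * y)).lt_or_gt
  unfold asaiCocycle rowSign
  rcases hx with hx | hx <;> rcases hy with hy | hy <;> rcases hxy with hxy | hxy <;>
    simp [hx, hy, hxy, hx.not_gt, hy.not_gt, hxy.not_gt]

theorem rowSign_mul_of_left (x y : SL2 R) (h : x 1 0 = 0) :
    rowSign (x * y) = rowSign x * rowSign y := by
  obtain ⟨r, hr, hr'⟩ := rowSymbol_eq x
  obtain ⟨s, hs, hs'⟩ := rowSymbol_eq y
  refine rowSign_eq_of_eq_mul (r := r * s) ?_ (mul_pos hr hs) ?_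
  · rcases rowSign_eq_or x with h | h <;> rcases rowSign_eq_or y with h' | h' <;> simp [h, h']
  · have hx : rowSymbol x = x 1 1 := by simp [rowSymbol, h]
    have hne : x 1 1 ≠ 0 := hx ▸ rowSymbol_ne_zero x
    have : rowSymbol (x * y) = x 1 1 * rowSymbol y := by
      unfold rowSymbol
      rw [mul_apply_one_zero, mul_apply_one_one, h]
      by_cases hy : y 1 0 = 0 <;> simp [hy, hne]
    rw [this, ← hx, hr', hs']; push_cast; ring

theorem rowSign_mul_of_right (x y : SL2 R) (h : y 1 0 = 0) :
    rowSign (x * y) = rowSign x * rowSign y := by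
  obtain ⟨r, hr, hr'⟩ := rowSymbol_eq x
  obtain ⟨s, hs, hs'⟩ := rowSymbol_eq y
  have hy : rowSymbol y = y 1 1 := by simp [rowSymbol, h]
  have hdet : y 0 0 * y 1 1 = 1 := by
    have := y.det_coe
    rwa [Matrix.det_fin_two, h, mul_zero, sub_zero] at this
  have hsq : (rowSign y : R) * rowSign y = 1 := by
    rcases rowSign_eq_or y with h | h <;> simp [h]
  -- the two diagonal entries of an upper triangular matrix have the same sign
  obtain ⟨t, ht, ht'⟩ : ∃ t : R, 0 < t ∧ y 0 0 = rowSign y * t := by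
    refine ⟨rowSign y * y 0 0, ?_, by rw [← mul_assoc, hsq, one_mul]⟩
    rw [← hy, hs'] at hdet
    have h1 : 0 < (rowSign y * y 0 0) * s := by
      have : (rowSign y * y 0 0) * s = 1 := by linear_combination hdet
      rw [this]; exact one_pos
    exact pos_of_mul_pos_left h1 hs.le
  have he : rowSign x * rowSign y = 1 ∨ rowSign x * rowSign y = -1 := by
    rcases rowSign_eq_or x with h | h <;> rcases rowSign_eq_or y with h' | h' <;> simp [h, h']
  have h0 : y 0 0 ≠ 0 := left_ne_zero_of_mul (hdet ▸ one_ne_zero)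
  by_cases hx : x 1 0 = 0
  · refine rowSign_eq_of_eq_mul (r := r * s) he (mul_pos hr hs) ?_
    have hx' : rowSymbol x = x 1 1 := by simp [rowSymbol, hx]
    have : rowSymbol (x * y) = rowSymbol x * rowSymbol y := by
      rw [hx', hy]
      unfold rowSymbol
      rw [mul_apply_one_zero, mul_apply_one_one, h, hx]
      simp
    rw [this, hr', hs']; push_cast; ring
  · refine rowSign_eq_of_eq_mul (r := r * t) he (mul_pos hr ht) ?_
    have hx' : rowSymbol x = x 1 0 := by simp [rowSymbol, hx]
    have : rowSymbol (x * y) = rowSymbol x * y 0 0 := by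
      rw [hx']
      unfold rowSymbol
      rw [mul_apply_one_zero, mul_apply_one_one, h]
      simp [hx, h0]
    rw [this, hr', ht']; push_cast; ring

theorem rowSymbol_eq_lower_left {g : SL2 R} (h : g 1 0 ≠ 0) :
    ∃ r : R, 0 < r ∧ g 1 0 = rowSign g * r := by
  obtain ⟨r, hr, h'⟩ := rowSymbol_eq g
  exact ⟨r, hr, by rw [← h']; simp [rowSymbol, h]⟩

theorem asaiCocycle_cocycle (x y z : SL2 R) :
    asaiCocycle x y + asaiCocycle (x * y) z = asaiCocycle x (y * z) + asaiCocycle y z := by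
  have h1 := four_mul_asaiCocycle x y
  have h2 := four_mul_asaiCocycle (x * y) z
  have h3 := four_mul_asaiCocycle x (y * z)
  have h4 := four_mul_asaiCocycle y z
  rw [← mul_assoc] at h3
  -- the coboundary terms cancel; an identity between six signs is left
  suffices h : rowSign (x * y) * (rowSign x * rowSign y + rowSign z * rowSign (x * y * z)) =
      rowSign (y * z) * (rowSign x * rowSign (x * y * z) + rowSign y * rowSign z) by linarith
  have ha := rowSign_eq_or x
  have hb := rowSign_eq_or y
  have hp := rowSign_eq_or z
  have hq := rowSign_eq_or (x * y)
  have hr := rowSign_eq_or (y * z)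
  have ht := rowSign_eq_or (x * y * z)
  -- the identity of signs follows from this implication, which is what the Plücker relation gives
  have key : rowSign (x * y * z) * rowSign y = rowSign x * rowSign z →
      rowSign (x * y) * rowSign (y * z) = rowSign (x * y * z) * rowSign y := by
    by_cases hx : x 1 0 = 0
    · have e1 := rowSign_mul_of_left x y hx
      have e2 := rowSign_mul_of_left x (y * z) hx
      rw [← mul_assoc] at e2
      rw [e2, e1]
      intro; ring
    by_cases hy : y 1 0 = 0
    · have e1 := rowSign_mul_of_right x y hy
      have e2 := rowSign_mul_of_left y z hy
      rw [e2, e1]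
      intro h
      rw [h]
      rcases hb with hb | hb <;> rw [hb] <;> ring
    by_cases hz : z 1 0 = 0
    · have e1 := rowSign_mul_of_right y z hz
      have e2 := rowSign_mul_of_right (x * y) z hz
      rw [e2, e1]
      intro; ring
    obtain ⟨a, ha0, ha'⟩ := rowSymbol_eq_lower_left hx
    obtain ⟨b, hb0, hb'⟩ := rowSymbol_eq_lower_left hy
    obtain ⟨p, hp0, hp'⟩ := rowSymbol_eq_lower_left hz
    have hap := mul_pos ha0 hp0
    -- in the remaining cases the relation between the entries compares the signs
    have rel := plucker_lower_left x y z
    obtain ⟨t, ht0, ht'⟩ : ∃ t : R, 0 ≤ t ∧ (x * y * z) 1 0 = rowSign (x * y * z) * t := by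
      by_cases h : (x * y * z) 1 0 = 0
      · exact ⟨0, le_rfl, by rw [h, mul_zero]⟩
      · obtain ⟨t, h0, h'⟩ := rowSymbol_eq_lower_left h
        exact ⟨t, h0.le, h'⟩
    obtain ⟨q, hq0, hq'⟩ : ∃ q : R, 0 ≤ q ∧ (x * y) 1 0 = rowSign (x * y) * q := by
      by_cases h : (x * y) 1 0 = 0
      · exact ⟨0, le_rfl, by rw [h, mul_zero]⟩
      · obtain ⟨t, h0, h'⟩ := rowSymbol_eq_lower_left h
        exact ⟨t, h0.le, h'⟩
    obtain ⟨r, hr0, hr'⟩ : ∃ r : R, 0 ≤ r ∧ (y * z) 1 0 = rowSign (y * z) * r := by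
      by_cases h : (y * z) 1 0 = 0
      · exact ⟨0, le_rfl, by rw [h, mul_zero]⟩
      · obtain ⟨t, h0, h'⟩ := rowSymbol_eq_lower_left h
        exact ⟨t, h0.le, h'⟩
    have htb := mul_nonneg ht0 hb0.le
    have hqr := mul_nonneg hq0 hr0
    rw [ha', hb', hp', ht', hq', hr'] at rel
    have rel' : ((rowSign (x * y * z) * rowSign y : ℤ) : R) * (t * b) +
        ((rowSign x * rowSign z : ℤ) : R) * (a * p) =
        ((rowSign (x * y) * rowSign (y * z) : ℤ) : R) * (q * r) := by
      push_cast; linear_combination rel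
    have pm : ∀ {e f : ℤ}, (e = 1 ∨ e = -1) → (f = 1 ∨ f = -1) → (e * f = 1 ∨ e * f = -1) := by
      rintro _ _ (rfl | rfl) (rfl | rfl) <;> simp
    have pα := pm ht hb
    have pβ := pm ha hp
    have pγ := pm hq hr
    intro h
    rw [← h] at rel'
    rcases pα with h' | h' <;> rcases pγ with h'' | h'' <;> rw [h', h''] at rel' <;>
      rw [h', h''] <;> push_cast at rel' <;> exfalso <;> linarith
  rcases ha with ha | ha <;> rcases hb with hb | hb <;> rcases hp with hp | hp <;>
    rcases hq with hq | hq <;> rcases hr with hr | hr <;> rcases ht with ht | ht <;>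
    rw [ha, hb, hp, hq, hr, ht] at key ⊢ <;> revert key <;> decide

theorem isTwoCocycle_asaiCocycle : IsTwoCocycle (asaiCocycle : SL2 R → SL2 R → ℤ) where
  cocycle := asaiCocycle_cocycle
  right_one x := by
    unfold asaiCocycle
    rw [mul_one, if_neg (fun h => h.1.not_gt h.2.2), if_neg (fun h => h.1.not_gt h.2.2)]
  left_one x := by
    unfold asaiCocycle
    rw [one_mul, if_neg (fun h => h.2.1.not_gt h.2.2), if_neg (fun h => h.2.1.not_gt h.2.2)]

end AsaiCocycle

/-! ### Splitting by a logarithm of the modular discriminant -/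

section Splitting

open UpperHalfPlane

/-- The automorphy factor `c z + d` of a matrix with second row `(c, d)`. -/
noncomputable def automorphyFactor (g : SL2 ℤ) (z : ℍ) : ℂ := (g 1 0 : ℂ) * z + (g 1 1 : ℂ)

theorem automorphyFactor_eq_denom (g : SL2 ℤ) (z : ℍ) :
    automorphyFactor g z = denom (g : GL (Fin 2) ℝ) z := by
  simp [automorphyFactor, denom]

theorem automorphyFactor_ne_zero (g : SL2 ℤ) (z : ℍ) : automorphyFactor g z ≠ 0 := by
  rw [automorphyFactor_eq_denom]; exact denom_ne_zero _ z

theorem automorphyFactor_mul (x y : SL2 ℤ) (z : ℍ) :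
    automorphyFactor (x * y) z = automorphyFactor x (y • z) * automorphyFactor y z := by
  have hy := automorphyFactor_ne_zero y z
  have hz : ((y • z : ℍ) : ℂ) * automorphyFactor y z = (y 0 0 : ℂ) * z + (y 0 1 : ℂ) := by
    rw [UpperHalfPlane.coe_specialLinearGroup_apply]
    simp only [automorphyFactor] at hy ⊢
    simpa using div_mul_cancel₀ ((y 0 0 : ℂ) * z + (y 0 1 : ℂ)) hy
  have : automorphyFactor x (y • z) * automorphyFactor y z =
      (x 1 0 : ℂ) * (((y • z : ℍ) : ℂ) * automorphyFactor y z) +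
        (x 1 1 : ℂ) * automorphyFactor y z := by
    simp only [automorphyFactor]; ring
  rw [this, hz]
  simp only [automorphyFactor, mul_apply_one_zero, mul_apply_one_one]
  push_cast
  ring

theorem discriminant_smul (g : SL2 ℤ) (z : ℍ) :
    ModularForm.discriminant (g • z) = automorphyFactor g z ^ 12 * ModularForm.discriminant z := by
  have h := SlashInvariantForm.slash_action_eqn' CuspForm.discriminant
    (γ := (g : GL (Fin 2) ℝ)) (MonoidHom.mem_range.mpr ⟨g, rfl⟩) z
  rw [automorphyFactor_eq_denom]
  exact_mod_cast h

/-- A continuous logarithm of the modular discriminant on the upper half plane. -/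
theorem exists_log_discriminant :
    ∃ l : C(ℍ, ℂ), ∀ z, Complex.exp (l z) = ModularForm.discriminant z := by
  let F : C(ℍ, ℂ) := ⟨CuspForm.discriminant, (CuspFormClass.holo CuspForm.discriminant).continuous⟩
  have hF : ∀ z, F z = ModularForm.discriminant z := fun z => rfl
  obtain ⟨l, ⟨-, hl⟩, -⟩ := Complex.isCoveringMapOn_exp.existsUnique_continuousMap_lifts F
    (a₀ := I) (e₀ := Complex.log (F I))
    (Complex.exp_log (by rw [hF]; exact ModularForm.discriminant_ne_zero I))
    (fun z => by rw [hF]; exact ModularForm.discriminant_ne_zero z)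
  exact ⟨l, fun z => congrFun hl z⟩

/-- The branch of `log (c z + d)` whose imaginary part lies in `[0, π)` if the row symbol of the
matrix is positive, and in `[-π, 0)` if it is negative. -/
noncomputable def logFactor (g : SL2 ℤ) (z : ℍ) : ℂ :=
  if 0 < rowSymbol g then Complex.log (automorphyFactor g z)
  else Complex.log (-automorphyFactor g z) - Real.pi * Complex.I

theorem exp_logFactor (g : SL2 ℤ) (z : ℍ) :
    Complex.exp (logFactor g z) = automorphyFactor g z := by
  have h := automorphyFactor_ne_zero g z
  unfold logFactor
  split_ifs
  · exact Complex.exp_log h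
  · rw [Complex.exp_sub, Complex.exp_log (neg_ne_zero.mpr h), Complex.exp_pi_mul_I]; simp

/-- After normalising the sign, `c z + d` is in the open upper half plane or is a positive real. -/
theorem rowSign_mul_automorphyFactor (g : SL2 ℤ) (z : ℍ) :
    0 < ((rowSign g : ℂ) * automorphyFactor g z).im ∨
      (((rowSign g : ℂ) * automorphyFactor g z).im = 0 ∧
        0 < ((rowSign g : ℂ) * automorphyFactor g z).re) := by
  obtain ⟨r, hr, h⟩ := rowSymbol_eq g
  simp only [Int.cast_id] at h
  have hs : rowSign g * rowSymbol g = r := by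
    rw [h]; rcases rowSign_eq_or g with h | h <;> rw [h] <;> ring
  have him : ((rowSign g : ℂ) * automorphyFactor g z).im =
      ((rowSign g * g 1 0 : ℤ) : ℝ) * z.im := by
    simp [automorphyFactor]; ring
  have hre : ((rowSign g : ℂ) * automorphyFactor g z).re =
      ((rowSign g * g 1 0 : ℤ) : ℝ) * z.re + ((rowSign g * g 1 1 : ℤ) : ℝ) := by
    simp [automorphyFactor]; ring
  rw [him, hre]
  unfold rowSymbol at hs
  by_cases hc : g 1 0 = 0
  · right
    simp only [hc, ne_eq, not_true_eq_false, if_false] at hs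
    rw [hc, hs]
    simpa using hr
  · left
    simp only [ne_eq, hc, not_false_eq_true, if_true] at hs
    rw [hs]
    exact mul_pos (by exact_mod_cast hr) z.im_pos

theorem mem_slitPlane_rowSign_mul (g : SL2 ℤ) (z : ℍ) :
    (rowSign g : ℂ) * automorphyFactor g z ∈ Complex.slitPlane := by
  rw [Complex.mem_slitPlane_iff]
  rcases rowSign_mul_automorphyFactor g z with h | h
  · exact .inr h.ne'
  · exact .inl h.2

theorem logFactor_eq (g : SL2 ℤ) (z : ℍ) :
    logFactor g z = Complex.log ((rowSign g : ℂ) * automorphyFactor g z) -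
      (if 0 < rowSymbol g then 0 else Real.pi) * Complex.I := by
  unfold logFactor rowSign
  split_ifs <;> simp

theorem continuous_logFactor (g : SL2 ℤ) : Continuous (logFactor g) := by
  have : logFactor g = fun z : ℍ => Complex.log ((rowSign g : ℂ) * automorphyFactor g z) -
      (if 0 < rowSymbol g then 0 else Real.pi) * Complex.I := funext (logFactor_eq g)
  rw [this]
  refine Continuous.sub (Continuous.clog ?_ (mem_slitPlane_rowSign_mul g)) continuous_const
  unfold automorphyFactor
  have := UpperHalfPlane.continuous_coe
  fun_prop

theorem arg_rowSign_mul (g : SL2 ℤ) (z : ℍ) :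
    0 ≤ ((rowSign g : ℂ) * automorphyFactor g z).arg ∧
      ((rowSign g : ℂ) * automorphyFactor g z).arg < Real.pi := by
  have h := rowSign_mul_automorphyFactor g z
  refine ⟨Complex.arg_nonneg_iff.mpr ?_, Complex.arg_lt_pi_iff.mpr ?_⟩
  · rcases h with h | h
    · exact h.le
    · exact h.1.ge
  · rcases h with h | h
    · exact .inr h.ne'
    · exact .inl h.2.le

theorem logFactor_im_of_pos {g : SL2 ℤ} (h : 0 < rowSymbol g) (z : ℍ) :
    0 ≤ (logFactor g z).im ∧ (logFactor g z).im < Real.pi := by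
  rw [logFactor_eq, if_pos h, Complex.sub_im, Complex.log_im]
  simpa only [Complex.ofReal_zero, zero_mul, Complex.zero_im, sub_zero] using arg_rowSign_mul g z

theorem logFactor_im_of_neg {g : SL2 ℤ} (h : rowSymbol g < 0) (z : ℍ) :
    -Real.pi ≤ (logFactor g z).im ∧ (logFactor g z).im < 0 := by
  rw [logFactor_eq, if_neg h.not_gt]
  have := arg_rowSign_mul g z
  simp only [Complex.sub_im, Complex.log_im, Complex.mul_im, Complex.ofReal_re, Complex.I_im,
    Complex.ofReal_im, Complex.I_re]
  constructor <;> linarith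

/-- The Asai cocycle measures the failure of the chosen branches of `log (c z + d)` to be
multiplicative. -/
theorem logFactor_mul (x y : SL2 ℤ) (z : ℍ) :
    logFactor x (y • z) + logFactor y z - logFactor (x * y) z =
      (asaiCocycle x y : ℂ) * (2 * Real.pi * Complex.I) := by
  obtain ⟨n, hn⟩ : ∃ n : ℤ, logFactor x (y • z) + logFactor y z - logFactor (x * y) z =
      n * (2 * Real.pi * Complex.I) := by
    rw [← Complex.exp_eq_one_iff, Complex.exp_sub, Complex.exp_add, exp_logFactor, exp_logFactor,
      exp_logFactor, automorphyFactor_mul]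
    exact div_self (mul_ne_zero (automorphyFactor_ne_zero _ _) (automorphyFactor_ne_zero _ _))
  -- the integer `n` is determined by the bounds on the imaginary parts
  rw [hn]
  congr 2
  have him : (logFactor x (y • z)).im + (logFactor y z).im - (logFactor (x * y) z).im =
      n * (2 * Real.pi) := by
    have := congrArg Complex.im hn
    simpa using this
  have hpi := Real.pi_pos
  have bound : ∀ {m : ℤ}, (m - 1 : ℝ) * (2 * Real.pi) < n * (2 * Real.pi) →
      n * (2 * Real.pi) < (m + 1 : ℝ) * (2 * Real.pi) → n = m := by
    intro m h1 h2
    have h1' := lt_of_mul_lt_mul_right h1 (by positivity)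
    have h2' := lt_of_mul_lt_mul_right h2 (by positivity)
    have h3 : m - 1 < n := by exact_mod_cast h1'
    have h4 : n < m + 1 := by exact_mod_cast h2'
    omega
  unfold asaiCocycle
  rcases (rowSymbol_ne_zero x).lt_or_gt with hx | hx <;>
  rcases (rowSymbol_ne_zero y).lt_or_gt with hy | hy <;>
  rcases (rowSymbol_ne_zero (x * y)).lt_or_gt with hxy | hxy <;>
  simp only [hx, hy, hxy, hx.not_gt, hy.not_gt, hxy.not_gt, and_true, and_false,
    if_true, if_false] <;>
  first
  | have ax := logFactor_im_of_pos hx (y • z)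
  | have ax := logFactor_im_of_neg hx (y • z)
  all_goals
    first
    | have ay := logFactor_im_of_pos hy z
    | have ay := logFactor_im_of_neg hy z
  all_goals
    first
    | have axy := logFactor_im_of_pos hxy z
    | have axy := logFactor_im_of_neg hxy z
  all_goals
    apply bound <;> push_cast <;> linarith

/-- Comparing a logarithm of the discriminant at `z` and at `g z` splits the Asai cocycle. -/
theorem exists_splitsVia :
    ∃ f : SL2 ℤ → ℝ, SplitsVia (fun x y : SL2 ℤ => (asaiCocycle x y : ℝ)) f := by
  obtain ⟨l, hl⟩ := exists_log_discriminant
  let D : SL2 ℤ → ℍ → ℂ := fun g z => l (g • z) - l z - 12 * logFactor g z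
  have hD : ∀ g z, ∃ n : ℤ, D g z = n * (2 * Real.pi * Complex.I) := by
    intro g z
    rw [← Complex.exp_eq_one_iff]
    simp only [D]
    rw [Complex.exp_sub, Complex.exp_sub, hl, hl, discriminant_smul,
      show (12 : ℂ) * logFactor g z = ((12 : ℕ) : ℂ) * logFactor g z by norm_num,
      Complex.exp_nat_mul, exp_logFactor]
    have h1 := automorphyFactor_ne_zero g z
    have h2 := ModularForm.discriminant_ne_zero z
    field_simp
  choose N hN using hD
  -- an integer-valued continuous function on the upper half plane is constant
  have hconst : ∀ g z w, N g z = N g w := by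
    intro g
    have hpi : (2 * Real.pi * Complex.I : ℂ) ≠ 0 := Complex.two_pi_I_ne_zero
    have hc : Continuous fun z => ((N g z : ℤ) : ℝ) := by
      have : (fun z => ((N g z : ℤ) : ℝ)) = fun z => (D g z / (2 * Real.pi * Complex.I)).re := by
        funext z
        rw [hN, mul_div_assoc, div_self hpi, mul_one, Complex.intCast_re]
      rw [this]
      have h1 := continuous_logFactor g
      have h2 : Continuous fun z : ℍ => g • z := continuous_const_smul (g : GL (Fin 2) ℝ)
      simp only [D]
      fun_prop
    have hc' : Continuous (N g) :=
      Int.isClosedEmbedding_coe_real.isEmbedding.continuous_iff.mpr hc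
    exact fun z w => PreconnectedSpace.constant inferInstance hc'
  have hadd : ∀ x y, (N x I : ℝ) + N y I - N (x * y) I = -12 * asaiCocycle x y := by
    intro x y
    have h := logFactor_mul x y I
    have h1 := hN x (y • I)
    have h2 := hN y I
    have h3 := hN (x * y) I
    rw [hconst x _ I] at h1
    have hpi : (2 * Real.pi * Complex.I : ℂ) ≠ 0 := Complex.two_pi_I_ne_zero
    have : (N x I + N y I - N (x * y) I : ℂ) = -12 * asaiCocycle x y := by
      apply mul_right_cancel₀ hpi
      rw [sub_mul, add_mul, ← h1, ← h2, ← h3, mul_assoc, ← h]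
      simp only [D, mul_smul]
      ring
    exact_mod_cast this
  have hone : (asaiCocycle (1 : SL2 ℤ) 1 : ℤ) = 0 := isTwoCocycle_asaiCocycle.left_one 1
  refine ⟨fun g => -(N g I : ℝ) / 12, fun x y => ?_, ?_⟩
  · have := hadd x y
    linarith
  · have := hadd 1 1
    rw [hone] at this
    norm_num at this
    simpa using this

end Splitting

/-! ### Unipotent matrices and the abelianization of the modular group -/

section Unipotent

variable {R : Type*} [CommRing R]

/-- The upper unipotent matrix with upper right entry `r`. -/
def upperUnip (r : R) : SL2 R := ⟨!![1, r; 0, 1], by simp⟩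

/-- The matrix of the quarter turn, with rows `(0, -1)` and `(1, 0)`. -/
def weyl : SL2 R := ⟨!![0, -1; 1, 0], by simp⟩

theorem coe_upperUnip (r : R) :
    (upperUnip r : Matrix (Fin 2) (Fin 2) R) = !![1, r; 0, 1] := rfl

theorem coe_weyl : ((weyl : SL2 R) : Matrix (Fin 2) (Fin 2) R) = !![0, -1; 1, 0] := rfl

theorem upperUnip_add (r s : R) : upperUnip (r + s) = upperUnip r * upperUnip s := by
  ext i j
  fin_cases i <;> fin_cases j <;> simp [coe_upperUnip, add_comm]

theorem upperUnip_zero : upperUnip (0 : R) = 1 := by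
  ext i j
  fin_cases i <;> fin_cases j <;> simp [coe_upperUnip]

theorem upperUnip_neg (r : R) : upperUnip (-r) = (upperUnip r)⁻¹ := by
  rw [eq_inv_iff_mul_eq_one, ← upperUnip_add, neg_add_cancel, upperUnip_zero]

theorem upperUnip_zpow (r : R) (n : ℤ) : upperUnip r ^ n = upperUnip (n * r) := by
  have hn : ∀ n : ℕ, upperUnip r ^ n = upperUnip (n * r) := by
    intro n
    induction n with
    | zero => simp [upperUnip_zero]
    | succ n ih => rw [pow_succ, ih, ← upperUnip_add]; congr 1; push_cast; ring
  obtain ⟨n, rfl | rfl⟩ := n.eq_nat_or_neg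
  · simpa using hn n
  · rw [zpow_neg, zpow_natCast, hn, ← upperUnip_neg]; congr 1; push_cast; ring

theorem coe_weyl_inv : ((weyl⁻¹ : SL2 R) : Matrix (Fin 2) (Fin 2) R) = !![0, 1; -1, 0] := by
  rw [Matrix.SpecialLinearGroup.coe_inv]
  simp [coe_weyl, Matrix.adjugate_fin_two]

theorem coe_weyl_conj (r : R) :
    ((weyl * upperUnip r * weyl⁻¹ : SL2 R) : Matrix (Fin 2) (Fin 2) R) = !![1, 0; -r, 1] := by
  rw [Matrix.SpecialLinearGroup.coe_mul, coe_weyl_inv, Matrix.SpecialLinearGroup.coe_mul]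
  simp [coe_weyl, coe_upperUnip]

variable [LinearOrder R]

theorem rowSymbol_upperUnip (r : R) : rowSymbol (upperUnip r) = 1 := by
  simp [rowSymbol, coe_upperUnip]

variable [IsStrictOrderedRing R]

theorem rowSymbol_weyl : rowSymbol (weyl : SL2 R) = 1 := by
  simp [rowSymbol, coe_weyl]

theorem rowSymbol_weyl_upperUnip (r : R) : rowSymbol (weyl * upperUnip r) = 1 := by
  unfold rowSymbol
  rw [mul_apply_one_zero, mul_apply_one_one]
  simp [coe_weyl, coe_upperUnip]

theorem rowSymbol_weyl_inv : rowSymbol (weyl⁻¹ : SL2 R) = -1 := by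
  unfold rowSymbol
  rw [coe_weyl_inv]
  simp

theorem asaiCocycle_upperUnip (r s : R) : asaiCocycle (upperUnip r) (upperUnip s) = 0 := by
  rw [asaiCocycle, ← upperUnip_add]
  simp [rowSymbol_upperUnip, zero_lt_one.not_gt]

theorem asaiCocycle_weyl_upperUnip (r : R) : asaiCocycle weyl (upperUnip r) = 0 := by
  simp [asaiCocycle, rowSymbol_weyl, rowSymbol_weyl_upperUnip, zero_lt_one.not_gt]

theorem asaiCocycle_weyl_upperUnip_weyl_inv (r : R) :
    asaiCocycle (weyl * upperUnip r) weyl⁻¹ = 0 := by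
  simp [asaiCocycle, rowSymbol_weyl_upperUnip, rowSymbol_weyl_inv, zero_lt_one.not_gt]

theorem asaiCocycle_weyl_inv_weyl : asaiCocycle (weyl⁻¹ : SL2 R) weyl = 0 := by
  simp [asaiCocycle, rowSymbol_weyl, rowSymbol_weyl_inv, zero_lt_one.not_gt]

end Unipotent

section Modular

theorem closure_weyl_upperUnip : Subgroup.closure {weyl, upperUnip (1 : ℤ)} = ⊤ :=
  SpecialLinearGroup.SL2Z_generators

theorem weyl_pow_four : (weyl : SL2 ℤ) ^ 4 = 1 := by decide

theorem weyl_mul_upperUnip_pow_three : (weyl * upperUnip (1 : ℤ)) ^ 3 = weyl ^ 2 := by decide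

theorem map_weyl_mul_map_upperUnip {C : Type*} [CommGroup C] (ψ : SL2 ℤ →* C) :
    ψ weyl * ψ (upperUnip 1) ^ 3 = 1 := by
  have h := congrArg ψ weyl_mul_upperUnip_pow_three
  rw [map_pow, map_pow, map_mul, mul_pow] at h
  have : ψ weyl ^ 2 * (ψ weyl * ψ (upperUnip 1) ^ 3) = ψ weyl ^ 2 * 1 := by
    rw [mul_one, ← mul_assoc, ← pow_succ]; exact h
  exact mul_left_cancel this

theorem map_upperUnip_pow_twelve {C : Type*} [CommGroup C] (ψ : SL2 ℤ →* C) :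
    ψ (upperUnip 1) ^ 12 = 1 := by
  have h := map_weyl_mul_map_upperUnip ψ
  have h4 : ψ weyl ^ 4 = 1 := by rw [← map_pow, weyl_pow_four, map_one]
  have h' := congrArg (· ^ 4) h
  simp only [mul_pow, h4, one_mul, one_pow, ← pow_mul] at h'
  exact h'

/-- The image of `SL₂(ℤ)` in an abelian group is generated by the image of `upperUnip 1`, whose
order divides twelve. -/
theorem exists_map_mul_map_upperUnip_pow {C : Type*} [CommGroup C] (ψ : SL2 ℤ →* C) (g : SL2 ℤ) :
    ∃ i < 12, ψ (g * upperUnip 1 ^ i) = 1 := by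
  have hz : ψ g ∈ Subgroup.zpowers (ψ (upperUnip 1)) := by
    have : Subgroup.closure {weyl, upperUnip (1 : ℤ)} ≤
        (Subgroup.zpowers (ψ (upperUnip 1))).comap ψ := by
      rw [Subgroup.closure_le]
      rintro x (rfl | rfl)
      · exact ⟨-3, by
          simp only
          rw [zpow_neg, zpow_ofNat]
          exact (eq_inv_of_mul_eq_one_left (map_weyl_mul_map_upperUnip ψ)).symm⟩
      · exact Subgroup.mem_zpowers _
    rw [closure_weyl_upperUnip] at this
    exact this (Subgroup.mem_top g)
  obtain ⟨k, hk⟩ := hz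
  simp only at hk
  refine ⟨((-k) % 12).toNat, by omega, ?_⟩
  rw [map_mul, map_pow, ← hk, ← zpow_natCast, Int.toNat_of_nonneg (by omega), ← zpow_add]
  have : k + -k % 12 = 12 * ((k + -k % 12) / 12) := by omega
  rw [this, zpow_mul]
  have h12 := map_upperUnip_pow_twelve ψ
  rw [show (ψ (upperUnip 1)) ^ (12 : ℤ) = 1 by exact_mod_cast h12, one_zpow]

theorem mem_commutator_iff (g : SL2 ℤ) :
    g ∈ commutator (SL2 ℤ) ↔ Abelianization.of g = 1 := by
  rw [← Abelianization.ker_of, MonoidHom.mem_ker]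

/-- The commutator subgroup has at most twelve cosets, represented by powers of a unipotent. -/
theorem exists_mul_upperUnip_mem_commutator (g : SL2 ℤ) :
    ∃ i < 12, g * upperUnip 1 ^ i ∈ commutator (SL2 ℤ) := by
  obtain ⟨i, hi, h⟩ := exists_map_mul_map_upperUnip_pow (Abelianization.of (G := SL2 ℤ)) g
  exact ⟨i, hi, (mem_commutator_iff _).mpr h⟩

theorem finiteIndex_commutator : (commutator (SL2 ℤ)).FiniteIndex := by
  have : Function.Surjective fun i : Fin 12 =>
      (QuotientGroup.mk (upperUnip 1 ^ (i : ℕ)) : SL2 ℤ ⧸ commutator (SL2 ℤ)) := by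
    intro q
    obtain ⟨g, rfl⟩ := QuotientGroup.mk_surjective q
    obtain ⟨i, hi, h⟩ := exists_mul_upperUnip_mem_commutator g⁻¹
    refine ⟨⟨i, hi⟩, ?_⟩
    rw [eq_comm, QuotientGroup.eq]
    exact h
  have := Finite.of_surjective _ this
  exact Subgroup.finiteIndex_of_finite_quotient

theorem SplitsVia.asai_mul {f : SL2 ℤ → ℝ}
    (hf : SplitsVia (fun x y : SL2 ℤ => (asaiCocycle x y : ℝ)) f) (x y : SL2 ℤ) :
    f (x * y) = f x + f y - asaiCocycle x y := by
  have := hf.1 x y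
  linarith

/-- Since the cocycle is integral, `f` modulo `ℤ` is a homomorphism to an abelian group, hence
trivial on commutators. -/
theorem SplitsVia.asai_exists_int {f : SL2 ℤ → ℝ}
    (hf : SplitsVia (fun x y : SL2 ℤ => (asaiCocycle x y : ℝ)) f) {g : SL2 ℤ}
    (hg : g ∈ commutator (SL2 ℤ)) : ∃ n : ℤ, f g = n := by
  let ψ : SL2 ℤ →* Multiplicative (ℝ ⧸ AddSubgroup.zmultiples (1 : ℝ)) :=
    { toFun := fun g => Multiplicative.ofAdd (QuotientAddGroup.mk (f g))
      map_one' := by simp [hf.2]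
      map_mul' := fun a b => by
        rw [hf.asai_mul, ← ofAdd_add, ← QuotientAddGroup.mk_add]
        congr 1
        rw [QuotientAddGroup.eq, AddSubgroup.mem_zmultiples_iff]
        exact ⟨asaiCocycle a b, by simp⟩ }
  have h : ψ g = 1 := Abelianization.commutator_subset_ker ψ hg
  have h' : (QuotientAddGroup.mk (f g) : ℝ ⧸ AddSubgroup.zmultiples (1 : ℝ)) = 0 :=
    Multiplicative.ofAdd.injective h
  rw [QuotientAddGroup.eq_zero_iff, AddSubgroup.mem_zmultiples_iff] at h'
  obtain ⟨n, hn⟩ := h'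
  exact ⟨n, by rw [← hn]; simp⟩

/-- The difference of two splitting functions is a homomorphism to `ℝ`, which is trivial because the
abelianization of `SL₂(ℤ)` is finite. -/
theorem SplitsVia.asai_unique {f : SL2 ℤ → ℝ}
    (hf : SplitsVia (fun x y : SL2 ℤ => (asaiCocycle x y : ℝ)) f) {f' : SL2 ℤ → ℝ}
    (hf' : SplitsVia (fun x y : SL2 ℤ => (asaiCocycle x y : ℝ)) f') : f' = f := by
  let ψ : SL2 ℤ →* Multiplicative ℝ :=
    { toFun := fun g => Multiplicative.ofAdd (f' g - f g)
      map_one' := by simp [hf.2, hf'.2]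
      map_mul' := fun a b => by
        rw [hf.asai_mul, hf'.asai_mul, ← ofAdd_add]
        congr 1
        ring }
  funext g
  obtain ⟨i, -, h⟩ := exists_map_mul_map_upperUnip_pow ψ g
  have ht : ψ (upperUnip 1) = 1 := by
    have h12 := congrArg Multiplicative.toAdd (map_upperUnip_pow_twelve ψ)
    rw [toAdd_pow, toAdd_one, smul_eq_zero_iff_right (by norm_num)] at h12
    exact Multiplicative.toAdd.injective h12
  rw [map_mul, map_pow, ht, one_pow, mul_one] at h
  have : f' g - f g = 0 := Multiplicative.ofAdd.injective h
  linarith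

theorem existsUnique_splitsVia :
    ∃! f : SL2 ℤ → ℝ, SplitsVia (fun x y : SL2 ℤ => (asaiCocycle x y : ℝ)) f := by
  obtain ⟨f, hf⟩ := exists_splitsVia
  exact ⟨f, hf, fun f' hf' => hf.asai_unique hf'⟩

theorem splitsVia_asaiSplitting :
    SplitsVia (fun x y : SL2 ℤ => (asaiCocycle x y : ℝ)) asaiSplitting :=
  Classical.epsilon_spec exists_splitsVia

end Modular

/-! ### Two-sorted formulas -/

section TwoSortedFormulas

/-- Ring terms in variables indexed by `β`. -/
inductive RTerm (β : Type) : Type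
  | var (b : β)
  | zero
  | one
  | neg (t : RTerm β)
  | add (s t : RTerm β)
  | mul (s t : RTerm β)

/-- Terms of the language of abelian groups with a constant, in variables indexed by `α`. -/
inductive ATerm (α : Type) : Type
  | var (a : α)
  | const
  | zero
  | neg (t : ATerm α)
  | add (s t : ATerm α)

namespace RTerm

variable {β : Type}

instance : Zero (RTerm β) := ⟨zero⟩
instance : One (RTerm β) := ⟨one⟩
instance : Neg (RTerm β) := ⟨neg⟩
instance : Add (RTerm β) := ⟨add⟩
instance : Mul (RTerm β) := ⟨mul⟩

/-- The numeral `n` as a term. -/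
def nat : ℕ → RTerm β
  | 0 => 0
  | n + 1 => nat n + 1

/-- The value of a ring term. -/
def eval {R : Type w} [CommRing R] (w : β → R) : RTerm β → R
  | var b => w b
  | zero => 0
  | one => 1
  | neg t => -eval w t
  | add s t => eval w s + eval w t
  | mul s t => eval w s * eval w t

variable {R : Type w} [CommRing R] (w : β → R) (s t : RTerm β)

@[simp] theorem eval_var (b : β) : (var b).eval w = w b := rfl
@[simp] theorem eval_zero : (0 : RTerm β).eval w = 0 := rfl
@[simp] theorem eval_one : (1 : RTerm β).eval w = 1 := rfl
@[simp] theorem eval_neg : (-t).eval w = -t.eval w := rfl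
@[simp] theorem eval_add : (s + t).eval w = s.eval w + t.eval w := rfl
@[simp] theorem eval_mul : (s * t).eval w = s.eval w * t.eval w := rfl
@[simp] theorem eval_nat (n : ℕ) : (nat n : RTerm β).eval w = n := by
  induction n with
  | zero => simp [nat]
  | succ n ih => simp [nat, ih]

end RTerm

namespace ATerm

variable {α : Type}

instance : Zero (ATerm α) := ⟨zero⟩
instance : Neg (ATerm α) := ⟨neg⟩
instance : Add (ATerm α) := ⟨add⟩

/-- The term `n t`. -/
def nsmul : ℕ → ATerm α → ATerm α
  | 0, _ => 0
  | n + 1, t => nsmul n t + t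

/-- The value of a term, where `c` is the value of the constant. -/
def eval {A : Type w} [AddCommGroup A] (c : A) (u : α → A) : ATerm α → A
  | var a => u a
  | const => c
  | zero => 0
  | neg t => -eval c u t
  | add s t => eval c u s + eval c u t

variable {A : Type w} [AddCommGroup A] (c : A) (u : α → A) (s t : ATerm α)

@[simp] theorem eval_var (a : α) : (var a).eval c u = u a := rfl
@[simp] theorem eval_const : (const : ATerm α).eval c u = c := rfl
@[simp] theorem eval_zero : (0 : ATerm α).eval c u = 0 := rfl
@[simp] theorem eval_neg : (-t).eval c u = -t.eval c u := rfl
@[simp] theorem eval_add : (s + t).eval c u = s.eval c u + t.eval c u := rfl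
@[simp] theorem eval_nsmul (n : ℕ) : (nsmul n t).eval c u = n • t.eval c u := by
  induction n with
  | zero => simp [nsmul]
  | succ n ih => simp [nsmul, ih, succ_nsmul]

end ATerm

/-- Two-sorted first-order formulas of the language of `((A, +, c), (R, +, ·), F)`, with free
variables of the first sort indexed by `α` and of the second sort indexed by `β`. Finite blocks of
variables are quantified at once. -/
inductive TwoSorted : Type → Type → Type 1
  | eqR {α β : Type} (s t : RTerm β) : TwoSorted α β
  | eqA {α β : Type} (s t : ATerm α) : TwoSorted α β
  | rel {α β : Type} (m : Fin 2 → Fin 2 → RTerm β) (t : ATerm α) : TwoSorted α β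
  | not {α β : Type} (ψ : TwoSorted α β) : TwoSorted α β
  | and {α β : Type} (ψ χ : TwoSorted α β) : TwoSorted α β
  | exR {α β : Type} (γ : Type) [Finite γ] (ψ : TwoSorted α (β ⊕ γ)) : TwoSorted α β
  | exA {α β : Type} (γ : Type) [Finite γ] (ψ : TwoSorted (α ⊕ γ) β) : TwoSorted α β

namespace TwoSorted

/-- Disjunction. -/
def or {α β : Type} (ψ χ : TwoSorted α β) : TwoSorted α β := not (and (not ψ) (not χ))

/-- Implication. -/
def imp {α β : Type} (ψ χ : TwoSorted α β) : TwoSorted α β := not (and ψ (not χ))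

/-- Universal quantification over a block of variables of the second sort. -/
def allR {α β : Type} (γ : Type) [Finite γ] (ψ : TwoSorted α (β ⊕ γ)) : TwoSorted α β :=
  not (exR γ (not ψ))

/-- Universal quantification over a block of variables of the first sort. -/
def allA {α β : Type} (γ : Type) [Finite γ] (ψ : TwoSorted (α ⊕ γ) β) : TwoSorted α β :=
  not (exA γ (not ψ))

/-- The disjunction of the formulas `ψ i` for `i < n`. -/
def iOr {α β : Type} (ψ : ℕ → TwoSorted α β) : ℕ → TwoSorted α β
  | 0 => not (eqA 0 0)
  | n + 1 => or (iOr ψ n) (ψ n)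

variable {A R : Type w} [AddCommGroup A] [CommRing R] (F : SL2 R → A → Prop) (c : A)

/-- Truth of a two-sorted formula. -/
def Realize : {α β : Type} → TwoSorted α β → (α → A) → (β → R) → Prop
  | _, _, eqR s t, _, w => s.eval w = t.eval w
  | _, _, eqA s t, u, _ => s.eval c u = t.eval c u
  | _, _, rel m t, u, w => ∃ g : SL2 R, (∀ i j, g i j = (m i j).eval w) ∧ F g (t.eval c u)
  | _, _, not ψ, u, w => ¬ Realize ψ u w
  | _, _, and ψ χ, u, w => Realize ψ u w ∧ Realize χ u w
  | _, _, exR γ ψ, u, w => ∃ z : γ → R, Realize ψ u (Sum.elim w z)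
  | _, _, exA γ ψ, u, w => ∃ z : γ → A, Realize ψ (Sum.elim u z) w

section

variable {α β : Type} (u : α → A) (w : β → R) (ψ χ : TwoSorted α β)

@[simp] theorem realize_eqR (s t : RTerm β) :
    (eqR s t : TwoSorted α β).Realize F c u w ↔ s.eval w = t.eval w := Iff.rfl
@[simp] theorem realize_eqA (s t : ATerm α) :
    (eqA s t : TwoSorted α β).Realize F c u w ↔ s.eval c u = t.eval c u := Iff.rfl
@[simp] theorem realize_rel (m : Fin 2 → Fin 2 → RTerm β) (t : ATerm α) :
    (rel m t).Realize F c u w ↔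
      ∃ g : SL2 R, (∀ i j, g i j = (m i j).eval w) ∧ F g (t.eval c u) := Iff.rfl
@[simp] theorem realize_not : ψ.not.Realize F c u w ↔ ¬ ψ.Realize F c u w := Iff.rfl
@[simp] theorem realize_and :
    (ψ.and χ).Realize F c u w ↔ ψ.Realize F c u w ∧ χ.Realize F c u w := Iff.rfl
@[simp] theorem realize_or :
    (ψ.or χ).Realize F c u w ↔ ψ.Realize F c u w ∨ χ.Realize F c u w := by
  simp only [or, realize_not, realize_and]; tauto
@[simp] theorem realize_imp :
    (ψ.imp χ).Realize F c u w ↔ (ψ.Realize F c u w → χ.Realize F c u w) := by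
  simp only [imp, realize_not, realize_and]; tauto
@[simp] theorem realize_exR (γ : Type) [Finite γ] (ψ : TwoSorted α (β ⊕ γ)) :
    (ψ.exR).Realize F c u w ↔ ∃ z : γ → R, ψ.Realize F c u (Sum.elim w z) := Iff.rfl
@[simp] theorem realize_exA (γ : Type) [Finite γ] (ψ : TwoSorted (α ⊕ γ) β) :
    (ψ.exA).Realize F c u w ↔ ∃ z : γ → A, ψ.Realize F c (Sum.elim u z) w := Iff.rfl
@[simp] theorem realize_allR (γ : Type) [Finite γ] (ψ : TwoSorted α (β ⊕ γ)) :
    (ψ.allR).Realize F c u w ↔ ∀ z : γ → R, ψ.Realize F c u (Sum.elim w z) := by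
  simp only [allR, realize_not, realize_exR, not_exists, not_not]
@[simp] theorem realize_allA (γ : Type) [Finite γ] (ψ : TwoSorted (α ⊕ γ) β) :
    (ψ.allA).Realize F c u w ↔ ∀ z : γ → A, ψ.Realize F c (Sum.elim u z) w := by
  simp only [allA, realize_not, realize_exA, not_exists, not_not]
@[simp] theorem realize_iOr (ψ : ℕ → TwoSorted α β) (n : ℕ) :
    (iOr ψ n).Realize F c u w ↔ ∃ i < n, (ψ i).Realize F c u w := by
  induction n with
  | zero => simp [iOr]
  | succ n ih => simp only [iOr, realize_or, ih, Nat.lt_succ_iff_lt_or_eq, or_and_right, exists_or,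
      exists_eq_left]

end

end TwoSorted

/-! Translation into one-sorted formulas. -/

section Translation

/-- The one-sorted formula saying that the variable `y` is the value of the given ring term at the
variables `x b`. The element `0` is characterised by `y + y = y`, and `1` by `r y = r` for
all `r`. -/
noncomputable def RTerm.graph {β : Type} : RTerm β → {V : Type} → (β → V) → V → baseLang.Formula V
  | .var b, _, x, y => (Relations.formula (L := baseLang) BaseRel.sortR ![Term.var y]) ⊓
      Term.equal (Term.var y) (Term.var (x b))
  | .zero, _, _, y =>
      Relations.formula (L := baseLang) BaseRel.addR ![Term.var y, Term.var y, Term.var y]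
  | .one, V, _, y => Formula.iAlls (L := baseLang) (α := V) Unit
      (Formula.imp (Relations.formula (L := baseLang) BaseRel.sortR ![Term.var (.inr ())])
        (Relations.formula (L := baseLang) BaseRel.mulR
          ![Term.var (.inr ()), Term.var (.inl y), Term.var (.inr ())]))
  | .neg t, V, x, y => Formula.iExs (L := baseLang) (α := V) (Fin 2)
      (t.graph (Sum.inl ∘ x) (.inr 0) ⊓
        (Relations.formula (L := baseLang) BaseRel.addR
          ![Term.var (.inr 1), Term.var (.inr 1), Term.var (.inr 1)] ⊓
        Relations.formula (L := baseLang) BaseRel.addR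
          ![Term.var (.inl y), Term.var (.inr 0), Term.var (.inr 1)]))
  | .add s t, V, x, y => Formula.iExs (L := baseLang) (α := V) (Fin 2)
      (s.graph (Sum.inl ∘ x) (.inr 0) ⊓ (t.graph (Sum.inl ∘ x) (.inr 1) ⊓
        Relations.formula (L := baseLang) BaseRel.addR
          ![Term.var (.inr 0), Term.var (.inr 1), Term.var (.inl y)]))
  | .mul s t, V, x, y => Formula.iExs (L := baseLang) (α := V) (Fin 2)
      (s.graph (Sum.inl ∘ x) (.inr 0) ⊓ (t.graph (Sum.inl ∘ x) (.inr 1) ⊓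
        Relations.formula (L := baseLang) BaseRel.mulR
          ![Term.var (.inr 0), Term.var (.inr 1), Term.var (.inl y)]))

/-- The one-sorted formula saying that the variable `y` is the value of the given group term at the
variables `x a`, where `k` is the variable that stands for the constant. -/
noncomputable def ATerm.graph {α : Type} :
    ATerm α → {V : Type} → (α → V) → V → V → baseLang.Formula V
  | .var a, _, x, _, y => (Relations.formula (L := baseLang) BaseRel.sortA ![Term.var y]) ⊓
      Term.equal (Term.var y) (Term.var (x a))
  | .const, _, _, k, y => (Relations.formula (L := baseLang) BaseRel.sortA ![Term.var y]) ⊓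
      Term.equal (Term.var y) (Term.var k)
  | .zero, _, _, _, y =>
      Relations.formula (L := baseLang) BaseRel.addA ![Term.var y, Term.var y, Term.var y]
  | .neg t, V, x, k, y => Formula.iExs (L := baseLang) (α := V) (Fin 2)
      (t.graph (Sum.inl ∘ x) (.inl k) (.inr 0) ⊓
        (Relations.formula (L := baseLang) BaseRel.addA
          ![Term.var (.inr 1), Term.var (.inr 1), Term.var (.inr 1)] ⊓
        Relations.formula (L := baseLang) BaseRel.addA
          ![Term.var (.inl y), Term.var (.inr 0), Term.var (.inr 1)]))
  | .add s t, V, x, k, y => Formula.iExs (L := baseLang) (α := V) (Fin 2)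
      (s.graph (Sum.inl ∘ x) (.inl k) (.inr 0) ⊓ (t.graph (Sum.inl ∘ x) (.inl k) (.inr 1) ⊓
        Relations.formula (L := baseLang) BaseRel.addA
          ![Term.var (.inr 0), Term.var (.inr 1), Term.var (.inl y)]))

/-- Translation of a two-sorted formula into a one-sorted formula: `x` and `y` name the variables
of the two sorts, and `k` is the variable that stands for the constant. -/
noncomputable def TwoSorted.toFormula : {α β : Type} → TwoSorted α β →
    {V : Type} → (α → V) → (β → V) → V → baseLang.Formula V
  | _, _, .eqR s t, V, _, y, _ => Formula.iExs (L := baseLang) (α := V) Unit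
      (s.graph (Sum.inl ∘ y) (.inr ()) ⊓ t.graph (Sum.inl ∘ y) (.inr ()))
  | _, _, .eqA s t, V, x, _, k => Formula.iExs (L := baseLang) (α := V) Unit
      (s.graph (Sum.inl ∘ x) (.inl k) (.inr ()) ⊓ t.graph (Sum.inl ∘ x) (.inl k) (.inr ()))
  | _, _, .rel m t, V, x, y, k => Formula.iExs (L := baseLang) (α := V) (Fin 5)
      ((m 0 0).graph (Sum.inl ∘ y) (.inr 0) ⊓ ((m 0 1).graph (Sum.inl ∘ y) (.inr 1) ⊓
        ((m 1 0).graph (Sum.inl ∘ y) (.inr 2) ⊓ ((m 1 1).graph (Sum.inl ∘ y) (.inr 3) ⊓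
        (t.graph (Sum.inl ∘ x) (.inl k) (.inr 4) ⊓
        Relations.formula (L := baseLang) BaseRel.split fun i => Term.var (.inr i))))))
  | _, _, .not ψ, _, x, y, k => Formula.not (ψ.toFormula x y k)
  | _, _, .and ψ χ, _, x, y, k => ψ.toFormula x y k ⊓ χ.toFormula x y k
  | _, _, @TwoSorted.exR _ _ γ _ ψ, V, x, y, k => Formula.iExs (L := baseLang) (α := V) γ
      ((Formula.iInf fun i : γ =>
        Relations.formula (L := baseLang) BaseRel.sortR ![Term.var (.inr i)]) ⊓
        ψ.toFormula (Sum.inl ∘ x) (Sum.elim (Sum.inl ∘ y) Sum.inr) (.inl k))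
  | _, _, @TwoSorted.exA _ _ γ _ ψ, V, x, y, k => Formula.iExs (L := baseLang) (α := V) γ
      ((Formula.iInf fun i : γ =>
        Relations.formula (L := baseLang) BaseRel.sortA ![Term.var (.inr i)]) ⊓
        ψ.toFormula (Sum.elim (Sum.inl ∘ x) Sum.inr) (Sum.inl ∘ y) (.inl k))

variable {A R : Type w} [AddCommGroup A] [CommRing R] (F : SL2 R → A → Prop)

theorem realize_sortA {V : Type} (v : V → A ⊕ R) (y : V) :
    @Formula.Realize baseLang (A ⊕ R) (baseStructure A R F) V
      (Relations.formula (L := baseLang) BaseRel.sortA ![Term.var y]) v ↔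
      ∃ a, v y = .inl a := Iff.rfl

theorem realize_sortR {V : Type} (v : V → A ⊕ R) (y : V) :
    @Formula.Realize baseLang (A ⊕ R) (baseStructure A R F) V
      (Relations.formula (L := baseLang) BaseRel.sortR ![Term.var y]) v ↔
      ∃ a, v y = .inr a := Iff.rfl

theorem funext_fin_three_iff {X : Type*} {p : Fin 3 → X} {a b c : X} :
    p = ![a, b, c] ↔ p 0 = a ∧ p 1 = b ∧ p 2 = c := by
  constructor
  · rintro rfl; exact ⟨rfl, rfl, rfl⟩
  · rintro ⟨rfl, rfl, rfl⟩; funext i; fin_cases i <;> rfl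

theorem realize_addA {V : Type} (v : V → A ⊕ R) (x y z : V) :
    @Formula.Realize baseLang (A ⊕ R) (baseStructure A R F) V
      (Relations.formula (L := baseLang) BaseRel.addA
      ![Term.var x, Term.var y, Term.var z]) v ↔
      ∃ a b, v x = .inl a ∧ v y = .inl b ∧ v z = .inl (a + b) :=
  exists_congr fun _ => exists_congr fun _ => funext_fin_three_iff

theorem realize_addR {V : Type} (v : V → A ⊕ R) (x y z : V) :
    @Formula.Realize baseLang (A ⊕ R) (baseStructure A R F) V
      (Relations.formula (L := baseLang) BaseRel.addR
      ![Term.var x, Term.var y, Term.var z]) v ↔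
      ∃ a b, v x = .inr a ∧ v y = .inr b ∧ v z = .inr (a + b) :=
  exists_congr fun _ => exists_congr fun _ => funext_fin_three_iff

theorem realize_mulR {V : Type} (v : V → A ⊕ R) (x y z : V) :
    @Formula.Realize baseLang (A ⊕ R) (baseStructure A R F) V
      (Relations.formula (L := baseLang) BaseRel.mulR
      ![Term.var x, Term.var y, Term.var z]) v ↔
      ∃ a b, v x = .inr a ∧ v y = .inr b ∧ v z = .inr (a * b) :=
  exists_congr fun _ => exists_congr fun _ => funext_fin_three_iff

theorem RTerm.realize_graph {β : Type} (t : RTerm β) {V : Type} (x : β → V) (y : V)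
    (v : V → A ⊕ R) (w : β → R) (hw : ∀ b, v (x b) = .inr (w b)) :
    @Formula.Realize baseLang (A ⊕ R) (baseStructure A R F) V (t.graph x y) v ↔
      v y = .inr (t.eval w) := by
  induction t generalizing V with
  | var b =>
    let := baseStructure A R F
    rw [RTerm.graph, Formula.realize_inf, realize_sortR, Formula.realize_equal]
    simp only [Term.realize_var, hw, RTerm.eval]
    exact ⟨fun h => h.2, fun h => ⟨⟨_, h⟩, h⟩⟩
  | zero =>
    let := baseStructure A R F
    rw [RTerm.graph, realize_addR]
    simp only [RTerm.eval]
    constructor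
    · rintro ⟨a, b, h1, h2, h3⟩
      rw [h1, Sum.inr.injEq] at h3
      rw [h2, Sum.inr.injEq]
      simpa using h3
    · intro h
      exact ⟨0, 0, h, h, by simpa using h⟩
  | one =>
    let := baseStructure A R F
    rw [RTerm.graph, Formula.realize_iAlls]
    simp only [RTerm.eval, Formula.realize_imp]
    constructor
    · intro h
      have h := h fun _ => .inr 1
      rw [realize_sortR, realize_mulR] at h
      obtain ⟨a, b, h1, h2, h3⟩ := h ⟨1, rfl⟩
      simp only [Sum.elim_inr, Sum.inr.injEq] at h1 h3
      subst h1
      simp only [Sum.elim_inl] at h2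
      rw [h2, h3, one_mul]
    · intro h i
      rw [realize_sortR, realize_mulR]
      rintro ⟨a, ha⟩
      exact ⟨a, 1, ha, h, by simpa using ha⟩
  | neg t ih =>
    let := baseStructure A R F
    rw [RTerm.graph, Formula.realize_iExs]
    simp only [Formula.realize_inf, RTerm.eval]
    constructor
    · rintro ⟨z, h1, h2, h3⟩
      rw [ih _ _ _ (by simpa using hw)] at h1
      rw [realize_addR] at h2 h3
      obtain ⟨a, b, h4, h5, h6⟩ := h2
      obtain ⟨a', b', h7, h8, h9⟩ := h3
      simp only [Sum.elim_inl, Sum.elim_inr] at *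
      rw [h4, Sum.inr.injEq] at h5 h6 h9
      rw [h1, Sum.inr.injEq] at h8
      subst h5 h8
      rw [h7, Sum.inr.injEq]
      have : a = 0 := by simpa using h6
      exact eq_neg_of_add_eq_zero_left (by rw [← h9, this])
    · intro h
      refine ⟨![.inr (t.eval w), .inr 0], ?_, ?_, ?_⟩
      · rw [ih _ _ _ (by simpa using hw)]; rfl
      · rw [realize_addR]; exact ⟨0, 0, by simp⟩
      · rw [realize_addR]; exact ⟨_, _, h, rfl, by simp⟩
  | add s t ihs iht =>
    let := baseStructure A R F
    rw [RTerm.graph, Formula.realize_iExs]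
    simp only [Formula.realize_inf, RTerm.eval]
    constructor
    · rintro ⟨z, h1, h2, h3⟩
      rw [ihs _ _ _ (by simpa using hw)] at h1
      rw [iht _ _ _ (by simpa using hw)] at h2
      rw [realize_addR] at h3
      obtain ⟨a', b', h7, h8, h9⟩ := h3
      rw [h1, Sum.inr.injEq] at h7
      rw [h2, Sum.inr.injEq] at h8
      rw [h7, h8]; exact h9
    · intro h
      refine ⟨![.inr (s.eval w), .inr (t.eval w)], ?_, ?_, ?_⟩
      · rw [ihs _ _ _ (by simpa using hw)]; rfl
      · rw [iht _ _ _ (by simpa using hw)]; rfl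
      · rw [realize_addR]; exact ⟨_, _, rfl, rfl, h⟩
  | mul s t ihs iht =>
    let := baseStructure A R F
    rw [RTerm.graph, Formula.realize_iExs]
    simp only [Formula.realize_inf, RTerm.eval]
    constructor
    · rintro ⟨z, h1, h2, h3⟩
      rw [ihs _ _ _ (by simpa using hw)] at h1
      rw [iht _ _ _ (by simpa using hw)] at h2
      rw [realize_mulR] at h3
      obtain ⟨a', b', h7, h8, h9⟩ := h3
      rw [h1, Sum.inr.injEq] at h7
      rw [h2, Sum.inr.injEq] at h8
      rw [h7, h8]; exact h9
    · intro h
      refine ⟨![.inr (s.eval w), .inr (t.eval w)], ?_, ?_, ?_⟩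
      · rw [ihs _ _ _ (by simpa using hw)]; rfl
      · rw [iht _ _ _ (by simpa using hw)]; rfl
      · rw [realize_mulR]; exact ⟨_, _, rfl, rfl, h⟩

theorem ATerm.realize_graph {α : Type} (t : ATerm α) {V : Type} (x : α → V) (k y : V)
    (v : V → A ⊕ R) (c : A) (u : α → A) (hu : ∀ b, v (x b) = .inl (u b)) (hk : v k = .inl c) :
    @Formula.Realize baseLang (A ⊕ R) (baseStructure A R F) V (t.graph x k y) v ↔
      v y = .inl (t.eval c u) := by
  induction t generalizing V with
  | var b =>
    let := baseStructure A R F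
    rw [ATerm.graph, Formula.realize_inf, realize_sortA, Formula.realize_equal]
    simp only [Term.realize_var, hu, ATerm.eval]
    exact ⟨fun h => h.2, fun h => ⟨⟨_, h⟩, h⟩⟩
  | const =>
    let := baseStructure A R F
    rw [ATerm.graph, Formula.realize_inf, realize_sortA, Formula.realize_equal]
    simp only [Term.realize_var, hk, ATerm.eval]
    exact ⟨fun h => h.2, fun h => ⟨⟨_, h⟩, h⟩⟩
  | zero =>
    let := baseStructure A R F
    rw [ATerm.graph, realize_addA]
    simp only [ATerm.eval]
    constructor
    · rintro ⟨a, b, h1, h2, h3⟩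
      rw [h1, Sum.inl.injEq] at h3
      rw [h2, Sum.inl.injEq]
      simpa using h3
    · intro h
      exact ⟨0, 0, h, h, by simpa using h⟩
  | neg t ih =>
    let := baseStructure A R F
    rw [ATerm.graph, Formula.realize_iExs]
    simp only [Formula.realize_inf, ATerm.eval]
    constructor
    · rintro ⟨z, h1, h2, h3⟩
      rw [ih _ _ _ _ (by simpa using hu) (by simpa using hk)] at h1
      rw [realize_addA] at h2 h3
      obtain ⟨a, b, h4, h5, h6⟩ := h2
      obtain ⟨a', b', h7, h8, h9⟩ := h3
      simp only [Sum.elim_inl, Sum.elim_inr] at *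
      rw [h4, Sum.inl.injEq] at h5 h6 h9
      rw [h1, Sum.inl.injEq] at h8
      subst h5 h8
      rw [h7, Sum.inl.injEq]
      have : a = 0 := by simpa using h6
      exact eq_neg_of_add_eq_zero_left (by rw [← h9, this])
    · intro h
      refine ⟨![.inl (t.eval c u), .inl 0], ?_, ?_, ?_⟩
      · rw [ih _ _ _ _ (by simpa using hu) (by simpa using hk)]; rfl
      · rw [realize_addA]; exact ⟨0, 0, by simp⟩
      · rw [realize_addA]; exact ⟨_, _, h, rfl, by simp⟩
  | add s t ihs iht =>
    let := baseStructure A R F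
    rw [ATerm.graph, Formula.realize_iExs]
    simp only [Formula.realize_inf, ATerm.eval]
    constructor
    · rintro ⟨z, h1, h2, h3⟩
      rw [ihs _ _ _ _ (by simpa using hu) (by simpa using hk)] at h1
      rw [iht _ _ _ _ (by simpa using hu) (by simpa using hk)] at h2
      rw [realize_addA] at h3
      obtain ⟨a', b', h7, h8, h9⟩ := h3
      rw [h1, Sum.inl.injEq] at h7
      rw [h2, Sum.inl.injEq] at h8
      rw [h7, h8]; exact h9
    · intro h
      refine ⟨![.inl (s.eval c u), .inl (t.eval c u)], ?_, ?_, ?_⟩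
      · rw [ihs _ _ _ _ (by simpa using hu) (by simpa using hk)]; rfl
      · rw [iht _ _ _ _ (by simpa using hu) (by simpa using hk)]; rfl
      · rw [realize_addA]; exact ⟨_, _, rfl, rfl, h⟩

theorem TwoSorted.realize_toFormula {α β : Type} (ψ : TwoSorted α β) {V : Type} (x : α → V)
    (y : β → V) (k : V) (v : V → A ⊕ R) (c : A) (u : α → A) (w : β → R)
    (hu : ∀ a, v (x a) = .inl (u a)) (hw : ∀ b, v (y b) = .inr (w b)) (hk : v k = .inl c) :
    @Formula.Realize baseLang (A ⊕ R) (baseStructure A R F) V (ψ.toFormula x y k) v ↔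
      ψ.Realize F c u w := by
  induction ψ generalizing V with
  | eqR s t =>
    let := baseStructure A R F
    rw [TwoSorted.toFormula, Formula.realize_iExs, TwoSorted.Realize]
    simp only [Formula.realize_inf]
    constructor
    · rintro ⟨z, h1, h2⟩
      rw [RTerm.realize_graph F _ _ _ _ w (by simpa using hw)] at h1 h2
      exact Sum.inr.inj (h1.symm.trans h2)
    · intro h
      refine ⟨fun _ => .inr (s.eval w), ?_, ?_⟩
      · rw [RTerm.realize_graph F _ _ _ _ w (by simpa using hw)]; rfl
      · rw [RTerm.realize_graph F _ _ _ _ w (by simpa using hw), ← h]; rfl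
  | eqA s t =>
    let := baseStructure A R F
    rw [TwoSorted.toFormula, Formula.realize_iExs, TwoSorted.Realize]
    simp only [Formula.realize_inf]
    constructor
    · rintro ⟨z, h1, h2⟩
      rw [ATerm.realize_graph F _ _ _ _ _ c u (by simpa using hu) (by simpa using hk)] at h1 h2
      exact Sum.inl.inj (h1.symm.trans h2)
    · intro h
      refine ⟨fun _ => .inl (s.eval c u), ?_, ?_⟩
      · rw [ATerm.realize_graph F _ _ _ _ _ c u (by simpa using hu) (by simpa using hk)]; rfl
      · rw [ATerm.realize_graph F _ _ _ _ _ c u (by simpa using hu) (by simpa using hk), ← h]; rfl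
  | rel m t =>
    let := baseStructure A R F
    rw [TwoSorted.toFormula, Formula.realize_iExs, TwoSorted.Realize]
    simp only [Formula.realize_inf]
    have hsplit : ∀ z : Fin 5 → A ⊕ R, (Relations.formula (L := baseLang) BaseRel.split
        fun i => Term.var (.inr i : V ⊕ Fin 5)).Realize (Sum.elim v z) ↔
        ∃ (g : SL2 R) (a : A), F g a ∧
          z = ![.inr (g 0 0), .inr (g 0 1), .inr (g 1 0), .inr (g 1 1), .inl a] :=
      fun z => Iff.rfl
    constructor
    · rintro ⟨z, h1, h2, h3, h4, h5, h6⟩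
      rw [RTerm.realize_graph F _ _ _ _ w (by simpa using hw)] at h1 h2 h3 h4
      rw [ATerm.realize_graph F _ _ _ _ _ c u (by simpa using hu) (by simpa using hk)] at h5
      obtain ⟨g, a, hF, rfl⟩ := (hsplit z).mp h6
      refine ⟨g, ?_, ?_⟩
      · have h1 := Sum.inr.inj h1
        have h2 := Sum.inr.inj h2
        have h3 := Sum.inr.inj h3
        have h4 := Sum.inr.inj h4
        intro i j
        fin_cases i <;> fin_cases j <;> assumption
      · have h5 := Sum.inl.inj h5
        rwa [← h5]
    · rintro ⟨g, hg, hF⟩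
      refine ⟨![.inr (g 0 0), .inr (g 0 1), .inr (g 1 0), .inr (g 1 1), .inl (t.eval c u)],
        ?_, ?_, ?_, ?_, ?_, ?_⟩
      · rw [RTerm.realize_graph F _ _ _ _ w (by simpa using hw), ← hg]; rfl
      · rw [RTerm.realize_graph F _ _ _ _ w (by simpa using hw), ← hg]; rfl
      · rw [RTerm.realize_graph F _ _ _ _ w (by simpa using hw), ← hg]; rfl
      · rw [RTerm.realize_graph F _ _ _ _ w (by simpa using hw), ← hg]; rfl
      · rw [ATerm.realize_graph F _ _ _ _ _ c u (by simpa using hu) (by simpa using hk)]; rfl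
      · exact (hsplit _).mpr ⟨g, _, hF, rfl⟩
  | not ψ ih =>
    let := baseStructure A R F
    rw [TwoSorted.toFormula, Formula.realize_not, ih _ _ _ _ _ _ hu hw hk, TwoSorted.Realize]
  | and ψ χ ih1 ih2 =>
    let := baseStructure A R F
    rw [TwoSorted.toFormula, Formula.realize_inf, ih1 _ _ _ _ _ _ hu hw hk,
      ih2 _ _ _ _ _ _ hu hw hk, TwoSorted.Realize]
  | exR γ ψ ih =>
    let := baseStructure A R F
    rw [TwoSorted.toFormula, Formula.realize_iExs, TwoSorted.Realize]
    simp only [Formula.realize_inf, Formula.realize_iInf, realize_sortR, Sum.elim_inr]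
    constructor
    · rintro ⟨z, hz, h⟩
      choose z' hz' using hz
      refine ⟨z', ?_⟩
      rwa [ih _ _ _ _ u (Sum.elim w z') (by simpa using hu)
        (by rintro (b | b) <;> simp [hw, hz']) (by simpa using hk)] at h
    · rintro ⟨z', h⟩
      refine ⟨fun i => .inr (z' i), fun i => ⟨_, rfl⟩, ?_⟩
      rwa [ih _ _ _ _ u (Sum.elim w z') (by simpa using hu)
        (by rintro (b | b) <;> simp [hw]) (by simpa using hk)]
  | exA γ ψ ih =>
    let := baseStructure A R F
    rw [TwoSorted.toFormula, Formula.realize_iExs, TwoSorted.Realize]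
    simp only [Formula.realize_inf, Formula.realize_iInf, realize_sortA, Sum.elim_inr]
    constructor
    · rintro ⟨z, hz, h⟩
      choose z' hz' using hz
      refine ⟨z', ?_⟩
      rwa [ih _ _ _ _ (Sum.elim u z') w (by rintro (b | b) <;> simp [hu, hz'])
        (by simpa using hw) (by simpa using hk)] at h
    · rintro ⟨z', h⟩
      refine ⟨fun i => .inl (z' i), fun i => ⟨_, rfl⟩, ?_⟩
      rwa [ih _ _ _ _ (Sum.elim u z') w (by rintro (b | b) <;> simp [hu])
        (by simpa using hw) (by simpa using hk)]

end Translation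

end TwoSortedFormulas

/-! ### Transfer and definability -/

section Transfer

variable {L : FirstOrder.Language.{u, v}} {φ : baseLang →ᴸ L}

section Expansion

variable {A R : Type w} [AddCommGroup A] [CommRing R] [L.Structure (A ⊕ R)] {F : SL2 R → A → Prop}

theorem IsExpansionOf.realize_onFormula (hM : IsExpansionOf φ A R F) {V : Type}
    (χ : baseLang.Formula V) (v : V → A ⊕ R) :
    (φ.onFormula χ).Realize v ↔
      @Formula.Realize baseLang (A ⊕ R) (baseStructure A R F) V χ v := by
  let := baseStructure A R F
  have : φ.IsExpansionOn (A ⊕ R) := hM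
  exact LHom.realize_onFormula φ χ

theorem IsExpansionOf.realize_toFormula (hM : IsExpansionOf φ A R F) {α β : Type}
    (ψ : TwoSorted α β) {V : Type} (x : α → V) (y : β → V) (k : V) (v : V → A ⊕ R) (c : A)
    (u : α → A) (w : β → R) (hu : ∀ a, v (x a) = .inl (u a)) (hw : ∀ b, v (y b) = .inr (w b))
    (hk : v k = .inl c) :
    (φ.onFormula (ψ.toFormula x y k)).Realize v ↔ ψ.Realize F c u w := by
  rw [hM.realize_onFormula, TwoSorted.realize_toFormula F ψ x y k v c u w hu hw hk]

/-- The one-sorted formula saying that the variables in the range of `x` and of `y` belong to the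
two sorts, and that `ψ` holds. -/
noncomputable def TwoSorted.sortedFormula {α β : Type} [Finite α] [Finite β] (ψ : TwoSorted α β)
    {V : Type} (x : α → V) (y : β → V) (k : V) : baseLang.Formula V :=
  (Formula.iInf fun a : α =>
    Relations.formula (L := baseLang) BaseRel.sortA ![Term.var (x a)]) ⊓
  ((Formula.iInf fun b : β =>
    Relations.formula (L := baseLang) BaseRel.sortR ![Term.var (y b)]) ⊓
  ψ.toFormula x y k)

theorem IsExpansionOf.realize_sortedFormula (hM : IsExpansionOf φ A R F) {α β : Type} [Finite α]
    [Finite β] (ψ : TwoSorted α β) {V : Type} (x : α → V) (y : β → V) (k : V) (v : V → A ⊕ R)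
    (c : A) (hk : v k = .inl c) :
    (φ.onFormula (ψ.sortedFormula x y k)).Realize v ↔
      ∃ (u : α → A) (w : β → R), (∀ a, v (x a) = .inl (u a)) ∧ (∀ b, v (y b) = .inr (w b)) ∧
        ψ.Realize F c u w := by
  let := baseStructure A R F
  rw [hM.realize_onFormula, TwoSorted.sortedFormula, Formula.realize_inf, Formula.realize_inf]
  simp only [Formula.realize_iInf, realize_sortA, realize_sortR]
  constructor
  · rintro ⟨hx, hy, h⟩
    choose u hu using hx
    choose w hw using hy
    exact ⟨u, w, hu, hw, (TwoSorted.realize_toFormula F ψ x y k v c u w hu hw hk).mp h⟩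
  · rintro ⟨u, w, hu, hw, h⟩
    exact ⟨fun a => ⟨_, hu a⟩, fun b => ⟨_, hw b⟩,
      (TwoSorted.realize_toFormula F ψ x y k v c u w hu hw hk).mpr h⟩

/-- Two-sorted formulas define subsets that are definable over the constant. -/
theorem IsExpansionOf.definable (hM : IsExpansionOf φ A R F) {α β : Type} [Finite α] [Finite β]
    (ψ : TwoSorted α β) {I : Type} (x : α → I) (y : β → I) (c : A) :
    ({.inl c} : Set (A ⊕ R)).Definable L {v : I → A ⊕ R | ∃ (u : α → A) (w : β → R),
      (∀ a, v (x a) = .inl (u a)) ∧ (∀ b, v (y b) = .inr (w b)) ∧ ψ.Realize F c u w} := by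
  rw [Set.definable_iff_exists_formula_sum]
  refine ⟨(φ.onFormula (ψ.sortedFormula (V := Unit ⊕ I) (Sum.inr ∘ x) (Sum.inr ∘ y)
    (.inl ()))).relabel (Sum.map (fun _ => ⟨.inl c, rfl⟩) id), ?_⟩
  ext v
  rw [Set.mem_ofPred_eq, Set.mem_ofPred_eq, Formula.realize_relabel,
    hM.realize_sortedFormula ψ _ _ _ _ c rfl]
  rfl

end Expansion

section Elementary

variable {N M : Type*} [L.Structure N] [L.Structure M] (ι : N ↪ₑ[L] M)

/-- Membership in the interpretation of a definable set can be tested with any formula that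
defines it. -/
theorem mem_interpretation_iff {α : Type} [Finite α] {X : Set (α → N)} (ψ : L.Formula (α ⊕ N))
    (hψ : ∀ x, x ∈ X ↔ ψ.Realize (Sum.elim x id)) (y : α → M) :
    y ∈ interpretation ι X ↔ ψ.Realize (Sum.elim y ι) := by
  refine ⟨?_, fun h => ⟨ψ, hψ, h⟩⟩
  rintro ⟨χ, hχ, h⟩
  let θ : L.Formula N := Formula.iAlls α ((χ.imp ψ).relabel Sum.swap)
  have hN : θ.Realize (id : N → N) := by
    rw [Formula.realize_iAlls]
    intro x
    rw [Formula.realize_relabel, Formula.realize_imp]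
    have e : (Sum.elim id x ∘ Sum.swap : α ⊕ N → N) = Sum.elim x id := by
      ext (i | i) <;> rfl
    rw [e, ← hχ, ← hψ]
    exact id
  rw [← ι.map_formula, Formula.realize_iAlls] at hN
  have := hN y
  rw [Formula.realize_relabel, Formula.realize_imp] at this
  have e : (Sum.elim (ι ∘ id) y ∘ Sum.swap : α ⊕ N → M) = Sum.elim y ι := by
    ext (i | i) <;> rfl
  rw [e] at this
  exact this h

end Elementary

variable [L.Structure (ℤ ⊕ ℤ)] {F₀ : SL2 ℤ → ℤ → Prop} {A R : Type w} [AddCommGroup A]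
  [CommRing R] [L.Structure (A ⊕ R)] {F : SL2 R → A → Prop}
  (ι : (ℤ ⊕ ℤ) ↪ₑ[L] (A ⊕ R))

theorem IsExpansionOf.exists_inl (hN : IsExpansionOf φ ℤ ℤ F₀)
    (hM : IsExpansionOf φ A R F) : ∃ c : A, ι (.inl 1) = .inl c := by
  have h := ι.map_formula (φ.onFormula
    (Relations.formula (L := baseLang) BaseRel.sortA ![Term.var ()])) (fun _ => .inl 1)
  rw [hN.realize_onFormula, hM.realize_onFormula, realize_sortA, realize_sortA] at h
  exact h.mpr ⟨1, rfl⟩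

theorem IsExpansionOf.map_inl (hN : IsExpansionOf φ ℤ ℤ F₀)
    (hM : IsExpansionOf φ A R F) {c : A} (hc : ι (.inl 1) = .inl c)
    (n : ℤ) : ι (.inl n) = .inl (n • c) := by
  have key : ∀ t : ATerm Empty, ι (.inl (t.eval 1 Empty.elim)) = .inl (t.eval c Empty.elim) := by
    intro t
    have h := ι.map_formula (φ.onFormula (t.graph (V := Bool) Empty.elim false true))
      (fun b => if b then .inl (t.eval 1 Empty.elim) else .inl 1)
    rw [hN.realize_onFormula, hM.realize_onFormula,
      ATerm.realize_graph F₀ t _ _ _ _ 1 Empty.elim (fun b => b.elim) (by exact rfl),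
      ATerm.realize_graph F t _ _ _ _ c Empty.elim (fun b => b.elim) (by exact hc)] at h
    exact h.mpr rfl
  obtain ⟨n, rfl | rfl⟩ := n.eq_nat_or_neg
  · simpa using key (ATerm.nsmul n ATerm.const)
  · simpa using key (-ATerm.nsmul n ATerm.const)

/-- Transfer of two-sorted sentences along the elementary embedding. -/
theorem IsExpansionOf.transfer (hN : IsExpansionOf φ ℤ ℤ F₀)
    (hM : IsExpansionOf φ A R F) {c : A} (hc : ι (.inl 1) = .inl c)
    (ψ : TwoSorted Empty Empty) :
    ψ.Realize F₀ 1 Empty.elim Empty.elim ↔ ψ.Realize F c Empty.elim Empty.elim := by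
  have h := ι.map_formula (φ.onFormula (ψ.toFormula (V := Unit) Empty.elim Empty.elim ()))
    (fun _ => .inl 1)
  rw [hN.realize_toFormula ψ _ _ _ _ 1 Empty.elim Empty.elim (fun b => b.elim) (fun b => b.elim)
      (by exact rfl),
    hM.realize_toFormula ψ _ _ _ _ c Empty.elim Empty.elim (fun b => b.elim) (fun b => b.elim)
      (by exact hc)] at h
  exact h.symm

/-- The interpretation of a set defined by a two-sorted formula is defined by the same formula. -/
theorem IsExpansionOf.mem_interpretation_iff (hN : IsExpansionOf φ ℤ ℤ F₀)
    (hM : IsExpansionOf φ A R F) {c : A} (hc : ι (.inl 1) = .inl c)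
    {α β : Type} [Finite α] [Finite β]
    (ψ : TwoSorted α β) {I : Type} [Finite I] (x : α → I) (y : β → I) (v : I → A ⊕ R) :
    v ∈ interpretation ι {v : I → ℤ ⊕ ℤ | ∃ (u : α → ℤ) (w : β → ℤ),
        (∀ a, v (x a) = .inl (u a)) ∧ (∀ b, v (y b) = .inr (w b)) ∧ ψ.Realize F₀ 1 u w} ↔
      ∃ (u : α → A) (w : β → R), (∀ a, v (x a) = .inl (u a)) ∧ (∀ b, v (y b) = .inr (w b)) ∧
        ψ.Realize F c u w := by
  rw [_root_.mem_interpretation_iff ι ((φ.onFormula (ψ.sortedFormula (V := I ⊕ Unit) (Sum.inl ∘ x)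
    (Sum.inl ∘ y) (.inr ()))).relabel (Sum.map id fun _ => .inl 1))]
  · rw [Formula.realize_relabel, hM.realize_sortedFormula ψ _ _ _ _ c (by exact hc)]
    rfl
  · intro v
    rw [Formula.realize_relabel, hN.realize_sortedFormula ψ _ _ _ _ 1 (by exact rfl)]
    rfl

end Transfer

/-! ### The order of the ring sort and the formula for the cocycle -/

section SumsOfSquares

/-- Sums of four squares. -/
def IsSumFourSq {R : Type w} [CommRing R] (x : R) : Prop :=
  ∃ z : Fin 4 → R, x = z 0 * z 0 + z 1 * z 1 + z 2 * z 2 + z 3 * z 3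

theorem Int.isSumFourSq_iff (n : ℤ) : IsSumFourSq n ↔ 0 ≤ n := by
  constructor
  · rintro ⟨z, rfl⟩
    nlinarith [mul_self_nonneg (z 0), mul_self_nonneg (z 1), mul_self_nonneg (z 2),
      mul_self_nonneg (z 3)]
  · intro h
    obtain ⟨a, b, c, d, h'⟩ := Nat.sum_four_squares n.toNat
    refine ⟨![a, b, c, d], ?_⟩
    have : n = (n.toNat : ℤ) := (Int.toNat_of_nonneg h).symm
    rw [this, ← h']
    simp [pow_two]

theorem IsSumFourSq.mul {R : Type w} [CommRing R] {x y : R} (hx : IsSumFourSq x)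
    (hy : IsSumFourSq y) : IsSumFourSq (x * y) := by
  obtain ⟨a, rfl⟩ := hx
  obtain ⟨b, rfl⟩ := hy
  -- Euler's four-square identity
  refine ⟨![a 0 * b 0 - a 1 * b 1 - a 2 * b 2 - a 3 * b 3,
    a 0 * b 1 + a 1 * b 0 + a 2 * b 3 - a 3 * b 2,
    a 0 * b 2 - a 1 * b 3 + a 2 * b 0 + a 3 * b 1,
    a 0 * b 3 + a 1 * b 2 - a 2 * b 1 + a 3 * b 0], ?_⟩
  simp only [Matrix.cons_val]
  ring

theorem isSumFourSq_sq {R : Type w} [CommRing R] (x : R) : IsSumFourSq (x * x) :=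
  ⟨![x, 0, 0, 0], by simp⟩

/-- An integral domain in which every element or its negative is a sum of four squares, and in which
such sums are closed under addition and do not cancel, is linearly ordered by them. -/
theorem exists_linearOrder_of_isSumFourSq {R : Type w} [CommRing R] (h01 : (1 : R) ≠ 0)
    (hmul : ∀ x y : R, x * y = 0 → x = 0 ∨ y = 0)
    (hadd : ∀ x y : R, IsSumFourSq x → IsSumFourSq y → IsSumFourSq (x + y))
    (hneg : ∀ x : R, IsSumFourSq x → IsSumFourSq (-x) → x = 0)
    (htot : ∀ x : R, IsSumFourSq x ∨ IsSumFourSq (-x)) :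
    ∃ (_ : LinearOrder R) (_ : IsStrictOrderedRing R), ∀ x : R, 0 ≤ x ↔ IsSumFourSq x := by
  classical
  let o : LinearOrder R :=
    { le := fun a b => IsSumFourSq (b - a)
      le_refl := fun a => by
        rw [sub_self]; simpa using isSumFourSq_sq (0 : R)
      le_trans := fun a b c h1 h2 => by
        have := hadd _ _ h1 h2
        rwa [sub_add_sub_cancel'] at this
      le_antisymm := fun a b h1 h2 => by
        have := hneg (b - a) h1 (by rwa [neg_sub])
        exact (sub_eq_zero.mp this).symm
      le_total := fun a b => by
        have := htot (b - a)
        rwa [neg_sub] at this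
      toDecidableLE := Classical.decRel _ }
  have h0 : ∀ x : R, 0 ≤ x ↔ IsSumFourSq x := fun x => by
    change IsSumFourSq (x - 0) ↔ _
    rw [sub_zero]
  have : Nontrivial R := ⟨1, 0, h01⟩
  have : IsOrderedAddMonoid R :=
    { add_le_add_left := fun a b h c => by
        change IsSumFourSq _
        rw [add_sub_add_right_eq_sub]; exact h }
  have : ZeroLEOneClass R := ⟨by rw [h0]; simpa using isSumFourSq_sq (1 : R)⟩
  have : IsStrictOrderedRing R := IsStrictOrderedRing.of_mul_pos fun a b ha hb => by
    refine lt_of_le_of_ne ((h0 _).mpr (((h0 _).mp ha.le).mul ((h0 _).mp hb.le))) fun h => ?_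
    rcases hmul a b h.symm with h | h
    · exact ha.ne' h
    · exact hb.ne' h
  exact ⟨o, this, h0⟩

end SumsOfSquares

namespace RTerm

/-- Renaming of variables. -/
def rename {β γ : Type} (f : β → γ) : RTerm β → RTerm γ
  | var b => var (f b)
  | zero => 0
  | one => 1
  | neg t => -rename f t
  | add s t => rename f s + rename f t
  | mul s t => rename f s * rename f t

@[simp] theorem eval_rename {β γ : Type} (f : β → γ) (t : RTerm β) {R : Type w} [CommRing R]
    (w : γ → R) : (t.rename f).eval w = t.eval (w ∘ f) := by
  induction t with
  | var b => rfl
  | zero => rfl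
  | one => rfl
  | neg t ih => simp only [rename, eval_neg, ih]; rfl
  | add s t hs ht => simp only [rename, eval_add, hs, ht]; rfl
  | mul s t hs ht => simp only [rename, eval_mul, hs, ht]; rfl

/-- The product of two `2 × 2` matrices of terms. -/
def matMul {β : Type} (x y : Fin 2 → Fin 2 → RTerm β) : Fin 2 → Fin 2 → RTerm β :=
  fun i j => x i 0 * y 0 j + x i 1 * y 1 j

theorem eval_matMul {β : Type} {x y : Fin 2 → Fin 2 → RTerm β} {R : Type w} [CommRing R]
    {w : β → R} {X Y : SL2 R} (hX : ∀ i j, X i j = (x i j).eval w)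
    (hY : ∀ i j, Y i j = (y i j).eval w) (i j : Fin 2) :
    (X * Y) i j = (matMul x y i j).eval w := by
  simp [matMul, Matrix.mul_apply, Fin.sum_univ_two, hX, hY]

end RTerm

namespace TwoSorted

variable {α β : Type}

/-- The formula saying that `t` is a sum of four squares. -/
def sumFourSq (t : RTerm β) : TwoSorted α β :=
  exR (Fin 4) (eqR (t.rename .inl) (RTerm.var (.inr 0) * RTerm.var (.inr 0) +
    RTerm.var (.inr 1) * RTerm.var (.inr 1) + RTerm.var (.inr 2) * RTerm.var (.inr 2) +
    RTerm.var (.inr 3) * RTerm.var (.inr 3)))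

/-- The formula saying that `t` is non-zero and a sum of four squares. -/
def pos (t : RTerm β) : TwoSorted α β := and (sumFourSq t) (not (eqR t 0))

/-- The formula saying that the row symbol of a matrix with lower row `(s, t)` is positive. -/
def rowPos (s t : RTerm β) : TwoSorted α β := or (pos s) (and (eqR s 0) (pos t))

/-- The formula saying that `t` is the multiple of the constant by the value of the Asai cocycle at
two matrices. -/
def asai (x y : Fin 2 → Fin 2 → RTerm β) (t : ATerm α) : TwoSorted α β :=
  or (and (and (rowPos (x 1 0) (x 1 1)) (and (rowPos (y 1 0) (y 1 1))
      (rowPos (-RTerm.matMul x y 1 0) (-RTerm.matMul x y 1 1)))) (eqA t ATerm.const))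
    (or (and (and (rowPos (-x 1 0) (-x 1 1)) (and (rowPos (-y 1 0) (-y 1 1))
      (rowPos (RTerm.matMul x y 1 0) (RTerm.matMul x y 1 1)))) (eqA t (-ATerm.const)))
    (and (not (or (and (rowPos (x 1 0) (x 1 1)) (and (rowPos (y 1 0) (y 1 1))
      (rowPos (-RTerm.matMul x y 1 0) (-RTerm.matMul x y 1 1))))
      (and (rowPos (-x 1 0) (-x 1 1)) (and (rowPos (-y 1 0) (-y 1 1))
      (rowPos (RTerm.matMul x y 1 0) (RTerm.matMul x y 1 1)))))) (eqA t 0)))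

variable {A R : Type w} [AddCommGroup A] [CommRing R] (F : SL2 R → A → Prop) (c : A) (u : α → A)
  (w : β → R)

@[simp] theorem realize_sumFourSq (t : RTerm β) :
    (sumFourSq t : TwoSorted α β).Realize F c u w ↔ IsSumFourSq (t.eval w) := by
  simp only [sumFourSq, realize_exR, realize_eqR, RTerm.eval_rename, RTerm.eval_add,
    RTerm.eval_mul, RTerm.eval_var, Sum.elim_inr]
  rfl

variable [LinearOrder R]

theorem realize_pos (h0 : ∀ x : R, 0 ≤ x ↔ IsSumFourSq x) (t : RTerm β) :
    (pos t : TwoSorted α β).Realize F c u w ↔ 0 < t.eval w := by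
  simp only [pos, realize_and, realize_sumFourSq, ← h0, realize_not, realize_eqR, RTerm.eval_zero]
  rw [lt_iff_le_and_ne, ne_comm]

theorem realize_rowPos (h0 : ∀ x : R, 0 ≤ x ↔ IsSumFourSq x)
    (s t : RTerm β) {g : SL2 R} (hs : g 1 0 = s.eval w)
    (ht : g 1 1 = t.eval w) :
    (rowPos s t : TwoSorted α β).Realize F c u w ↔ 0 < rowSymbol g := by
  simp only [rowPos, realize_or, realize_and, realize_pos F c u w h0, realize_eqR, RTerm.eval_zero]
  rw [← hs, ← ht]
  unfold rowSymbol
  by_cases h : g 1 0 = 0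
  · simp [h]
  · simp [h]

variable [IsStrictOrderedRing R]

theorem realize_rowPos_neg (h0 : ∀ x : R, 0 ≤ x ↔ IsSumFourSq x)
    (s t : RTerm β) {g : SL2 R} (hs : g 1 0 = s.eval w)
    (ht : g 1 1 = t.eval w) :
    (rowPos (-s) (-t) : TwoSorted α β).Realize F c u w ↔ rowSymbol g < 0 := by
  simp only [rowPos, realize_or, realize_and, realize_pos F c u w h0, realize_eqR, RTerm.eval_zero,
    RTerm.eval_neg]
  rw [← hs, ← ht]
  unfold rowSymbol
  by_cases h : g 1 0 = 0
  · simp [h]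
  · simp [h]

theorem realize_asai (h0 : ∀ x : R, 0 ≤ x ↔ IsSumFourSq x)
    {x y : Fin 2 → Fin 2 → RTerm β} {X Y : SL2 R}
    (hX : ∀ i j, X i j = (x i j).eval w) (hY : ∀ i j, Y i j = (y i j).eval w) (t : ATerm α) :
    (asai x y t).Realize F c u w ↔ t.eval c u = asaiCocycle X Y • c := by
  have hXY := RTerm.eval_matMul hX hY
  simp only [asai, realize_or, realize_and, realize_not, realize_eqA, ATerm.eval_const,
    ATerm.eval_neg, ATerm.eval_zero, realize_rowPos F c u w h0 _ _ (hX 1 0) (hX 1 1),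
    realize_rowPos F c u w h0 _ _ (hY 1 0) (hY 1 1),
    realize_rowPos F c u w h0 _ _ (hXY 1 0) (hXY 1 1),
    realize_rowPos_neg F c u w h0 _ _ (hX 1 0) (hX 1 1),
    realize_rowPos_neg F c u w h0 _ _ (hY 1 0) (hY 1 1),
    realize_rowPos_neg F c u w h0 _ _ (hXY 1 0) (hXY 1 1)]
  unfold asaiCocycle
  by_cases h1 : 0 < rowSymbol X ∧ 0 < rowSymbol Y ∧ rowSymbol (X * Y) < 0
  · have h2 : ¬ (rowSymbol X < 0 ∧ rowSymbol Y < 0 ∧ 0 < rowSymbol (X * Y)) :=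
      fun h => h.1.not_gt h1.1
    rw [if_pos h1]
    simp [h1, h2]
  · rw [if_neg h1]
    by_cases h2 : rowSymbol X < 0 ∧ rowSymbol Y < 0 ∧ 0 < rowSymbol (X * Y)
    · rw [if_pos h2]
      simp [h1, h2]
    · rw [if_neg h2]
      simp [h1, h2]

end TwoSorted

/-! ### First-order properties of the splitting function -/

/-- The first-order properties of the graph `F` of the splitting function, restricted to its domain
of integrality, that the argument uses. They hold in `ℤ`, and so in every elementary extension;
`c` is the interpretation of `1`. -/
structure IsAsaiGraph {A R : Type w} [AddCommGroup A] [CommRing R] [LinearOrder R]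
    (F : SL2 R → A → Prop) (c : A) : Prop where
  unique : ∀ {x a b}, F x a → F x b → a = b
  mul : ∀ {x y a b}, F x a → F y b → F (x * y) (a + b - asaiCocycle x y • c)
  inv : ∀ {x a}, F x a → ∃ b, F x⁻¹ b
  exists_mul : ∀ x, ∃ i : ℕ, i < 12 ∧ ∃ a, F (x * upperUnip (i : R)) a

/-- The standard graph has these properties. -/
theorem isAsaiGraph_asaiSplittingGraph : IsAsaiGraph asaiSplittingGraph (1 : ℤ) where
  unique := fun h1 h2 => by exact_mod_cast h1.2.symm.trans h2.2
  mul := fun {x y a b} h1 h2 => by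
    refine ⟨mul_mem h1.1 h2.1, ?_⟩
    rw [splitsVia_asaiSplitting.asai_mul, h1.2, h2.2]
    simp
  inv := fun {x a} h => by
    obtain ⟨n, hn⟩ := splitsVia_asaiSplitting.asai_exists_int (inv_mem h.1)
    exact ⟨n, inv_mem h.1, hn⟩
  exists_mul := fun x => by
    obtain ⟨i, hi, h⟩ := exists_mul_upperUnip_mem_commutator x
    obtain ⟨n, hn⟩ := splitsVia_asaiSplitting.asai_exists_int h
    rw [← zpow_natCast, upperUnip_zpow, mul_one, Int.cast_natCast] at h hn
    exact ⟨i, hi, n, h, hn⟩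

theorem specialLinearGroup_ext_of_eq {R : Type w} [CommRing R] {x y : SL2 R}
    (h : ∀ i j, x i j = y i j) : x = y := by
  ext i j; exact h i j

theorem exists_specialLinearGroup_iff {R : Type w} [CommRing R] {x : SL2 R}
    {m : Fin 2 → Fin 2 → R} (hx : ∀ i j, x i j = m i j) (P : SL2 R → Prop) :
    (∃ g : SL2 R, (∀ i j, g i j = m i j) ∧ P g) ↔ P x := by
  constructor
  · rintro ⟨g, hg, h⟩
    have : g = x := specialLinearGroup_ext_of_eq fun i j => by rw [hg, hx]
    rwa [← this]
  · intro h
    exact ⟨x, hx, h⟩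

namespace RTerm

/-- The matrix whose entries are the variables `f (i, j)`. -/
def matVar {β : Type} (f : Fin 2 × Fin 2 → β) : Fin 2 → Fin 2 → RTerm β := fun i j => var (f (i, j))

/-- The upper unipotent matrix with upper right entry `t`. -/
def matUnip {β : Type} (t : RTerm β) : Fin 2 → Fin 2 → RTerm β := ![![1, t], ![0, 1] ]

/-- The adjugate of a matrix of terms. -/
def matAdj {β : Type} (x : Fin 2 → Fin 2 → RTerm β) : Fin 2 → Fin 2 → RTerm β :=
  ![![x 1 1, -x 0 1], ![-x 1 0, x 0 0] ]

variable {β : Type} {R : Type w} [CommRing R] (w : β → R)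

theorem eval_matUnip (t : RTerm β) (i j : Fin 2) :
    upperUnip (t.eval w) i j = (matUnip t i j).eval w := by
  fin_cases i <;> fin_cases j <;> rfl

theorem eval_matAdj {x : Fin 2 → Fin 2 → RTerm β} {X : SL2 R}
    (hX : ∀ i j, X i j = (x i j).eval w) (i j : Fin 2) : X⁻¹ i j = (matAdj x i j).eval w := by
  rw [Matrix.SpecialLinearGroup.coe_inv, Matrix.adjugate_fin_two]
  fin_cases i <;> fin_cases j <;> simp [matAdj, hX]

end RTerm

section TransferFacts

variable {L : FirstOrder.Language.{u, v}} {φ : baseLang →ᴸ L} [L.Structure (ℤ ⊕ ℤ)]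
  {A R : Type w} [AddCommGroup A] [CommRing R] [L.Structure (A ⊕ R)] {F : SL2 R → A → Prop}
  {F₀ : SL2 ℤ → ℤ → Prop} {ι : (ℤ ⊕ ℤ) ↪ₑ[L] (A ⊕ R)}

open TwoSorted

/-- The ring sort of an elementary extension is ordered by sums of four squares. -/
theorem IsExpansionOf.exists_linearOrder (hN : IsExpansionOf φ ℤ ℤ F₀)
    (hM : IsExpansionOf φ A R F) {c : A} (hc : ι (.inl 1) = .inl c) :
    ∃ (_ : LinearOrder R) (_ : IsStrictOrderedRing R), ∀ x : R, 0 ≤ x ↔ IsSumFourSq x := by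
  apply exists_linearOrder_of_isSumFourSq
  · have h := hN.transfer ι hM hc (not (eqR 1 0))
    simp only [realize_not, realize_eqR, RTerm.eval_one, RTerm.eval_zero] at h
    exact h.mp one_ne_zero
  · have h := hN.transfer ι hM hc (allR (Fin 2) (imp
      (eqR (RTerm.var (.inr 0) * RTerm.var (.inr 1)) 0)
      (or (eqR (RTerm.var (.inr 0)) 0) (eqR (RTerm.var (.inr 1)) 0))))
    simp only [realize_allR, realize_imp, realize_or, realize_eqR, RTerm.eval_mul, RTerm.eval_var,
      RTerm.eval_zero, Sum.elim_inr] at h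
    intro x y
    exact h.mp (fun z => mul_eq_zero.mp) ![x, y]
  · have h := hN.transfer ι hM hc (allR (Fin 2) (imp (sumFourSq (RTerm.var (.inr 0)))
      (imp (sumFourSq (RTerm.var (.inr 1)))
        (sumFourSq (RTerm.var (.inr 0) + RTerm.var (.inr 1))))))
    simp only [realize_allR, realize_imp, realize_sumFourSq, RTerm.eval_add, RTerm.eval_var,
      Sum.elim_inr] at h
    intro x y
    exact h.mp (fun z => by simp only [Int.isSumFourSq_iff]; exact add_nonneg) ![x, y]
  · have h := hN.transfer ι hM hc (allR Unit (imp (sumFourSq (RTerm.var (.inr ())))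
      (imp (sumFourSq (-RTerm.var (.inr ()))) (eqR (RTerm.var (.inr ())) 0))))
    simp only [realize_allR, realize_imp, realize_sumFourSq, RTerm.eval_neg, RTerm.eval_var,
      Sum.elim_inr, realize_eqR, RTerm.eval_zero] at h
    intro x
    refine h.mp (fun z => ?_) fun _ => x
    simp only [Int.isSumFourSq_iff]
    intro h1 h2
    omega
  · have h := hN.transfer ι hM hc (allR Unit (or (sumFourSq (RTerm.var (.inr ())))
      (sumFourSq (-RTerm.var (.inr ())))))
    simp only [realize_allR, realize_or, realize_sumFourSq, RTerm.eval_neg, RTerm.eval_var,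
      Sum.elim_inr] at h
    intro x
    refine h.mp (fun z => ?_) fun _ => x
    simp only [Int.isSumFourSq_iff]
    omega

theorem realize_rel_iff {α β : Type} (c : A) (u : α → A) (w : β → R)
    {m : Fin 2 → Fin 2 → RTerm β} {x : SL2 R} (hx : ∀ i j, x i j = (m i j).eval w) (t : ATerm α) :
    (rel m t).Realize F c u w ↔ F x (t.eval c u) := by
  rw [realize_rel, exists_specialLinearGroup_iff hx (fun g => F g (t.eval c u))]

theorem realize_rel_matVar {α β : Type} (c : A) (u : α → A) (w : β → R)
    {f : Fin 2 × Fin 2 → β} {t : ATerm α} (h : (rel (RTerm.matVar f) t).Realize F c u w) :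
    ∃ x : SL2 R, ∀ i j, x i j = w (f (i, j)) := by
  obtain ⟨g, hg, -⟩ := h
  exact ⟨g, hg⟩

/-- The order of the ring sort is discrete. -/
theorem IsExpansionOf.one_le_of_pos [LinearOrder R] [IsStrictOrderedRing R]
    (hN : IsExpansionOf φ ℤ ℤ F₀) (hM : IsExpansionOf φ A R F)
    {c : A} (hc : ι (.inl 1) = .inl c) (h0 : ∀ x : R, 0 ≤ x ↔ IsSumFourSq x) {x : R}
    (hx : 0 < x) : 1 ≤ x := by
  have T := (hN.transfer ι hM hc (allR Unit (imp (pos (RTerm.var (.inr ())))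
    (sumFourSq (RTerm.var (.inr ()) + -1))))).mp
  simp only [realize_allR, realize_imp, realize_sumFourSq, realize_pos _ _ _ _ h0,
    realize_pos _ _ _ _ (fun x => (Int.isSumFourSq_iff x).symm), RTerm.eval_add, RTerm.eval_neg,
    RTerm.eval_one, RTerm.eval_var, Sum.elim_inr, Int.isSumFourSq_iff, ← h0] at T
  have := T (fun z hz => by omega) (fun _ => x) hx
  linarith

/-- Division with remainder by a standard integer. -/
theorem IsExpansionOf.exists_nsmul_add (hN : IsExpansionOf φ ℤ ℤ F₀) (hM : IsExpansionOf φ A R F)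
    {c : A} (hc : ι (.inl 1) = .inl c) {n : ℕ} (hn : n ≠ 0) (a : A) :
    ∃ i < n, ∃ b : A, a = n • b + i • c := by
  have T := (hN.transfer ι hM hc (allA Unit (iOr (fun i => exA Unit (eqA
    (ATerm.var (.inl (.inr ())))
    (ATerm.nsmul n (ATerm.var (.inr ())) + ATerm.nsmul i ATerm.const))) n))).mp
  simp only [realize_allA, realize_iOr, realize_exA, realize_eqA, ATerm.eval_var, Sum.elim_inl,
    Sum.elim_inr, ATerm.eval_add, ATerm.eval_nsmul, ATerm.eval_const] at T
  obtain ⟨i, hi, b, hb⟩ := T (fun z => ⟨(z () % n).toNat, by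
    have := Int.emod_lt_of_pos (z ()) (b := n) (by omega)
    omega, fun _ => z () / n, by
    have h1 := Int.emod_nonneg (z ()) (b := n) (by omega)
    have h2 := Int.mul_ediv_add_emod (z ()) n
    simp only [nsmul_eq_mul, mul_one]
    rw [Int.toNat_of_nonneg h1, h2]⟩) fun _ => a
  exact ⟨i, hi, _, hb⟩

/-- A standard integer is divisible by `n` in the extension only if it is so in `ℤ`. -/
theorem IsExpansionOf.dvd_of_nsmul_eq (hN : IsExpansionOf φ ℤ ℤ F₀) (hM : IsExpansionOf φ A R F)
    {c : A} (hc : ι (.inl 1) = .inl c) {n : ℕ} {m : ℤ} {b : A} (h : n • b = m • c) :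
    (n : ℤ) ∣ m := by
  have key : ∀ m : ℕ, ∀ b : A, n • b = m • c → (n : ℤ) ∣ m := by
    intro m b h
    have T := (hN.transfer ι hM hc (exA Unit (eqA (ATerm.nsmul n (ATerm.var (.inr ())))
      (ATerm.nsmul m ATerm.const)))).mpr
    simp only [realize_exA, realize_eqA, ATerm.eval_var, Sum.elim_inr, ATerm.eval_nsmul,
      ATerm.eval_const] at T
    obtain ⟨z, hz⟩ := T ⟨fun _ => b, h⟩
    exact ⟨z (), by simpa using hz.symm⟩
  obtain ⟨m, rfl | rfl⟩ := m.eq_nat_or_neg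
  · exact key m b (by simpa using h)
  · exact (Int.dvd_neg).mpr (key m (-b) (by rw [smul_neg, h]; simp))

variable [LinearOrder R] [IsStrictOrderedRing R]

/-- The properties in `IsAsaiGraph` are expressed by two-sorted sentences, so they pass to
elementary extensions. -/
theorem IsExpansionOf.isAsaiGraph (hN : IsExpansionOf φ ℤ ℤ F₀) (hM : IsExpansionOf φ A R F)
    {c : A} (hc : ι (.inl 1) = .inl c) (h0 : ∀ x : R, 0 ≤ x ↔ IsSumFourSq x)
    (h : IsAsaiGraph F₀ (1 : ℤ)) : IsAsaiGraph F c where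
  unique := by
    have T := (hN.transfer ι hM hc (allR (Fin 2 × Fin 2) (allA (Fin 2)
      (imp (rel (RTerm.matVar .inr) (ATerm.var (.inr 0)))
        (imp (rel (RTerm.matVar .inr) (ATerm.var (.inr 1)))
          (eqA (ATerm.var (.inr 0)) (ATerm.var (.inr 1)))))))).mp
    simp only [realize_allR, realize_allA, realize_imp] at T
    intro x a b ha hb
    refine T ?_ (fun p => x p.1 p.2) ![a, b] ?_ ?_
    · intro z u h1 h2
      obtain ⟨g, hg⟩ := realize_rel_matVar _ _ _ h1
      rw [realize_rel_iff _ _ _ hg] at h1 h2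
      exact h.unique h1 h2
    · rw [realize_rel_iff _ _ _ (x := x) fun i j => rfl]; exact ha
    · rw [realize_rel_iff _ _ _ (x := x) fun i j => rfl]; exact hb
  mul := by
    have T := (hN.transfer ι hM hc (allR (Fin 2 × Fin 2) (allR (Fin 2 × Fin 2) (allA (Fin 3)
      (imp (rel (RTerm.matVar (.inl ∘ .inr)) (ATerm.var (.inr 0)))
        (imp (rel (RTerm.matVar .inr) (ATerm.var (.inr 1)))
          (imp (asai (RTerm.matVar (.inl ∘ .inr)) (RTerm.matVar .inr) (ATerm.var (.inr 2)))
          (rel (RTerm.matMul (RTerm.matVar (.inl ∘ .inr)) (RTerm.matVar .inr))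
            (ATerm.var (.inr 0) + ATerm.var (.inr 1) + -ATerm.var (.inr 2)))))))))).mp
    simp only [realize_allR, realize_allA, realize_imp] at T
    intro x y a b ha hb
    have := T ?_ (fun p => x p.1 p.2) (fun p => y p.1 p.2) ![a, b, asaiCocycle x y • c] ?_ ?_ ?_
    · rw [realize_rel_iff _ _ _ (x := x * y)
        (RTerm.eval_matMul (fun i j => rfl) (fun i j => rfl))] at this
      rw [sub_eq_add_neg]
      exact this
    · intro z z' u h1 h2 h3
      obtain ⟨g, hg⟩ := realize_rel_matVar _ _ _ h1
      obtain ⟨g', hg'⟩ := realize_rel_matVar _ _ _ h2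
      rw [realize_rel_iff _ _ _ hg] at h1
      rw [realize_rel_iff _ _ _ hg'] at h2
      rw [realize_asai _ _ _ _ (fun x => (Int.isSumFourSq_iff x).symm) hg hg'] at h3
      rw [realize_rel_iff _ _ _ (RTerm.eval_matMul hg hg')]
      have := h.mul h1 h2
      rw [← h3, sub_eq_add_neg] at this
      exact this
    · rw [realize_rel_iff _ _ _ (x := x) fun i j => rfl]; exact ha
    · rw [realize_rel_iff _ _ _ (x := y) fun i j => rfl]; exact hb
    · rw [realize_asai _ _ _ _ h0 (X := x) (Y := y) (fun i j => rfl) (fun i j => rfl)]; rfl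
  inv := by
    have T := (hN.transfer ι hM hc (allR (Fin 2 × Fin 2) (allA Unit
      (imp (rel (RTerm.matVar .inr) (ATerm.var (.inr ())))
        (exA Unit (rel (RTerm.matAdj (RTerm.matVar .inr)) (ATerm.var (.inr ())))))))).mp
    simp only [realize_allR, realize_allA, realize_imp, realize_exA] at T
    intro x a ha
    have hT := T ?_ (fun p => x p.1 p.2) (fun _ => a) ?_
    · obtain ⟨b, hb⟩ := hT
      rw [realize_rel_iff _ _ _ (RTerm.eval_matAdj _ (X := x) fun i j => rfl)] at hb
      exact ⟨_, hb⟩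
    · intro z u h1
      obtain ⟨g, hg⟩ := realize_rel_matVar _ _ _ h1
      rw [realize_rel_iff _ _ _ hg] at h1
      obtain ⟨b, hb⟩ := h.inv h1
      refine ⟨fun _ => b, ?_⟩
      rw [realize_rel_iff _ _ _ (RTerm.eval_matAdj _ hg)]
      exact hb
    · rw [realize_rel_iff _ _ _ (x := x) fun i j => rfl]; exact ha
  exists_mul := by
    have T := (hN.transfer ι hM hc (allR (Fin 2 × Fin 2)
      (imp (eqR (RTerm.var (.inr (0, 0)) * RTerm.var (.inr (1, 1)) +
        -(RTerm.var (.inr (0, 1)) * RTerm.var (.inr (1, 0)))) 1)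
        (iOr (fun i => exA Unit (rel (RTerm.matMul (RTerm.matVar .inr)
          (RTerm.matUnip (RTerm.nat i))) (ATerm.var (.inr ())))) 12)))).mp
    simp only [realize_allR, realize_imp, realize_exA, realize_iOr, realize_eqR] at T
    intro x
    have hT := T ?_ (fun p => x p.1 p.2) ?_
    · obtain ⟨i, hi, b, hb⟩ := hT
      rw [realize_rel_iff _ _ _ (RTerm.eval_matMul (X := x) (fun i j => rfl)
        (RTerm.eval_matUnip _ _)), RTerm.eval_nat] at hb
      exact ⟨i, hi, _, hb⟩
    · intro z hz
      let g : SL2 ℤ := ⟨Matrix.of fun i j => z (i, j), by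
        rw [Matrix.det_fin_two, sub_eq_add_neg]; exact hz⟩
      obtain ⟨i, hi, b, hb⟩ := h.exists_mul g
      refine ⟨i, hi, fun _ => b, ?_⟩
      rw [realize_rel_iff _ _ _ (RTerm.eval_matMul (X := g) (fun i j => rfl)
        (RTerm.eval_matUnip _ _)), RTerm.eval_nat]
      exact hb
    · have := x.det_coe
      rw [Matrix.det_fin_two, sub_eq_add_neg] at this
      exact this

end TransferFacts

/-! ### Saturation in several variables -/

section Saturation

variable {L : FirstOrder.Language.{u, v}} {M : Type w} [L.Structure M] {κ : Cardinal.{w}}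

/-- If a family is closed under intersections, a finite set of its images under a monotone map has a
lower bound among these images. -/
theorem exists_subset_of_finite {X Y : Type*} {𝒮 : Set (Set X)} (hne : 𝒮.Nonempty)
    (hinter : ∀ S ∈ 𝒮, ∀ T ∈ 𝒮, S ∩ T ∈ 𝒮) {f : Set X → Set Y} (hf : Monotone f)
    {𝒯 : Set (Set Y)} (h𝒯 : 𝒯.Finite) (h : 𝒯 ⊆ f '' 𝒮) : ∃ S ∈ 𝒮, ∀ T ∈ 𝒯, f S ⊆ T := by
  induction 𝒯, h𝒯 using Set.Finite.induction_on with
  | empty =>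
    obtain ⟨S, hS⟩ := hne
    exact ⟨S, hS, by simp⟩
  | @insert T 𝒯 _ _ ih =>
    obtain ⟨S, hS, hS'⟩ := ih fun T hT => h (Set.mem_insert_of_mem _ hT)
    obtain ⟨S', hS'', rfl⟩ := h (Set.mem_insert _ _)
    refine ⟨S ∩ S', hinter _ hS _ hS'', ?_⟩
    rintro T (rfl | hT)
    · exact hf Set.inter_subset_right
    · exact (hf Set.inter_subset_left).trans (hS' T hT)

/-- A fibre of a definable set is definable over the parameters and the point of the base. -/
theorem Set.Definable.fiber {P : Set M} {n : ℕ} {S : Set (Fin (n + 1) → M)} (hS : P.Definable L S)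
    (a : M) : (insert a P).Definable L {v : Fin n → M | (Fin.cons a v : Fin (n + 1) → M) ∈ S} := by
  rw [Set.definable_iff_exists_formula_sum] at hS ⊢
  obtain ⟨ψ, rfl⟩ := hS
  let r : P ⊕ Fin (n + 1) → (insert a P : Set M) ⊕ Fin n :=
    Sum.elim (fun p => .inl ⟨p, Set.mem_insert_of_mem _ p.2⟩)
      (Fin.cons (.inl ⟨a, Set.mem_insert _ _⟩) .inr)
  refine ⟨ψ.relabel r, ?_⟩
  ext v
  rw [Set.mem_ofPred_eq, Set.mem_ofPred_eq, Set.mem_ofPred_eq, Formula.realize_relabel]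
  have : (Sum.elim (fun p : (insert a P : Set M) => (p : M)) v ∘ r : P ⊕ Fin (n + 1) → M) =
      Sum.elim (fun p : P => (p : M)) (Fin.cons a v) := by
    ext (p | i)
    · rfl
    · refine Fin.cases ?_ (fun i => ?_) i <;> rfl
  rw [this]

/-- Saturation in one variable implies saturation in finitely many variables: the coordinates of a
common point are found one at a time. -/
theorem IsSaturatedModel.sInter_nonempty_fin (hsat : IsSaturatedModel L M κ) (hκ : ℵ₀ ≤ κ) {n : ℕ}
    {P : Set M} (hP : #P < κ) {𝒮 : Set (Set (Fin n → M))} (hdef : ∀ S ∈ 𝒮, P.Definable L S)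
    (h𝒮 : 𝒮.Nonempty) (hinter : ∀ S ∈ 𝒮, ∀ T ∈ 𝒮, S ∩ T ∈ 𝒮) (hne : ∀ S ∈ 𝒮, S.Nonempty) :
    (⋂₀ 𝒮).Nonempty := by
  induction n generalizing P with
  | zero =>
    refine ⟨Fin.elim0, fun S hS => ?_⟩
    obtain ⟨v, hv⟩ := hne S hS
    rwa [Subsingleton.elim v Fin.elim0] at hv
  | succ n ih =>
    let f : Set (Fin (n + 1) → M) → Set M := fun S => (fun v => v 0) '' S
    have hf : Monotone f := fun _ _ h => Set.image_mono h
    obtain ⟨a, ha⟩ := hsat P hP (f '' 𝒮) (by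
      rintro _ ⟨S, hS, rfl⟩
      have := (hdef S hS).image_comp (fun _ : Fin 1 => (0 : Fin (n + 1)))
      unfold Set.Definable₁
      convert this using 1
      ext x
      simp only [f, Set.mem_ofPred_eq, Set.mem_image]
      refine exists_congr fun v => and_congr_right fun _ => ?_
      constructor
      · intro h
        funext i
        rw [Subsingleton.elim i 0]
        exact h
      · rintro rfl; rfl) (by
      intro 𝒯 h𝒯 hfin
      obtain ⟨S, hS, h⟩ := exists_subset_of_finite h𝒮 hinter hf hfin h𝒯
      obtain ⟨v, hv⟩ := hne S hS
      exact ⟨v 0, fun T hT => h T hT ⟨v, hv, rfl⟩⟩)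
    let g : Set (Fin (n + 1) → M) → Set (Fin n → M) :=
      fun S => {v | (Fin.cons a v : Fin (n + 1) → M) ∈ S}
    obtain ⟨v, hv⟩ := ih (P := insert a P)
      ((mk_insert_le).trans_lt (add_lt_of_lt hκ hP (one_lt_aleph0.trans_le hκ)))
      (𝒮 := g '' 𝒮)
      (by
        rintro _ ⟨S, hS, rfl⟩
        exact (hdef S hS).fiber a)
      (h𝒮.image g)
      (by
        rintro _ ⟨S, hS, rfl⟩ _ ⟨T, hT, rfl⟩
        exact ⟨S ∩ T, hinter _ hS _ hT, rfl⟩)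
      (by
        rintro _ ⟨S, hS, rfl⟩
        obtain ⟨v, hv, hva⟩ := ha (f S) ⟨S, hS, rfl⟩
        refine ⟨Fin.tail v, ?_⟩
        change Fin.cons a (Fin.tail v) ∈ S
        simp only at hva
        rwa [← hva, Fin.cons_self_tail])
    exact ⟨Fin.cons a v, fun S hS => hv (g S) ⟨S, hS, rfl⟩⟩

theorem IsSaturatedModel.sInter_nonempty (hsat : IsSaturatedModel L M κ) (hκ : ℵ₀ ≤ κ) {I : Type}
    [Finite I] {P : Set M} (hP : #P < κ) {𝒮 : Set (Set (I → M))}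
    (hdef : ∀ S ∈ 𝒮, P.Definable L S) (h𝒮 : 𝒮.Nonempty)
    (hinter : ∀ S ∈ 𝒮, ∀ T ∈ 𝒮, S ∩ T ∈ 𝒮) (hne : ∀ S ∈ 𝒮, S.Nonempty) : (⋂₀ 𝒮).Nonempty := by
  obtain ⟨n, ⟨e⟩⟩ := Finite.exists_equiv_fin I
  let g : Set (I → M) → Set (Fin n → M) := fun S => (fun v : Fin n → M => v ∘ e) ⁻¹' S
  obtain ⟨v, hv⟩ := hsat.sInter_nonempty_fin hκ hP (𝒮 := g '' 𝒮)
    (by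
      rintro _ ⟨S, hS, rfl⟩
      exact (hdef S hS).preimage_comp e)
    (h𝒮.image g)
    (by
      rintro _ ⟨S, hS, rfl⟩ _ ⟨T, hT, rfl⟩
      exact ⟨S ∩ T, hinter _ hS _ hT, rfl⟩)
    (by
      rintro _ ⟨S, hS, rfl⟩
      obtain ⟨v, hv⟩ := hne S hS
      refine ⟨v ∘ e.symm, ?_⟩
      change (v ∘ e.symm) ∘ e ∈ S
      rwa [Function.comp_assoc, e.symm_comp_self, Function.comp_id])
  exact ⟨v ∘ e, fun S hS => hv (g S) ⟨S, hS, rfl⟩⟩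

/-- An infinite definable subset of a saturated model is not small. -/
theorem IsSaturatedModel.le_mk_of_infinite (hsat : IsSaturatedModel L M κ) (hκ : ℵ₀ ≤ κ)
    {P : Set M} (hP : #P < κ) {D : Set M} (hD : P.Definable₁ L D) (hinf : D.Infinite) : κ ≤ #D := by
  -- a point of `D` that avoids every element of `D` would be finitely consistent
  by_contra hlt
  rw [not_le] at hlt
  obtain ⟨x, hx⟩ := hsat (P ∪ D) ((mk_union_le _ _).trans_lt (add_lt_of_lt hκ hP hlt))
    (insert D ((fun d => D \ {d}) '' D)) (by
      have hD' : (P ∪ D).Definable₁ L D := Set.Definable.mono hD Set.subset_union_left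
      rintro _ (rfl | ⟨d, hd, rfl⟩)
      · exact hD'
      · refine Set.Definable.sdiff (s := {x : Fin 1 → M | x 0 ∈ D})
          (t := {x : Fin 1 → M | x 0 ∈ ({d} : Set M)}) hD' ?_
        rw [Set.definable_iff_exists_formula_sum]
        refine ⟨Term.equal (Term.var (.inr 0)) (Term.var (.inl ⟨d, .inr hd⟩)), ?_⟩
        ext x
        simp [Formula.realize_equal]) (by
      intro 𝒯 h𝒯 hfin
      -- finitely many sets of the family exclude finitely many elements of `D` only
      have hfin' : {d ∈ D | D \ {d} ∈ 𝒯}.Finite := by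
        refine Set.Finite.of_finite_image (f := fun d => D \ {d})
          (hfin.subset (by rintro _ ⟨d, hd, rfl⟩; exact hd.2)) ?_
        intro d hd d' hd' h
        by_contra hne
        have : d' ∈ D \ {d} := ⟨hd'.1, fun h => hne h.symm⟩
        simp only at h
        rw [h] at this
        exact this.2 rfl
      obtain ⟨x, hx⟩ := (hinf.sdiff hfin').nonempty
      refine ⟨x, fun T hT => ?_⟩
      rcases h𝒯 hT with rfl | ⟨d, hd, rfl⟩
      · exact hx.1
      · refine ⟨hx.1, ?_⟩
        rintro rfl
        exact hx.2 ⟨hd, hT⟩)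
  have hxD : x ∈ D := hx D (Set.mem_insert _ _)
  exact (hx (D \ {x}) (Set.mem_insert_of_mem _ ⟨x, hxD, rfl⟩)).2 rfl

end Saturation

/-! ### Subgroups of bounded index and the central extension -/

section Index

theorem mk_quotient_le_of_injective {G X : Type w} [Group G] {K : Subgroup G} (f : G → X)
    (hf : ∀ x y, f x = f y → x⁻¹ * y ∈ K) : #(G ⧸ K) ≤ #X := by
  refine mk_le_of_injective (f := fun q : G ⧸ K => f q.out) fun p q h => ?_
  have := QuotientGroup.eq.mpr (hf _ _ h)
  rwa [QuotientGroup.out_eq', QuotientGroup.out_eq'] at this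

theorem mk_quotient_inf_lt {G : Type w} [Group G] {K K' : Subgroup G} {κ : Cardinal.{w}}
    (hκ : ℵ₀ ≤ κ) (h : #(G ⧸ K) < κ) (h' : #(G ⧸ K') < κ) : #(G ⧸ (K ⊓ K')) < κ := by
  refine lt_of_le_of_lt (mk_quotient_le_of_injective (X := (G ⧸ K) × (G ⧸ K'))
    (fun x => (QuotientGroup.mk x, QuotientGroup.mk x)) fun x y h => ?_) ?_
  · rw [Prod.mk.injEq, QuotientGroup.eq, QuotientGroup.eq] at h
    exact h
  · rw [mk_prod, lift_id, lift_id]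
    exact mul_lt_of_lt hκ h h'

theorem mk_quotient_comap_lt {G G' : Type w} [Group G] [Group G'] (f : G →* G') {K : Subgroup G'}
    {κ : Cardinal.{w}} (h : #(G' ⧸ K) < κ) : #(G ⧸ K.comap f) < κ := by
  refine lt_of_le_of_lt (mk_quotient_le_of_injective (X := G' ⧸ K)
    (fun x => QuotientGroup.mk (f x)) fun x y h => ?_) h
  rw [QuotientGroup.eq] at h
  rwa [Subgroup.mem_comap, map_mul, map_inv]

/-- A subgroup is of bounded index if its translates by finitely many elements cover the group. -/
theorem mk_quotient_lt_of_exists_mul_mem {G : Type w} [Group G] {K : Subgroup G}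
    {κ : Cardinal.{w}} (hκ : ℵ₀ ≤ κ) {J : Type} [Finite J] (r : J → G)
    (h : ∀ x, ∃ j, x * r j ∈ K) : #(G ⧸ K) < κ := by
  refine lt_of_lt_of_le ?_ hκ
  have hs : Function.Surjective fun j => (QuotientGroup.mk (r j) : G ⧸ K) := by
    intro q
    induction q using QuotientGroup.induction_on with | H x =>
    obtain ⟨j, hj⟩ := h x⁻¹
    exact ⟨j, (QuotientGroup.eq.mpr hj).symm⟩
  have := Finite.of_surjective _ hs
  exact lt_aleph0_of_finite _

/-- Two homomorphisms from a large group take some non-trivial element into a given subgroup of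
bounded index. -/
theorem exists_ne_one_mem_of_mk_quotient_lt {G V : Type w} [Group G] [Group V] {K : Subgroup G}
    {κ : Cardinal.{w}} (hκ : ℵ₀ ≤ κ) (hK : #(G ⧸ K) < κ) (hV : κ ≤ #V) (f g : V →* G) :
    ∃ r, r ≠ 1 ∧ f r ∈ K ∧ g r ∈ K := by
  by_contra! h
  refine hV.not_gt (lt_of_le_of_lt (mk_le_of_injective (β := (G ⧸ K) × (G ⧸ K))
    (f := fun r => (QuotientGroup.mk (f r), QuotientGroup.mk (g r))) fun r s hrs => ?_) ?_)
  · simp only [Prod.mk.injEq, QuotientGroup.eq, ← map_inv, ← map_mul] at hrs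
    by_contra hne
    exact h (r⁻¹ * s) (fun h1 => hne (inv_mul_eq_one.mp h1)) hrs.1 hrs.2
  · rw [mk_prod, lift_id]
    exact mul_lt_of_lt hκ hK hK

end Index

section AsaiExtension

variable {A R : Type w} [AddCommGroup A] [CommRing R] [LinearOrder R] [IsStrictOrderedRing R]

theorem isTwoCocycle_asaiCocycle_zsmul (c : A) :
    IsTwoCocycle fun x y : SL2 R => asaiCocycle x y • c where
  cocycle x y z := by
    rw [← add_smul, ← add_smul, isTwoCocycle_asaiCocycle.cocycle]
  right_one x := by rw [isTwoCocycle_asaiCocycle.right_one, zero_smul]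
  left_one x := by rw [isTwoCocycle_asaiCocycle.left_one, zero_smul]

variable (R) in
/-- The central extension of `SL₂(R)` by `A` defined by the Asai cocycle with values in the
subgroup generated by `c`. -/
abbrev AsaiExt (c : A) : Type w := CentralExt (isTwoCocycle_asaiCocycle_zsmul (R := R) c)

/-- The projection of a central extension. -/
def CentralExt.sndHom {G A : Type*} [Group G] [AddCommGroup A] {h : G → G → A}
    (hc : IsTwoCocycle h) : CentralExt hc →* G where
  toFun := CentralExt.snd
  map_one' := rfl
  map_mul' _ _ := rfl

variable {c : A}

namespace IsAsaiGraph

variable {F : SL2 R → A → Prop}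

theorem one (hF : IsAsaiGraph F c) : F 1 0 := by
  obtain ⟨i, -, a, ha⟩ := hF.exists_mul 1
  obtain ⟨b, hb⟩ := hF.inv ha
  have h := hF.mul ha hb
  rw [mul_inv_cancel] at h
  have h' := hF.mul h h
  rw [mul_one, isTwoCocycle_asaiCocycle.right_one, zero_smul, sub_zero] at h'
  have := hF.unique h h'
  rw [left_eq_add] at this
  rwa [this] at h

/-- The domain of the function with graph `F`. -/
def domain (hF : IsAsaiGraph F c) : Subgroup (SL2 R) where
  carrier := {x | ∃ a, F x a}
  one_mem' := ⟨0, hF.one⟩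
  mul_mem' := by
    rintro x y ⟨a, ha⟩ ⟨b, hb⟩
    exact ⟨_, hF.mul ha hb⟩
  inv_mem' := by
    rintro x ⟨a, ha⟩
    exact hF.inv ha

theorem mk_quotient_domain_lt (hF : IsAsaiGraph F c) {κ : Cardinal.{w}} (hκ : ℵ₀ ≤ κ) :
    #(SL2 R ⧸ hF.domain) < κ := by
  refine mk_quotient_lt_of_exists_mul_mem hκ
    (fun i : Fin 12 => upperUnip ((i : ℕ) : R)) fun x => ?_
  obtain ⟨i, hi, h⟩ := hF.exists_mul x
  exact ⟨⟨i, hi⟩, h⟩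

/-- Over the domain of the splitting function `f`, the extension is a direct product, and
`(a, x) ↦ a + f x` is a homomorphism; this is the preimage of `nA` under it. -/
def congruence (hF : IsAsaiGraph F c) (n : ℕ) : Subgroup (AsaiExt R c) where
  carrier := {e | ∃ b, F e.snd b ∧ ∃ d, e.fst + b = n • d}
  one_mem' := ⟨0, hF.one, 0, by simp⟩
  mul_mem' := by
    rintro e e' ⟨b, hb, d, hd⟩ ⟨b', hb', d', hd'⟩
    refine ⟨_, hF.mul hb hb', d + d', ?_⟩
    rw [smul_add, ← hd, ← hd', CentralExt.mul_fst]
    abel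
  inv_mem' := by
    rintro e ⟨b, hb, d, hd⟩
    obtain ⟨b', hb'⟩ := hF.inv hb
    refine ⟨b', hb', -d, ?_⟩
    have h := hF.mul hb' hb
    rw [inv_mul_cancel] at h
    have h := hF.unique h hF.one
    rw [smul_neg, ← hd, CentralExt.inv_fst]
    rw [sub_eq_zero] at h
    rw [← h]
    abel

theorem mem_congruence (hF : IsAsaiGraph F c) {n : ℕ} {e : AsaiExt R c} :
    e ∈ hF.congruence n ↔ ∃ b, F e.snd b ∧ ∃ d, e.fst + b = n • d := Iff.rfl

theorem mk_quotient_congruence_lt (hF : IsAsaiGraph F c) {κ : Cardinal.{w}} (hκ : ℵ₀ ≤ κ) {n : ℕ}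
    (hdiv : ∀ a : A, ∃ i < n, ∃ b : A, a = n • b + i • c) :
    #(AsaiExt R c ⧸ hF.congruence n) < κ := by
  refine mk_quotient_lt_of_exists_mul_mem hκ (J := Fin 12 × Fin n)
    (fun p => ⟨0, upperUnip ((p.1 : ℕ) : R)⟩ * ⟨-((p.2 : ℕ) • c), 1⟩) fun e => ?_
  obtain ⟨i, hi, b, hb⟩ := hF.exists_mul e.snd
  obtain ⟨j, hj, d, hd⟩ := hdiv (e.fst + asaiCocycle e.snd (upperUnip (i : R)) • c + b)
  refine ⟨(⟨i, hi⟩, ⟨j, hj⟩), b, ?_, d, ?_⟩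
  · simpa using hb
  · rw [← mul_assoc]
    simp only [CentralExt.mul_fst, CentralExt.mul_snd, isTwoCocycle_asaiCocycle.right_one,
      zero_smul, add_zero]
    rw [← add_right_cancel_iff (a := j • c), ← hd]
    abel

end IsAsaiGraph

end AsaiExtension

/-! ### Lifts of unipotent matrices and compatible residues -/

section Central

theorem asaiCocycle_eq_zero_of_pos_of_neg {R : Type w} [CommRing R] [LinearOrder R]
    {x y : SL2 R} (hx : 0 < rowSymbol x)
    (hy : rowSymbol y < 0) : asaiCocycle x y = 0 := by
  rw [asaiCocycle, if_neg fun h => hy.not_gt h.2.1, if_neg fun h => hx.not_gt h.1]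

theorem asaiCocycle_eq_zero_of_pos {R : Type w} [CommRing R] [LinearOrder R]
    {x y : SL2 R} (hx : 0 < rowSymbol x)
    (hxy : 0 < rowSymbol (x * y)) : asaiCocycle x y = 0 := by
  rw [asaiCocycle, if_neg fun h => hxy.not_gt h.2.2, if_neg fun h => hx.not_gt h.1]

/-- The product of an upper and a lower unipotent matrix. -/
theorem exists_mul_eq {R : Type w} [CommRing R] (r : R) :
    ∃ g : SL2 R, g = upperUnip r * (weyl * upperUnip r * weyl⁻¹) ∧
    (g : Matrix (Fin 2) (Fin 2) R) = !![1 - r ^ 2, r; -r, 1] := by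
  refine ⟨_, rfl, ?_⟩
  rw [Matrix.SpecialLinearGroup.coe_mul, coe_upperUnip, coe_weyl_conj]
  ext i j
  fin_cases i <;> fin_cases j <;> simp
  ring

variable {A R : Type w} [AddCommGroup A] [CommRing R] [LinearOrder R] [IsStrictOrderedRing R]
  (c : A)

/-- The lift of the upper unipotent subgroup to the central extension. -/
def unipExt : Multiplicative R →* AsaiExt R c where
  toFun r := ⟨0, upperUnip r.toAdd⟩
  map_one' := by
    ext1
    · rfl
    · exact upperUnip_zero
  map_mul' r s := by
    ext1
    · simp [asaiCocycle_upperUnip]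
    · exact upperUnip_add _ _

theorem weyl_conj_unipExt (r : Multiplicative R) :
    MulAut.conj (⟨0, weyl⟩ : AsaiExt R c) (unipExt c r) =
      ⟨0, weyl * upperUnip r.toAdd * weyl⁻¹⟩ := by
  rw [MulAut.conj_apply]
  ext1
  · simp [unipExt, asaiCocycle_weyl_upperUnip, asaiCocycle_weyl_upperUnip_weyl_inv,
      asaiCocycle_weyl_inv_weyl]
  · rfl

theorem asaiCocycle_inv_self {x : SL2 R} (hx : 0 < rowSymbol x) : asaiCocycle x⁻¹ x = 0 := by
  have h1 : rowSymbol (1 : SL2 R) = 1 := by simp [rowSymbol]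
  rw [asaiCocycle, inv_mul_cancel, h1, if_neg fun h => zero_le_one.not_gt h.2.2,
    if_neg fun h => hx.not_gt h.2.1]

/-- For `r ≥ 2`, the square of the product of the upper and the lower unipotent with entries `r` and
`-r` winds once around the origin: its powers stay in a cone on which the cocycle vanishes, while
the first coordinate of its lift changes by `-c` in each step. -/
theorem lift_pow {r : R} (hr : 2 ≤ r) (k : ℕ) :
    ∃ g : SL2 R, ((unipExt c (.ofAdd r) *
      MulAut.conj (⟨0, weyl⟩ : AsaiExt R c) (unipExt c (.ofAdd r))) ^ 2) ^ k = ⟨-(k • c), g⟩ ∧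
      0 < rowSymbol g := by
  rw [weyl_conj_unipExt]
  obtain ⟨g, hg, hgm⟩ := exists_mul_eq r
  have e00 : g 0 0 = 1 - r ^ 2 := by rw [hgm]; rfl
  have e01 : g 0 1 = r := by rw [hgm]; rfl
  have e10 : g 1 0 = -r := by rw [hgm]; rfl
  have e11 : g 1 1 = 1 := by rw [hgm]; rfl
  have hr0 : 0 < r := by linarith
  have hr2 : 4 ≤ r ^ 2 := by nlinarith
  have hsg : rowSymbol g < 0 := by
    rw [rowSymbol, e10, if_pos (by simpa using hr0.ne')]
    linarith
  have p10 : (g * g) 1 0 = r ^ 3 - 2 * r := by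
    rw [mul_apply_one_zero, e00, e10, e11]; ring
  have p11 : (g * g) 1 1 = 1 - r ^ 2 := by
    rw [mul_apply_one_one, e01, e10, e11]; ring
  have p00 : (g * g) 0 0 = r ^ 4 - 3 * r ^ 2 + 1 := by
    rw [Matrix.SpecialLinearGroup.coe_mul, Matrix.mul_apply, Fin.sum_univ_two, e00, e01, e10]; ring
  have p01 : (g * g) 0 1 = -(r ^ 3 - 2 * r) := by
    rw [Matrix.SpecialLinearGroup.coe_mul, Matrix.mul_apply, Fin.sum_univ_two, e00, e01, e11]; ring
  have hpos : 0 < r ^ 3 - 2 * r := by nlinarith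
  have hsp : 0 < rowSymbol (g * g) := by
    rw [rowSymbol, p10, if_pos hpos.ne']; exact hpos
  have hq : (⟨0, upperUnip r⟩ * ⟨0, weyl * upperUnip r * weyl⁻¹⟩ : AsaiExt R c) ^ 2 =
      ⟨-c, g * g⟩ := by
    have hneg : rowSymbol (weyl * upperUnip r * weyl⁻¹) < 0 := by
      rw [rowSymbol, coe_weyl_conj]
      simp [hr0.ne', hr0]
    have h1 : (⟨0, upperUnip r⟩ * ⟨0, weyl * upperUnip r * weyl⁻¹⟩ : AsaiExt R c) = ⟨0, g⟩ := by
      ext1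
      · rw [CentralExt.mul_fst, asaiCocycle_eq_zero_of_pos_of_neg
          (by rw [rowSymbol_upperUnip]; exact one_pos) hneg]
        simp
      · exact hg.symm
    rw [h1, pow_two]
    ext1
    · have : asaiCocycle g g = -1 := by
        rw [asaiCocycle, if_neg fun h => h.1.not_gt hsg, if_pos ⟨hsg, hsg, hsp⟩]
      rw [CentralExt.mul_fst, this]
      simp
    · rfl
  change ∃ g', ((⟨0, upperUnip r⟩ * ⟨0, weyl * upperUnip r * weyl⁻¹⟩ : AsaiExt R c) ^ 2) ^ k =
    ⟨-(k • c), g'⟩ ∧ _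
  rw [hq]
  -- for `k ≥ 1` the lower row `(x, y)` of the `k`-th power satisfies `0 < x` and `-x ≤ y ≤ 0`
  have key : ∀ k : ℕ, ∃ p : SL2 R, (⟨-c, g * g⟩ : AsaiExt R c) ^ (k + 1) = ⟨-((k + 1) • c), p⟩ ∧
      0 < p 1 0 ∧ -p 1 0 ≤ p 1 1 ∧ p 1 1 ≤ 0 := by
    intro k
    induction k with
    | zero =>
      refine ⟨g * g, by simp, by rwa [p10], ?_, ?_⟩
      · rw [p10, p11]; nlinarith
      · rw [p11]; linarith
    | succ k ih =>
      obtain ⟨p, hp, h1, h2, h3⟩ := ih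
      have hsum : 0 < r ^ 4 - 3 * r ^ 2 + 1 - (r ^ 3 - 2 * r) := by
        nlinarith [mul_nonneg (mul_nonneg hr0.le hr0.le) (mul_nonneg (sub_nonneg.mpr hr) hr0.le),
          mul_nonneg (mul_nonneg hr0.le hr0.le) (sub_nonneg.mpr hr)]
      have q10 : (p * (g * g)) 1 0 =
          p 1 0 * (r ^ 4 - 3 * r ^ 2 + 1) + p 1 1 * (r ^ 3 - 2 * r) := by
        rw [mul_apply_one_zero, p00, p10]
      have q11 : (p * (g * g)) 1 1 =
          -(p 1 0 * (r ^ 3 - 2 * r)) + p 1 1 * (1 - r ^ 2) := by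
        rw [mul_apply_one_one, p01, p11]; ring
      have hx : 0 < (p * (g * g)) 1 0 := by
        rw [q10]
        have := mul_nonneg (neg_le_iff_add_nonneg'.mp h2) hpos.le
        have := mul_pos h1 hsum
        linarith
      have hdiff : 0 ≤ r ^ 3 - 2 * r - (r ^ 2 - 1) := by nlinarith
      refine ⟨p * (g * g), ?_, hx, ?_, ?_⟩
      · rw [pow_succ, hp]
        ext1
        · rw [CentralExt.mul_fst, asaiCocycle_eq_zero_of_pos
            (by rw [rowSymbol, if_pos h1.ne']; exact h1)
            (by rw [rowSymbol, if_pos hx.ne']; exact hx), succ_nsmul c (k + 1)]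
          simp only [zero_smul]
          abel
        · rfl
      · rw [q10, q11]
        have h4 := mul_nonneg (neg_le_iff_add_nonneg'.mp h2) hdiff
        have h5 : 0 ≤ r * (r - 2) * (r ^ 2 - 2) :=
          mul_nonneg (mul_nonneg hr0.le (by linarith)) (by linarith)
        have h6 := mul_nonneg h1.le h5
        linarith
      · rw [q11]
        have h4 := mul_nonneg (neg_le_iff_add_nonneg'.mp h2) (by linarith : 0 ≤ r ^ 2 - 1)
        have h5 := mul_nonneg h1.le hdiff
        linarith
  cases k with
  | zero =>
    refine ⟨1, ?_, by simp [rowSymbol]⟩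
    rw [pow_zero]
    ext1 <;> simp
  | succ k =>
    obtain ⟨p, hp, h1, -⟩ := key k
    exact ⟨p, hp, by rw [rowSymbol, if_pos h1.ne']; exact h1⟩

/-- Every subgroup of bounded index meets every fibre of the projection to `A` over an integral
multiple of `c`. -/
theorem exists_mem_fst_eq_zsmul (hdisc : ∀ x : R, 0 < x → 1 ≤ x) {κ : Cardinal.{w}} (hκ : ℵ₀ ≤ κ)
    (hR : κ ≤ #R) {K : Subgroup (AsaiExt R c)} (hK : #(AsaiExt R c ⧸ K) < κ) (k : ℤ) :
    ∃ e ∈ K, e.fst = k • c := by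
  have hdbl : ∃ r : R, 2 ≤ r ∧ unipExt c (.ofAdd r) ∈ K ∧
      MulAut.conj (⟨0, weyl⟩ : AsaiExt R c) (unipExt c (.ofAdd r)) ∈ K := by
    obtain ⟨s, hs, h1, h2⟩ := exists_ne_one_mem_of_mk_quotient_lt hκ hK (V := Multiplicative R) hR
      (unipExt c) ((MulAut.conj (⟨0, weyl⟩ : AsaiExt R c)).toMonoidHom.comp (unipExt c))
    rw [MonoidHom.comp_apply] at h2
    change MulAut.conj _ _ ∈ K at h2
    -- `|s| ≥ 1`, so that one of `s²`, `s⁻²` has entry at least `2`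
    rcases lt_or_gt_of_ne (show s.toAdd ≠ 0 from hs) with h | h
    · refine ⟨(s⁻¹ ^ 2).toAdd, ?_, ?_, ?_⟩
      · have := hdisc (-s.toAdd) (by linarith)
        rw [toAdd_pow, toAdd_inv, nsmul_eq_mul]
        push_cast
        linarith
      · rw [ofAdd_toAdd, map_pow, map_inv]
        exact pow_mem (inv_mem h1) 2
      · rw [ofAdd_toAdd, map_pow, map_inv, map_pow, map_inv]
        exact pow_mem (inv_mem h2) 2
    · refine ⟨(s ^ 2).toAdd, ?_, ?_, ?_⟩
      · have := hdisc s.toAdd h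
        rw [toAdd_pow, nsmul_eq_mul]
        push_cast
        linarith
      · rw [ofAdd_toAdd, map_pow]
        exact pow_mem h1 2
      · rw [ofAdd_toAdd, map_pow, map_pow]
        exact pow_mem h2 2
  obtain ⟨r, hr, h1, h2⟩ := hdbl
  have hmem := fun k : ℕ => pow_mem (pow_mem (mul_mem h1 h2) 2) k
  obtain ⟨k, rfl | rfl⟩ := k.eq_nat_or_neg
  · refine ⟨_, inv_mem (hmem k), ?_⟩
    obtain ⟨g, hg, hpos⟩ := lift_pow c hr k
    rw [hg, CentralExt.inv_fst]
    simp [asaiCocycle_inv_self hpos]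
  · refine ⟨_, hmem k, ?_⟩
    obtain ⟨g, hg, -⟩ := lift_pow c hr k
    rw [hg]
    simp

end Central

section CompatibleFamilies

theorem two_pow_factorial_modEq {n : ℕ} (hn : Odd n) {m : ℕ} (h : n ≤ m) :
    (2 : ℤ) ^ m.factorial ≡ 1 [ZMOD n] := by
  have h1 : n.totient ∣ m.factorial :=
    Nat.dvd_factorial (Nat.totient_pos.mpr hn.pos) (n.totient_le.trans h)
  obtain ⟨k, hk⟩ := h1
  have := (Nat.ModEq.pow_totient (Nat.coprime_two_left.mpr hn)).pow k
  rw [← pow_mul, ← hk, one_pow] at this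
  exact_mod_cast (Int.natCast_modEq_iff.mpr this)

/-- There is an element of the profinite completion of `ℤ` outside of `ℤ`: the limit of `2 ^ n!`,
which is `0` in the `2`-adic integers and `1` in the `p`-adic integers for odd `p`. -/
theorem exists_compatible_family : ∃ T : ℕ → ℤ,
    (∀ n n' : ℕ, n' ≠ 0 → n ∣ n' → (n : ℤ) ∣ T n' - T n) ∧
      ∀ k : ℤ, ∃ n : ℕ, n ≠ 0 ∧ ¬ (n : ℤ) ∣ T n - k := by
  have hpow : ∀ {e m : ℕ}, e ≤ m → (2 : ℤ) ^ e ∣ 2 ^ m.factorial := fun h =>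
    pow_dvd_pow _ (h.trans (Nat.self_le_factorial _))
  refine ⟨fun n => 2 ^ n.factorial, fun n n' hn' h => ?_, fun k => ?_⟩
  · have hn : n ≠ 0 := ne_zero_of_dvd_ne_zero hn' h
    have hle := Nat.le_of_dvd (Nat.pos_of_ne_zero hn') h
    obtain ⟨e, m, hm, rfl⟩ := Nat.exists_eq_two_pow_mul_odd hn
    have he : e ≤ 2 ^ e * m := (Nat.lt_two_pow_self.le).trans (Nat.le_mul_of_pos_right _ hm.pos)
    have hm' : m ≤ 2 ^ e * m := Nat.le_mul_of_pos_left _ (by positivity)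
    push_cast
    refine IsCoprime.mul_dvd ?_ (dvd_sub (hpow (he.trans hle)) (hpow he)) ?_
    · have := Nat.isCoprime_iff_coprime.mpr (Nat.coprime_two_left.mpr hm)
      exact IsCoprime.pow_left (by exact_mod_cast this)
    · exact ((two_pow_factorial_modEq hm hm').trans
        (two_pow_factorial_modEq hm (hm'.trans hle)).symm).dvd
  · by_contra! h
    have hk : k = 0 := by
      refine Int.eq_zero_of_abs_lt_dvd (m := 2 ^ k.natAbs) ?_ ?_
      · have h1 := h (2 ^ k.natAbs) (by positivity)
        push_cast at h1
        exact (dvd_sub_right (hpow Nat.lt_two_pow_self.le)).mp h1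
      · rw [Int.abs_eq_natAbs]
        exact_mod_cast Nat.lt_two_pow_self
    have := h 3 (by norm_num)
    rw [hk] at this
    norm_num [Nat.factorial] at this

end CompatibleFamilies

/-! ### Definable sets -/

section Definability

theorem IsTypeDefinableOver.of_definable {L : FirstOrder.Language.{u, v}} {M : Type w}
    [L.Structure M] {B : Set M} {X : Type w} {α : Type} {e : X → α → M} {S : Set (α → M)}
    (hS : B.Definable L S) {K : Set X} (hK : ∀ x, x ∈ K ↔ e x ∈ S) :
    IsTypeDefinableOver L B e K :=
  ⟨{S}, by simpa using hS, by ext x; simp [hK]⟩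

/-- Definable sets are invariant under automorphisms that fix the parameters. -/
theorem Set.Definable.comp_mem_iff {L : FirstOrder.Language.{u, v}} {M : Type w} [L.Structure M]
    {B : Set M} {α : Type} {S : Set (α → M)} (hS : B.Definable L S) (σ : M ≃[L] M)
    (hσ : ∀ b ∈ B, σ b = b) (v : α → M) : σ ∘ v ∈ S ↔ v ∈ S := by
  rw [Set.definable_iff_exists_formula_sum] at hS
  obtain ⟨ψ, rfl⟩ := hS
  have : σ ∘ Sum.elim (fun b : B => (b : M)) v = Sum.elim (fun b : B => (b : M)) (σ ∘ v) := by
    ext (b | i)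
    · exact hσ b b.2
    · rfl
  rw [Set.mem_ofPred_eq, Set.mem_ofPred_eq, ← this, StrongHomClass.realize_formula σ ψ]

theorem component00_le {L : FirstOrder.Language.{u, v}} {M : Type w} [L.Structure M]
    {κ : Cardinal.{w}} {B : Set M} {X : Type w} [Group X] {α : Type} {e : X → α → M}
    {K : Subgroup X} (h : IsTypeDefinableOver L B e (K : Set X)) (hK : #(X ⧸ K) < κ) :
    component00 L κ B e ≤ K := sInf_le ⟨h, hK⟩

variable {L : FirstOrder.Language.{u, v}} {φ : baseLang →ᴸ L}
  {A R : Type w} [AddCommGroup A] [CommRing R] [L.Structure (A ⊕ R)] {F : SL2 R → A → Prop}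

open TwoSorted

/-- The set of elements `a` of the first sort with `a + k c ∈ nA`. -/
def congruenceSet (A R : Type w) [AddCommGroup A] (c : A) (k : ℤ) (n : ℕ) : Set (Unit → A ⊕ R) :=
  {v | ∃ a d : A, v () = .inl a ∧ a + k • c = n • d}

theorem coordA_mem_congruenceSet {A R : Type w} [AddCommGroup A] {c : A} {k : ℤ} {n : ℕ} (a : A) :
    coordA a ∈ congruenceSet A R c k n ↔ ∃ d, a + k • c = n • d := by
  constructor
  · rintro ⟨a', d, h, h'⟩
    exact ⟨d, Sum.inl_injective h ▸ h'⟩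
  · rintro ⟨d, h⟩
    exact ⟨a, d, rfl, h⟩

theorem IsExpansionOf.definable_congruenceSet (hM : IsExpansionOf φ A R F) (c : A) (k : ℤ) (n : ℕ) :
    ({.inl c} : Set (A ⊕ R)).Definable L (congruenceSet A R c k n) := by
  convert hM.definable (α := Unit) (β := Empty) (exA Unit (eqA
    (ATerm.var (.inl ()) + (ATerm.nsmul k.toNat ATerm.const + -ATerm.nsmul (-k).toNat ATerm.const))
    (ATerm.nsmul n (ATerm.var (.inr ()))))) (fun _ => ()) Empty.elim c using 1
  have hk : k • c = k.toNat • c + -((-k).toNat • c) := by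
    rw [← natCast_zsmul, ← natCast_zsmul, ← neg_smul, ← add_smul]
    congr 1
    omega
  ext v
  constructor
  · rintro ⟨a, d, h, h'⟩
    refine ⟨fun _ => a, Empty.elim, fun _ => h, fun b => b.elim, fun _ => d, ?_⟩
    simpa [← hk] using h'
  · rintro ⟨u, w, h, -, d, h'⟩
    refine ⟨u (), d (), h (), ?_⟩
    simpa [← hk] using h'

theorem IsExpansionOf.definable_singleton_zsmul (hM : IsExpansionOf φ A R F) (c : A) (k : ℤ) :
    ({.inl c} : Set (A ⊕ R)).Definable₁ L {.inl (k • c)} := by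
  unfold Set.Definable₁
  convert (hM.definable_congruenceSet c (-k) 0).preimage_comp (fun _ : Unit => (0 : Fin 1)) using 1
  ext v
  constructor
  · intro h
    exact ⟨k • c, 0, h, by simp⟩
  · rintro ⟨a, d, h, h'⟩
    rw [zero_smul, neg_smul, ← sub_eq_add_neg, sub_eq_zero] at h'
    rw [← h']
    exact h

theorem IsExpansionOf.definable_range_inr (hM : IsExpansionOf φ A R F) (c : A) :
    ({.inl c} : Set (A ⊕ R)).Definable₁ L (Set.range Sum.inr) := by
  unfold Set.Definable₁
  convert hM.definable (α := Empty) (β := Unit) (eqR 0 0) Empty.elim (fun _ => (0 : Fin 1)) c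
    using 1
  ext v
  constructor
  · rintro ⟨r, hr⟩
    exact ⟨Empty.elim, fun _ => r, fun a => a.elim, fun _ => hr.symm, rfl⟩
  · rintro ⟨u, w, -, h, -⟩
    exact ⟨w (), (h ()).symm⟩

/-- The formula saying that a matrix has determinant one. -/
def detOne {α β : Type} (x : Fin 2 → Fin 2 → RTerm β) : TwoSorted α β :=
  eqR (x 0 0 * x 1 1 + -(x 0 1 * x 1 0)) 1

theorem realize_detOne {α β : Type} {c : A} {u : α → A} {w : β → R} (f : Fin 2 × Fin 2 → β) :
    (detOne (RTerm.matVar f)).Realize F c u w ↔ ∃ g : SL2 R, ∀ i j, g i j = w (f (i, j)) := by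
  rw [detOne, realize_eqR]
  constructor
  · intro h
    exact ⟨⟨Matrix.of fun i j => w (f (i, j)), by
      rw [Matrix.det_fin_two, sub_eq_add_neg]; exact h⟩, fun i j => rfl⟩
  · rintro ⟨g, hg⟩
    have := g.det_coe
    rw [Matrix.det_fin_two, sub_eq_add_neg, hg, hg, hg, hg] at this
    exact this

theorem coordG_mem_iff {c : A} {ψ : TwoSorted Empty (Fin 2 × Fin 2)} {x : SL2 R} :
    coordG x ∈ {v : Fin 2 × Fin 2 → A ⊕ R | ∃ (u : Empty → A) (w : Fin 2 × Fin 2 → R),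
      (∀ a, v a.elim = .inl (u a)) ∧ (∀ b, v b = .inr (w b)) ∧ ψ.Realize F c u w} ↔
      ψ.Realize F c Empty.elim fun p => x p.1 p.2 := by
  constructor
  · rintro ⟨u, w, -, h2, h⟩
    have hw : w = fun p => x p.1 p.2 := funext fun b => (Sum.inr_injective (h2 b)).symm
    rwa [hw, Subsingleton.elim u Empty.elim] at h
  · intro h
    exact ⟨_, _, fun a => a.elim, fun b => rfl, h⟩

theorem coordGA_mem_iff {c : A} {ψ : TwoSorted Unit (Fin 2 × Fin 2)} {x : SL2 R} {a : A} :
    coordGA x a ∈ {v : (Fin 2 × Fin 2) ⊕ Unit → A ⊕ R | ∃ (u : Unit → A) (w : Fin 2 × Fin 2 → R),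
      (∀ a, v (.inr a) = .inl (u a)) ∧ (∀ b, v (.inl b) = .inr (w b)) ∧ ψ.Realize F c u w} ↔
      ψ.Realize F c (fun _ => a) fun p => x p.1 p.2 := by
  constructor
  · rintro ⟨u, w, h1, h2, h⟩
    have hw : w = fun p => x p.1 p.2 := funext fun b => (Sum.inr_injective (h2 b)).symm
    have hu : u = fun _ => a := funext fun b => (Sum.inl_injective (h1 b)).symm
    rwa [hw, hu] at h
  · intro h
    exact ⟨_, _, fun a => rfl, fun b => rfl, h⟩

theorem realize_rel_entries {α : Type} {c : A} {u : α → A} {x : SL2 R} {t : ATerm α} :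
    (rel (RTerm.matVar id) t).Realize F c u (fun p => x p.1 p.2) ↔ F x (t.eval c u) :=
  realize_rel_iff c u _ (fun _ _ => rfl) t

theorem IsExpansionOf.isTypeDefinableOver_domain (hM : IsExpansionOf φ A R F) (c : A) :
    IsTypeDefinableOver L {.inl c} (coordG : SL2 R → Fin 2 × Fin 2 → A ⊕ R)
      {x | ∃ a, F x a} := by
  refine IsTypeDefinableOver.of_definable (hM.definable (α := Empty) (β := Fin 2 × Fin 2)
    (exA Unit (rel (RTerm.matVar id) (ATerm.var (.inr ())))) Empty.elim id c) fun x => ?_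
  refine Iff.trans ?_ (coordG_mem_iff (F := F) (c := c)).symm
  simp only [realize_exA, realize_rel_entries]
  exact ⟨fun ⟨a, h⟩ => ⟨fun _ => a, h⟩, fun ⟨z, h⟩ => ⟨z (), h⟩⟩

theorem IsExpansionOf.isTypeDefinableOver_congruence [LinearOrder R] [IsStrictOrderedRing R]
    (hM : IsExpansionOf φ A R F) {c : A} (hF : IsAsaiGraph F c) (n : ℕ) :
    IsTypeDefinableOver L {.inl c}
      (coordExt (isTwoCocycle_asaiCocycle_zsmul (R := R) c))
      (hF.congruence n : Set (AsaiExt R c)) := by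
  refine IsTypeDefinableOver.of_definable (hM.definable (α := Unit) (β := Fin 2 × Fin 2)
    (exA (Fin 2) (and (rel (RTerm.matVar id) (ATerm.var (.inr 0)))
      (eqA (ATerm.var (.inl ()) + ATerm.var (.inr 0)) (ATerm.nsmul n (ATerm.var (.inr 1))))))
    .inr .inl c) fun e => ?_
  refine Iff.trans ?_ (coordGA_mem_iff (F := F) (c := c)).symm
  rw [realize_exA, SetLike.mem_coe, hF.mem_congruence]
  simp only [realize_and, realize_eqA, ATerm.eval_add, ATerm.eval_nsmul, ATerm.eval_var,
    Sum.elim_inl, Sum.elim_inr, realize_rel_entries]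
  constructor
  · rintro ⟨b, h, d, h'⟩
    exact ⟨![b, d], h, h'⟩
  · rintro ⟨z, h, h'⟩
    exact ⟨z 0, h, z 1, h'⟩

theorem IsExpansionOf.definable_range_coordGA (hM : IsExpansionOf φ A R F) (c : A) :
    ({.inl c} : Set (A ⊕ R)).Definable L
      (Set.range fun p : SL2 R × A => (coordGA p.1 p.2 : (Fin 2 × Fin 2) ⊕ Unit → A ⊕ R)) := by
  convert hM.definable (α := Unit) (β := Fin 2 × Fin 2) (detOne (RTerm.matVar id)) Sum.inr
    Sum.inl c
    using 1
  ext v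
  simp only [realize_detOne, Set.mem_ofPred_eq, Set.mem_range, Prod.exists]
  constructor
  · rintro ⟨x, a, rfl⟩
    exact ⟨fun _ => a, fun p => x p.1 p.2, fun a => rfl, fun b => rfl, x, fun i j => rfl⟩
  · rintro ⟨u, w, h1, h2, g, hg⟩
    refine ⟨g, u (), ?_⟩
    ext (p | p)
    · rw [h2, ← Prod.mk.eta (p := p)]; exact congrArg Sum.inr (hg p.1 p.2)
    · exact (h1 p).symm

/-- The graph of the Asai cocycle is defined by the formula `asai`. -/
theorem cocycleGraph_asaiCocycle [LinearOrder R] [IsStrictOrderedRing R]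
    (h0 : ∀ x : R, 0 ≤ x ↔ IsSumFourSq x) (F : SL2 R → A → Prop) (c : A) :
    cocycleGraph (fun x y : SL2 R => asaiCocycle x y • c) =
      {v | ∃ (u : Unit → A) (w : (Fin 2 × Fin 2) ⊕ (Fin 2 × Fin 2) → R),
        (∀ a, v (Sum.inr (.inr a)) = .inl (u a)) ∧
        (∀ b, v (Sum.map id Sum.inl b) = .inr (w b)) ∧
        (and (and (detOne (RTerm.matVar .inl)) (detOne (RTerm.matVar .inr)))
          (asai (RTerm.matVar .inl) (RTerm.matVar .inr) (ATerm.var ()))).Realize F c u w} := by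
  ext v
  simp only [realize_and, realize_detOne, cocycleGraph, Set.mem_ofPred_eq]
  constructor
  · rintro ⟨x, y, rfl⟩
    refine ⟨fun _ => asaiCocycle x y • c, Sum.elim (fun p => x p.1 p.2) (fun p => y p.1 p.2),
      fun a => rfl, ?_, ⟨⟨x, fun i j => rfl⟩, ⟨y, fun i j => rfl⟩⟩, ?_⟩
    · rintro (b | b) <;> rfl
    · rw [realize_asai _ _ _ _ h0 (X := x) (Y := y) (fun i j => rfl) (fun i j => rfl)]
      rfl
  · rintro ⟨u, w, h1, h2, ⟨⟨x, hx⟩, ⟨y, hy⟩⟩, h⟩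
    rw [realize_asai _ _ _ _ h0 hx hy] at h
    refine ⟨x, y, ?_⟩
    ext (p | p | p)
    · exact (h2 (.inl p)).trans (congrArg Sum.inr (hx p.1 p.2).symm)
    · exact (h2 (.inr p)).trans (congrArg Sum.inr (hy p.1 p.2).symm)
    · exact (h1 p).trans (congrArg Sum.inl h)

theorem IsExpansionOf.definable_cocycleGraph [LinearOrder R] [IsStrictOrderedRing R]
    (hM : IsExpansionOf φ A R F) (h0 : ∀ x : R, 0 ≤ x ↔ IsSumFourSq x) (c : A) :
    ({.inl c} : Set (A ⊕ R)).Definable L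
      (cocycleGraph fun x y : SL2 R => asaiCocycle x y • c) := by
  rw [cocycleGraph_asaiCocycle h0 F c]
  exact hM.definable _ _ _ c

theorem coordGGA_mem_cocycleGraph {h : SL2 R → SL2 R → A} {x y : SL2 R} {a : A} :
    coordGGA x y a ∈ cocycleGraph h ↔ h x y = a := by
  constructor
  · rintro ⟨x', y', h'⟩
    have hx : x = x' := specialLinearGroup_ext_of_eq fun i j =>
      Sum.inr_injective (congrFun h' (.inl (i, j)))
    have hy : y = y' := specialLinearGroup_ext_of_eq fun i j =>
      Sum.inr_injective (congrFun h' (.inr (.inl (i, j))))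
    rw [hx, hy]
    exact (Sum.inl_injective (congrFun h' (.inr (.inr ())))).symm
  · rintro rfl
    exact ⟨x, y, rfl⟩

theorem IsExpansionOf.definable_graph (hM : IsExpansionOf φ A R F) (c : A) :
    ({.inl c} : Set (A ⊕ R)).Definable L {v | ∃ x a, F x a ∧ v = coordGA x a} := by
  convert hM.definable (α := Unit) (β := Fin 2 × Fin 2) (rel (RTerm.matVar id) (ATerm.var ()))
    Sum.inr Sum.inl c using 1
  ext v
  constructor
  · rintro ⟨x, a, h, rfl⟩
    exact ⟨fun _ => a, fun p => x p.1 p.2, fun a => rfl, fun b => rfl, x, fun i j => rfl, h⟩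
  · rintro ⟨u, w, h1, h2, x, hx, h⟩
    refine ⟨x, u (), h, ?_⟩
    ext (p | p)
    · rw [h2]; exact congrArg Sum.inr (hx p.1 p.2).symm
    · exact h1 p

theorem IsExpansionOf.definable_domain (hM : IsExpansionOf φ A R F) (c : A) :
    ({.inl c} : Set (A ⊕ R)).Definable L {v | ∃ x a, F x a ∧ v = coordG x} := by
  convert (hM.definable_graph c).image_comp (Sum.inl : Fin 2 × Fin 2 → (Fin 2 × Fin 2) ⊕ Unit)
    using 1
  ext v
  constructor
  · rintro ⟨x, a, h, rfl⟩
    exact ⟨_, ⟨x, a, h, rfl⟩, rfl⟩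
  · rintro ⟨_, ⟨x, a, h, rfl⟩, rfl⟩
    exact ⟨x, a, h, rfl⟩

variable [L.Structure (ℤ ⊕ ℤ)] {F₀ : SL2 ℤ → ℤ → Prop} {ι : (ℤ ⊕ ℤ) ↪ₑ[L] (A ⊕ R)}

theorem IsExpansionOf.mem_interpretation_cocycleGraph [LinearOrder R] [IsStrictOrderedRing R]
    (hN : IsExpansionOf φ ℤ ℤ F₀) (hM : IsExpansionOf φ A R F) {c : A} (hc : ι (.inl 1) = .inl c)
    (h0 : ∀ x : R, 0 ≤ x ↔ IsSumFourSq x) (x y : SL2 R) (a : A) :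
    asaiCocycle x y • c = a ↔
      coordGGA x y a ∈ interpretation ι (cocycleGraph (asaiCocycle : SL2 ℤ → SL2 ℤ → ℤ)) := by
  have h1 : (asaiCocycle : SL2 ℤ → SL2 ℤ → ℤ) = fun x y => asaiCocycle x y • (1 : ℤ) := by
    simp
  rw [h1, cocycleGraph_asaiCocycle (fun x => (Int.isSumFourSq_iff x).symm) F₀ 1,
    hN.mem_interpretation_iff ι hM hc]
  rw [← coordGGA_mem_cocycleGraph (h := fun x y : SL2 R => asaiCocycle x y • c),
    cocycleGraph_asaiCocycle h0 F c]
  rfl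

end Definability

/-! ### Connected components -/

section DivisibleCore

theorem mem_divisibleCore {A : Type w} [AddCommGroup A] {a : A} :
    a ∈ divisibleCore A ↔ ∀ n : ℕ, n ≠ 0 → ∃ d, a = n • d := by
  simp [divisibleCore, AddSubgroup.mem_iInf, eq_comm]

/-- If every element of `A` is congruent to one of `0, c, …, (n - 1) c` modulo `nA`, for all `n`,
then `A` has at most continuum many classes modulo its divisible core. -/
theorem mk_quotient_divisibleCore_lt {A : Type w} [AddCommGroup A] {c : A}
    (hdiv : ∀ n : ℕ, n ≠ 0 → ∀ a : A, ∃ i < n, ∃ b : A, a = n • b + i • c)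
    {κ : Cardinal.{w}} (hκ : κ.IsStrongLimit) (hκ' : ℵ₀ < κ) : #(A ⧸ divisibleCore A) < κ := by
  choose i _ b hb using hdiv
  have hlt : #(ULift.{w} (ℕ → ℕ)) < κ := by
    rw [mk_uLift, ← power_def, mk_nat, aleph0_power_aleph0, ← two_power_aleph0, lift_power,
      lift_aleph0, lift_ofNat]
    exact hκ.isStrongPrelimit hκ'
  refine lt_of_le_of_lt (mk_le_of_injective (f := fun q : A ⧸ divisibleCore A =>
    (⟨fun n => if hn : n ≠ 0 then i n hn q.out else 0⟩ : ULift.{w} (ℕ → ℕ))) fun p q h => ?_) hlt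
  rw [← QuotientAddGroup.out_eq' p, ← QuotientAddGroup.out_eq' q, QuotientAddGroup.eq,
    mem_divisibleCore]
  intro n hn
  have h := congrFun (congrArg ULift.down h) n
  simp only [dif_pos hn] at h
  refine ⟨-b n hn p.out + b n hn q.out, ?_⟩
  conv_lhs => rw [hb n hn p.out, hb n hn q.out, h]
  rw [smul_add, smul_neg]
  abel

end DivisibleCore

section Components

variable {L : FirstOrder.Language.{u, v}} {φ : baseLang →ᴸ L}
  {A R : Type w} [AddCommGroup A] [CommRing R] [L.Structure (A ⊕ R)] {F : SL2 R → A → Prop}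

theorem IsExpansionOf.isTypeDefinableOver_divisibleCore (hM : IsExpansionOf φ A R F) (c : A) :
    IsTypeDefinableOver L {.inl c} (coordA : A → Unit → A ⊕ R) (divisibleCore A : Set A) := by
  refine ⟨{S | ∃ n : ℕ, n ≠ 0 ∧ S = congruenceSet A R c 0 n}, ?_, ?_⟩
  · rintro _ ⟨n, -, rfl⟩
    exact hM.definable_congruenceSet c 0 n
  · ext a
    rw [SetLike.mem_coe, mem_divisibleCore, Set.mem_preimage, Set.mem_sInter]
    constructor
    · rintro h _ ⟨n, hn, rfl⟩
      rw [coordA_mem_congruenceSet, zero_smul, add_zero]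
      exact h n hn
    · intro h n hn
      have := h _ ⟨n, hn, rfl⟩
      rwa [coordA_mem_congruenceSet, zero_smul, add_zero] at this

variable [LinearOrder R] [IsStrictOrderedRing R]

/-- The component `E⁰⁰` of the extension lies over the component of `SL₂(R)`. -/
theorem snd_mem_component00 {κ : Cardinal.{w}} {c : A} {B : Set (A ⊕ R)} {e : AsaiExt R c}
    (he : e ∈ component00 L κ B (coordExt (isTwoCocycle_asaiCocycle_zsmul (R := R) c))) :
    e.snd ∈ component00 L κ B (coordG : SL2 R → Fin 2 × Fin 2 → A ⊕ R) := by
  rw [component00, Subgroup.mem_sInf] at he ⊢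
  rintro K ⟨⟨𝒮, h𝒮, hK⟩, hK'⟩
  refine he (K.comap (CentralExt.sndHom _)) ⟨⟨(fun S => (fun v => v ∘ Sum.inl) ⁻¹' S) '' 𝒮, ?_, ?_⟩,
    mk_quotient_comap_lt _ hK'⟩
  · rintro _ ⟨S, hS, rfl⟩
    exact (h𝒮 S hS).preimage_comp _
  · ext e
    rw [Subgroup.coe_comap, Set.mem_preimage, hK, Set.mem_preimage, Set.mem_preimage,
      Set.sInter_image, Set.mem_sInter, Set.mem_iInter₂]
    rfl

/-- By saturation, the component `E⁰⁰` contains elements with arbitrary compatible standard residues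
of the first coordinate, because every subgroup of bounded index contains elements with first
coordinate any integral multiple of `c`. -/
theorem exists_mem_component00 (hM : IsExpansionOf φ A R F) {κ : Cardinal.{w}} (hκ : ℵ₀ < κ)
    (hsat : IsSaturatedModel L (A ⊕ R) κ) (hdisc : ∀ x : R, 0 < x → 1 ≤ x) (c : A) {T : ℕ → ℤ}
    (hT : ∀ n n' : ℕ, n' ≠ 0 → n ∣ n' → (n : ℤ) ∣ T n' - T n) :
    ∃ e ∈ component00 L κ {.inl c} (coordExt (isTwoCocycle_asaiCocycle_zsmul (R := R) c)),
      ∀ n : ℕ, n ≠ 0 → ∃ d, e.fst + T n • c = n • d := by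
  have hB : #({.inl c} : Set (A ⊕ R)) < κ := by
    rw [mk_singleton]; exact one_lt_aleph0.trans hκ
  have hR : κ ≤ #R := by
    have := hsat.le_mk_of_infinite hκ.le hB (hM.definable_range_inr c)
      (Set.infinite_range_of_injective Sum.inr_injective)
    rwa [mk_range_eq _ Sum.inr_injective] at this
  let E := AsaiExt R c
  let coord : E → (Fin 2 × Fin 2) ⊕ Unit → A ⊕ R := coordExt _
  have htop : #(E ⧸ (⊤ : Subgroup E)) < κ := by
    refine lt_of_le_of_lt ?_ (one_lt_aleph0.trans hκ)
    rw [le_one_iff_subsingleton]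
    exact QuotientGroup.subsingleton_quotient_top
  -- the sets containing all elements of some `K` of bounded index with the residue prescribed
  -- modulo some `n`; a common point lies in `E⁰⁰` and has all prescribed residues
  let 𝒮 : Set (Set ((Fin 2 × Fin 2) ⊕ Unit → A ⊕ R)) :=
    {S | ({.inl c} : Set (A ⊕ R)).Definable L S ∧ ∃ K : Subgroup E, #(E ⧸ K) < κ ∧
      ∃ n : ℕ, n ≠ 0 ∧ ∀ e ∈ K, (∃ d, e.fst + T n • c = n • d) → coord e ∈ S}
  obtain ⟨v, hv⟩ := hsat.sInter_nonempty hκ.le hB (𝒮 := 𝒮) (fun S hS => hS.1)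
    ⟨Set.univ, Set.definable_univ, ⊤, htop, 1, one_ne_zero, fun _ _ _ => trivial⟩
    (by
      rintro S ⟨hS, K, hK, n, hn, h⟩ S' ⟨hS', K', hK', n', hn', h'⟩
      refine ⟨hS.inter hS', K ⊓ K', mk_quotient_inf_lt hκ.le hK hK', n * n', mul_ne_zero hn hn', ?_⟩
      rintro e ⟨he, he'⟩ ⟨d, hd⟩
      have key : ∀ m m' : ℕ, n * n' = m * m' → ∃ d, e.fst + T m • c = m • d := by
        intro m m' hm
        obtain ⟨t, ht⟩ := hT m (n * n') (mul_ne_zero hn hn') ⟨m', hm⟩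
        refine ⟨m' • d - t • c, ?_⟩
        rw [sub_eq_iff_eq_add] at ht
        rw [ht, add_smul, mul_smul, natCast_zsmul, hm, mul_smul] at hd
        rw [smul_sub, ← hd]
        abel
      exact ⟨h e he (key n n' rfl), h' e he' (key n' n (mul_comm _ _))⟩)
    (by
      rintro S ⟨-, K, hK, n, -, h⟩
      obtain ⟨e, he, hec⟩ := exists_mem_fst_eq_zsmul c hdisc hκ.le hR hK (-T n)
      exact ⟨coord e, h e he ⟨0, by rw [hec, neg_smul, neg_add_cancel, smul_zero]⟩⟩)
  obtain ⟨⟨x, a⟩, rfl⟩ : v ∈ Set.range fun p : SL2 R × A => coordGA p.1 p.2 :=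
    hv _ ⟨hM.definable_range_coordGA c, ⊤, htop, 1, one_ne_zero, fun e _ _ => ⟨(e.snd, e.fst), rfl⟩⟩
  refine ⟨⟨a, x⟩, ?_, fun n hn => ?_⟩
  · rw [component00, Subgroup.mem_sInf]
    rintro K ⟨⟨𝒮', h𝒮', hK⟩, hK'⟩
    rw [← SetLike.mem_coe, hK]
    intro S hS
    refine hv S ⟨h𝒮' S hS, K, hK', 1, one_ne_zero, fun e he _ => ?_⟩
    rw [← SetLike.mem_coe, hK] at he
    exact he S hS
  · have : coordGA x a ∈ (fun v => v ∘ Sum.inr) ⁻¹' (congruenceSet A R c (T n) n) :=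
      hv _ ⟨(hM.definable_congruenceSet c (T n) n).preimage_comp _, ⊤, htop, n, hn, fun e _ h =>
        (coordA_mem_congruenceSet e.fst).mpr h⟩
    exact (coordA_mem_congruenceSet a).mp this

/-- The splitting function takes arbitrary compatible standard residues on the component of
`SL₂(R)`. -/
theorem exists_mem_component00_graph (hM : IsExpansionOf φ A R F) {κ : Cardinal.{w}} (hκ : ℵ₀ < κ)
    (hsat : IsSaturatedModel L (A ⊕ R) κ) (hdisc : ∀ x : R, 0 < x → 1 ≤ x) {c : A}
    (hF : IsAsaiGraph F c) (hdiv : ∀ n : ℕ, n ≠ 0 → ∀ a : A, ∃ i < n, ∃ b : A, a = n • b + i • c)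
    {T : ℕ → ℤ} (hT : ∀ n n' : ℕ, n' ≠ 0 → n ∣ n' → (n : ℤ) ∣ T n' - T n) :
    ∃ x ∈ component00 L κ {.inl c} (coordG : SL2 R → Fin 2 × Fin 2 → A ⊕ R), ∃ b, F x b ∧
      ∀ n : ℕ, n ≠ 0 → ∃ d, b - T n • c = n • d := by
  obtain ⟨e, he, h⟩ := exists_mem_component00 hM hκ hsat hdisc c hT
  have hmem : ∀ n : ℕ, n ≠ 0 → ∃ b, F e.snd b ∧ ∃ d, e.fst + b = n • d := fun n hn =>
    component00_le (hM.isTypeDefinableOver_congruence hF n)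
      (hF.mk_quotient_congruence_lt hκ.le (hdiv n hn)) he
  obtain ⟨b, hb, -⟩ := hmem 1 one_ne_zero
  refine ⟨e.snd, snd_mem_component00 he, b, hb, fun n hn => ?_⟩
  obtain ⟨b', hb', d, hd⟩ := hmem n hn
  rw [hF.unique hb' hb] at hd
  obtain ⟨d', hd'⟩ := h n hn
  refine ⟨d - d', ?_⟩
  rw [smul_sub, ← hd, ← hd']
  abel

variable (R) in
/-- The elements of the extension whose first coordinate is an integral multiple of `c` modulo the
divisible core. -/
def integralPart (c : A) : Subgroup (AsaiExt R c) where
  carrier := {e | ∃ k : ℤ, e.fst - k • c ∈ divisibleCore A}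
  one_mem' := ⟨0, by simp⟩
  mul_mem' := by
    rintro e e' ⟨k, h⟩ ⟨k', h'⟩
    refine ⟨k + k' + asaiCocycle e.snd e'.snd, ?_⟩
    convert add_mem h h' using 1
    rw [CentralExt.mul_fst, add_smul, add_smul]
    abel
  inv_mem' := by
    rintro e ⟨k, h⟩
    refine ⟨-k - asaiCocycle e.snd⁻¹ e.snd, ?_⟩
    convert neg_mem h using 1
    rw [CentralExt.inv_fst, sub_smul, neg_smul]
    abel

theorem mk_quotient_integralPart_le (c : A) :
    #(AsaiExt R c ⧸ integralPart R c) ≤ #(A ⧸ divisibleCore A) := by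
  refine mk_quotient_le_of_injective (fun e => QuotientAddGroup.mk e.fst) fun e e' h => ?_
  rw [QuotientAddGroup.eq] at h
  refine ⟨asaiCocycle e.snd⁻¹ e'.snd - asaiCocycle e.snd⁻¹ e.snd, ?_⟩
  convert h using 1
  rw [CentralExt.mul_fst, CentralExt.inv_fst, CentralExt.inv_snd, sub_smul]
  abel

/-- For every integer `k`, the condition that the first coordinate is `k c` modulo the divisible
core is an intersection of definable conditions. -/
theorem isInvariantOver_integralPart (hM : IsExpansionOf φ A R F) (c : A) :
    IsInvariantOver L {.inl c} (coordExt (isTwoCocycle_asaiCocycle_zsmul (R := R) c))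
      (integralPart R c : Set (AsaiExt R c)) := by
  rintro σ hσ e e' h ⟨k, hk⟩
  refine ⟨k, mem_divisibleCore.mpr fun n hn => ?_⟩
  obtain ⟨d, hd⟩ := mem_divisibleCore.mp hk n hn
  have h1 : coordA e.fst ∈ congruenceSet A R c (-k) n := by
    rw [coordA_mem_congruenceSet, neg_smul, ← sub_eq_add_neg]
    exact ⟨d, hd⟩
  rw [← (hM.definable_congruenceSet c (-k) n).comp_mem_iff σ hσ] at h1
  have h2 : coordA e'.fst = σ ∘ coordA e.fst := congrArg (fun v => v ∘ Sum.inr) h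
  rwa [← h2, coordA_mem_congruenceSet, neg_smul, ← sub_eq_add_neg] at h1

/-- `E⁰⁰⁰` lies in `integralPart`, while `E⁰⁰` has an element whose residues do not come from an
integer. -/
theorem component000_ne_component00 (hM : IsExpansionOf φ A R F) {κ : Cardinal.{w}} (hκ : ℵ₀ < κ)
    (hsat : IsSaturatedModel L (A ⊕ R) κ) (hdisc : ∀ x : R, 0 < x → 1 ≤ x) {c : A}
    (hcore : #(A ⧸ divisibleCore A) < κ)
    (hdvd : ∀ {n : ℕ} {m : ℤ} {b : A}, n • b = m • c → (n : ℤ) ∣ m) :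
    component000 L κ {.inl c} (coordExt (isTwoCocycle_asaiCocycle_zsmul (R := R) c)) ≠
      component00 L κ {.inl c} (coordExt (isTwoCocycle_asaiCocycle_zsmul (R := R) c)) := by
  intro heq
  obtain ⟨T, hT, hT'⟩ := exists_compatible_family
  obtain ⟨e, he, h⟩ := exists_mem_component00 hM hκ hsat hdisc c hT
  rw [← heq] at he
  have hle : component000 L κ {.inl c} (coordExt (isTwoCocycle_asaiCocycle_zsmul (R := R) c)) ≤
      integralPart R c :=
    sInf_le ⟨isInvariantOver_integralPart hM c, (mk_quotient_integralPart_le c).trans_lt hcore⟩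
  obtain ⟨k, hk⟩ := hle he
  obtain ⟨n, hn, hnk⟩ := hT' (-k)
  obtain ⟨d, hd⟩ := h n hn
  obtain ⟨d', hd'⟩ := mem_divisibleCore.mp hk n hn
  refine hnk (hdvd (b := d - d') ?_)
  rw [smul_sub, ← hd, ← hd', sub_smul, neg_smul]
  abel

end Components

/-! ### The standard model and the conclusion -/

section Standard

theorem asaiCocycle_mem {R : Type w} [CommRing R] [LinearOrder R] (x y : SL2 R) :
    asaiCocycle x y ∈ ({1, -1, 0} : Set ℤ) := by
  unfold asaiCocycle
  split_ifs <;> simp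

theorem exists_asaiSplittingGraph {g : SL2 ℤ} (hg : g ∈ commutator (SL2 ℤ)) :
    ∃ n, asaiSplittingGraph g n := by
  obtain ⟨n, hn⟩ := splitsVia_asaiSplitting.asai_exists_int hg
  exact ⟨n, hg, hn⟩

/-- The restriction of the splitting function to the commutator subgroup, with integral values. -/
noncomputable def asaiSplittingInt (g : commutator (SL2 ℤ)) : ℤ :=
  (exists_asaiSplittingGraph g.2).choose

theorem asaiSplittingGraph_iff {g : SL2 ℤ} {n : ℤ} :
    asaiSplittingGraph g n ↔ ∃ hg : g ∈ commutator (SL2 ℤ), asaiSplittingInt ⟨g, hg⟩ = n := by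
  constructor
  · intro h
    exact ⟨h.1, isAsaiGraph_asaiSplittingGraph.unique (exists_asaiSplittingGraph h.1).choose_spec h⟩
  · rintro ⟨hg, rfl⟩
    exact (exists_asaiSplittingGraph hg).choose_spec

theorem cast_asaiSplittingInt (g : commutator (SL2 ℤ)) :
    (asaiSplittingInt g : ℝ) = asaiSplitting g :=
  (exists_asaiSplittingGraph g.2).choose_spec.2.symm

theorem splitsVia_asaiSplittingInt :
    SplitsVia (fun x y : commutator (SL2 ℤ) => asaiCocycle (x : SL2 ℤ) (y : SL2 ℤ))
      asaiSplittingInt := by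
  have h := splitsVia_asaiSplitting
  constructor
  · intro x y
    have := h.1 x y
    rw [← Subgroup.coe_mul, ← cast_asaiSplittingInt, ← cast_asaiSplittingInt,
      ← cast_asaiSplittingInt] at this
    beta_reduce at this ⊢
    exact_mod_cast this
  · have := h.2
    rw [← Subgroup.coe_one (commutator (SL2 ℤ)), ← cast_asaiSplittingInt] at this
    exact_mod_cast this

end Standard

section TorsionFree

variable {A : Type w} [AddCommGroup A] {c : A}

theorem zsmul_mem_divisibleCore_iff (hdvd : ∀ {n : ℕ} {m : ℤ} {b : A}, n • b = m • c → (n : ℤ) ∣ m)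
    {k : ℤ} : k • c ∈ divisibleCore A ↔ k = 0 := by
  constructor
  · intro h
    obtain ⟨d, hd⟩ := mem_divisibleCore.mp h (k.natAbs + 1) (Nat.succ_ne_zero _)
    refine Int.eq_zero_of_abs_lt_dvd (hdvd hd.symm) ?_
    rw [Int.abs_eq_natAbs]
    push_cast
    exact lt_add_one _
  · rintro rfl
    rw [zero_smul]
    exact zero_mem _

theorem isAddTorsionFree_quotient_divisibleCore
    (hdvd : ∀ {n : ℕ} {m : ℤ} {b : A}, n • b = m • c → (n : ℤ) ∣ m) {A₀ : AddSubgroup A}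
    (hA : A₀ ≤ AddSubgroup.zmultiples c) :
    IsAddTorsionFree (A₀ ⧸ (divisibleCore A).addSubgroupOf A₀) := by
  refine ⟨fun n hn p q h => ?_⟩
  induction p using QuotientAddGroup.induction_on with | H x =>
  induction q using QuotientAddGroup.induction_on with | H y =>
  obtain ⟨k, hk⟩ := hA (-x + y).2
  have h' : n • (-x + y) ∈ (divisibleCore A).addSubgroupOf A₀ := by
    have : ((n • x : A₀) : A₀ ⧸ (divisibleCore A).addSubgroupOf A₀) = (n • y : A₀) := h
    rwa [QuotientAddGroup.eq, ← smul_neg, ← smul_add] at this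
  have hk0 : k = 0 := by
    rw [AddSubgroup.mem_addSubgroupOf, AddSubgroup.coe_nsmul, ← hk] at h'
    change n • k • c ∈ _ at h'
    rw [← natCast_zsmul, ← mul_smul, zsmul_mem_divisibleCore_iff hdvd] at h'
    exact (mul_eq_zero.mp h').resolve_left (by exact_mod_cast hn)
  rw [QuotientAddGroup.eq, AddSubgroup.mem_addSubgroupOf, ← hk, hk0]
  change (0 : ℤ) • c ∈ _
  rw [zero_smul]
  exact zero_mem _

end TorsionFree

theorem IsExpansionOf.imageSubgroup_le {L : FirstOrder.Language.{u, v}} {φ : baseLang →ᴸ L}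
    [L.Structure (ℤ ⊕ ℤ)] {F₀ : SL2 ℤ → ℤ → Prop} (hN : IsExpansionOf φ ℤ ℤ F₀)
    {A R : Type w} [AddCommGroup A] [CommRing R] [L.Structure (A ⊕ R)] {F : SL2 R → A → Prop}
    (hM : IsExpansionOf φ A R F) {ι : (ℤ ⊕ ℤ) ↪ₑ[L] (A ⊕ R)} {c : A} (hc : ι (.inl 1) = .inl c) :
    imageSubgroup ι ≤ AddSubgroup.zmultiples c := by
  refine (AddSubgroup.closure_le _).mpr ?_
  rintro a ⟨x, y, h⟩
  rw [hN.map_inl ι hM hc] at h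
  exact ⟨asaiCocycle x y, Sum.inl_injective h⟩

/-- `hN`: the `L`-structure on `ℤ ⊕ ℤ` is an arbitrary expansion `𝒢` of `((ℤ,+), (ℤ,+,·), f|H)`.
`A ⊕ R`, with the elementary embedding `ι`, is a monster model `𝒢*` of degree `κ`, and `fs` is the
graph of the interpretation `f*` of `f|H` in it. -/
theorem mainTheorem10 {L : FirstOrder.Language.{u, v}} (φ : baseLang →ᴸ L) [L.Structure (ℤ ⊕ ℤ)]
    (hN : IsExpansionOf φ ℤ ℤ asaiSplittingGraph)
    {A R : Type w} [AddCommGroup A] [CommRing R] [L.Structure (A ⊕ R)] (fs : SL2 R → A → Prop)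
    (hM : IsExpansionOf φ A R fs)
    (ι : (ℤ ⊕ ℤ) ↪ₑ[L] (A ⊕ R)) (κ : Cardinal.{w}) (hκ : IsMonster L (A ⊕ R) κ) :
    -- `h` is a 2-cocycle on `SL₂(ℤ)`, split over `ℝ` via exactly one function `f`
    IsTwoCocycle (asaiCocycle : SL2 ℤ → SL2 ℤ → ℤ) ∧
    (∃! f : SL2 ℤ → ℝ, SplitsVia (fun x y : SL2 ℤ => (asaiCocycle x y : ℝ)) f) ∧
    -- `h` has finite image, contained in `dcl(B)`, and is `B`-definable, for `B = {1}`
    (Set.range fun p : SL2 ℤ × SL2 ℤ => asaiCocycle p.1 p.2).Finite ∧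
    (∀ x y : SL2 ℤ, ({.inl 1} : Set (ℤ ⊕ ℤ)).Definable₁ L {.inl (asaiCocycle x y)}) ∧
    ({.inl 1} : Set (ℤ ⊕ ℤ)).Definable L (cocycleGraph (asaiCocycle : SL2 ℤ → SL2 ℤ → ℤ)) ∧
    -- (1) `H = [SL₂(ℤ), SL₂(ℤ)]` is `B`-definable of finite index, and `h|H×H : H × H → ℤ` is split
    -- via the `B`-definable function `f|H`
    (commutator (SL2 ℤ)).FiniteIndex ∧
    ({.inl 1} : Set (ℤ ⊕ ℤ)).Definable L
      {v : Fin 2 × Fin 2 → ℤ ⊕ ℤ | ∃ g ∈ commutator (SL2 ℤ), v = coordG g} ∧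
    (∃ fH : commutator (SL2 ℤ) → ℤ,
      (∀ g : commutator (SL2 ℤ), (fH g : ℝ) = asaiSplitting g) ∧
      ({.inl 1} : Set (ℤ ⊕ ℤ)).Definable L {v | ∃ g : commutator (SL2 ℤ), v = coordGA (g : SL2 ℤ) (fH g)} ∧
      SplitsVia (fun x y : commutator (SL2 ℤ) => asaiCocycle (x : SL2 ℤ) (y : SL2 ℤ)) fH) ∧
    -- `A₁*` is type-definable over `B` and of bounded index in `A*`
    IsTypeDefinableOver L {ι (.inl 1)} (coordA : A → Unit → A ⊕ R) (divisibleCore A : Set A) ∧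
    #(A ⧸ divisibleCore A) < κ ∧
    -- (2) `A₀ / (A₁* ∩ A₀)` is torsion free
    IsAddTorsionFree (imageSubgroup ι ⧸ (divisibleCore A).addSubgroupOf (imageSubgroup ι)) ∧
    -- `f*` is defined on the component `G*⁰⁰_B` of `G* = SL₂(R)`
    (∀ g ∈ component00 L κ {ι (.inl 1)} (coordG : SL2 R → Fin 2 × Fin 2 → A ⊕ R),
      ∃! a : A, fs g a) ∧
    -- (4) the image of `G*⁰⁰_B` in `A* / A₁*` contains a non-trivial subgroup
    (∃ S : AddSubgroup (A ⧸ divisibleCore A), S ≠ ⊥ ∧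
      (S : Set (A ⧸ divisibleCore A)) ⊆ inducedImage fs (divisibleCore A)
        (component00 L κ {ι (.inl 1)} (coordG : SL2 R → Fin 2 × Fin 2 → A ⊕ R))) ∧
    -- (3) the image of `G*⁰⁰_B` in `A* / A₁*` is not contained in `A₀ / A₁*`
    ¬ (inducedImage fs (divisibleCore A)
        (component00 L κ {ι (.inl 1)} (coordG : SL2 R → Fin 2 × Fin 2 → A ⊕ R)) ⊆
      ((imageSubgroup ι).map (QuotientAddGroup.mk' (divisibleCore A)) :
        Set (A ⧸ divisibleCore A))) ∧
    -- the interpretation `h*` of `h` is a 2-cocycle on `G*`, and in the extension of `G*` by `A*`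
    -- defined by `h*` the two connected components over `B` are different
    ∃ (hs : SL2 R → SL2 R → A) (hc : IsTwoCocycle hs),
      (∀ x y a, hs x y = a ↔
        coordGGA x y a ∈ interpretation ι (cocycleGraph (asaiCocycle : SL2 ℤ → SL2 ℤ → ℤ))) ∧
      component000 L κ {ι (.inl 1)} (coordExt hc) ≠ component00 L κ {ι (.inl 1)} (coordExt hc) := by
  obtain ⟨c, hc⟩ := hN.exists_inl (ι := ι) hM
  obtain ⟨_, _, h0⟩ := hN.exists_linearOrder hM hc
  have hF := hN.isAsaiGraph hM hc h0 isAsaiGraph_asaiSplittingGraph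
  have hdvd : ∀ {n : ℕ} {m : ℤ} {b : A}, n • b = m • c → (n : ℤ) ∣ m := hN.dvd_of_nsmul_eq hM hc
  have hdiv : ∀ n : ℕ, n ≠ 0 → ∀ a : A, ∃ i < n, ∃ b : A, a = n • b + i • c :=
    fun n hn => hN.exists_nsmul_add hM hc hn
  have hdisc : ∀ x : R, 0 < x → 1 ≤ x := fun x => hN.one_le_of_pos hM hc h0
  have hcore := mk_quotient_divisibleCore_lt hdiv hκ.strongLimit hκ.aleph0_lt
  have hA₀ := hN.imageSubgroup_le hM hc
  rw [hc]
  refine ⟨isTwoCocycle_asaiCocycle, existsUnique_splitsVia, ?_, ?_, ?_, finiteIndex_commutator, ?_,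
    ⟨asaiSplittingInt, cast_asaiSplittingInt, ?_, splitsVia_asaiSplittingInt⟩,
    hM.isTypeDefinableOver_divisibleCore c, hcore, isAddTorsionFree_quotient_divisibleCore hdvd hA₀,
    ?_, ?_, ?_, fun x y => asaiCocycle x y • c, isTwoCocycle_asaiCocycle_zsmul c,
    hN.mem_interpretation_cocycleGraph hM hc h0,
    component000_ne_component00 hM hκ.aleph0_lt hκ.saturated hdisc hcore hdvd⟩
  · exact (Set.toFinite {1, -1, 0}).subset
      (Set.range_subset_iff.mpr fun p => asaiCocycle_mem p.1 p.2)
  · intro x y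
    simpa using hN.definable_singleton_zsmul 1 (asaiCocycle x y)
  · simpa using hN.definable_cocycleGraph (fun x => (Int.isSumFourSq_iff x).symm) 1
  · convert hN.definable_domain 1 using 1
    ext v
    constructor
    · rintro ⟨g, hg, rfl⟩
      obtain ⟨n, hn⟩ := exists_asaiSplittingGraph hg
      exact ⟨g, n, hn, rfl⟩
    · rintro ⟨g, n, hn, rfl⟩
      exact ⟨g, hn.1, rfl⟩
  · convert hN.definable_graph 1 using 1
    ext v
    simp only [asaiSplittingGraph_iff, Set.mem_ofPred_eq]
    constructor
    · rintro ⟨g, rfl⟩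
      exact ⟨g, _, ⟨g.2, rfl⟩, rfl⟩
    · rintro ⟨g, n, ⟨hg, rfl⟩, rfl⟩
      exact ⟨⟨g, hg⟩, rfl⟩
  · intro g hg
    obtain ⟨a, ha⟩ := component00_le (K := hF.domain) (hM.isTypeDefinableOver_domain c)
      (hF.mk_quotient_domain_lt hκ.aleph0_lt.le) hg
    exact ⟨a, ha, fun b hb => hF.unique hb ha⟩
  · refine ⟨AddSubgroup.zmultiples (QuotientAddGroup.mk c), ?_, ?_⟩
    · rw [Ne, AddSubgroup.zmultiples_eq_bot, QuotientAddGroup.eq_zero_iff, ← one_smul ℤ c,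
        zsmul_mem_divisibleCore_iff hdvd]
      exact one_ne_zero
    · rintro _ ⟨k, rfl⟩
      -- the constant family of residues of `k`
      obtain ⟨x, hx, b, hb, h⟩ := exists_mem_component00_graph hM hκ.aleph0_lt hκ.saturated hdisc hF
        hdiv (T := fun _ => k) (by simp)
      refine ⟨x, hx, b, hb, ?_⟩
      change _ = k • QuotientAddGroup.mk' _ c
      rw [← map_zsmul, QuotientAddGroup.mk'_apply, eq_comm, QuotientAddGroup.eq, neg_add_eq_sub]
      exact mem_divisibleCore.mpr h
  · intro hsub
    obtain ⟨T, hT, hT'⟩ := exists_compatible_family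
    obtain ⟨x, hx, b, hb, h⟩ := exists_mem_component00_graph hM hκ.aleph0_lt hκ.saturated hdisc hF
      hdiv hT
    obtain ⟨a, ha, hab⟩ := hsub ⟨x, hx, b, hb, rfl⟩
    obtain ⟨k, rfl⟩ := hA₀ ha
    rw [QuotientAddGroup.mk'_apply, QuotientAddGroup.eq] at hab
    obtain ⟨n, hn, hnk⟩ := hT' k
    obtain ⟨d, hd⟩ := h n hn
    obtain ⟨d', hd'⟩ := mem_divisibleCore.mp hab n hn
    refine hnk (hdvd (b := d' - d) ?_)
    rw [smul_sub, ← hd, ← hd', sub_smul]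
    change -(k • c) + b - (b - T n • c) = _
    abel
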